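/- **Theorem 4.** Let $K\ge 1$, $T>0$, and let the network be the union of $K$ copies $\overline{I_i}=(-\infty,0]$, $i=1,\dots,K$, glued at $0$. Consider the Cauchy problem with Kirchhoff junction condition $$u_t+H_i(u_{x_i})-f_i(t,x)=0 \ \text{ in } I_i\times(0,T),\qquad \sum_{i=1}^K u_{x_i}=0\ \text{ on }\{0\}\times(0,T),\qquad u(\cdot,0)=u_0,$$ in the viscosity sense: the edge inequality $\varphi_t+H_i(\varphi_{x_i})-f_i\le 0$ (resp. $\ge 0$) is required at every local maximum (resp. minimum) point $(x,t)$, $t\in(0,T]$, $x\in I_i$, of $u-\varphi$ on the network times $[0,T]$, and at such points with $x=0$ one requires $\min\{\sum_i\varphi_{x_i}(0,t),\ \varphi_t(0,t)+\min_i (H_i(\varphi_{x_i}(0,t))-f_i(t,0))\}\le 0$ (resp. $\max\{\sum_i\varphi_{x_i}(0,t),\ \varphi_t(0,t)+\max_i (H_i(\varphi_{x_i}(0,t))-f_i(t,0))\}\ge 0$), for every continuous $\varphi$ that is $C^1$ on each $\overline{I_i}\times[0,T]$. Assume that the Hamiltonians $H_i(t,x,p)=H_i(p)-f_i(t,x)$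 are uniformly Lipschitz on $[0,T]\times\overline{I_i}\times[-R,R]$ for every $R>0$; that $H_i(t,x,p)\to\infty$ as $|p|\to\infty$, uniformly in $(t,x)$; that for every $R>0$ there is $C_R>0$ with $|H_i(t,x,p)-H_i(s,y,p)|\le C_R(1+|p|)(|x-y|+|t-s|)$ for $|p|\le R$; and that $u_0$ is Lipschitz on the network with constant $\ell$. Let $\lambda$ be a Lipschitz constant in time of the $f_i$, and let $M$ be a constant with $$M\ \ge\ \sup\{|H_i(p)-f_i(t,x)| : 1\le i\le K,\ |p|\le\ell,\ t\in[0,T],\ x\le 0\}+T\lambda .$$ Let $G_1,\dots,G_K:\mathbb R^2\to\mathbb R$ satisfy $|G_i(p_1,p_2)-G_i(q_1,q_2)|\le L_1(|p_1-q_1|+|p_2-q_2|)$ and $G_i(p,p)=\min\{H_i(p),\,M+\sup|f_i|+1\}$, and let $L_2\in\mathbb R$. Let $u$ be the uniformly continuous viscosity solution of the Cauchy problem. Then there are $C>0$ and $\delta>0$ such that the following holds for all $\varepsilon,\Delta x,\Delta t>0$ with $\Delta x<\delta$ and $$4L_1\le\frac{2\varepsilon}{\Delta x}\le\frac{\Delta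 x}{\Delta t}\le L_2$$ for which the scheme below is monotone, i.e. for which each map $(a,b,c)\mapsto b-\Delta t\,F_i\!\left(\frac{a-b}{\Delta x},\frac{b-c}{\Delta x}\right)$, where $F_i(p_1,p_2)=-\frac{\varepsilon}{\Delta x}(p_1-p_2)+G_i(p_1,p_2)$, is nondecreasing in $a$, $b$ and $c$. Put $N=\lceil T/\Delta t\rceil$, let $J_i=\{0,1,2,\dots\}$, glue these sets at $0$, write $1_i$ for $1\in J_i$, and let $U:\bigcup_i J_i\times\{0,\dots,N\}\to\mathbb R$ solve the explicit scheme $$\frac{U(m,s+1)-U(m,s)}{\Delta t}+F_i\!\left(\frac{U(m-1,s)-U(m,s)}{\Delta x},\frac{U(m,s)-U(m+1,s)}{\Delta x}\right)=f_i(s\Delta t,-m\Delta x)\quad (m\in J_i\setminus\{0\},\ 0\le s<N),$$ $$U(0,s)=\frac1K\sum_{i=1}^K U(1_i,s)\quad(1\le s\le N),\qquad U(m,0)=u_0(-m\Delta x)\quad (m\in J_i).$$ Then, for all $i$, all $m\in J_i$ and all $s\in\{0,\dots,N\}$ with $s\Delta t\le T$, with $-m\Delta x$ taken on the edge $\overline{I_i}$,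 $$|U(m,s)-u(-m\Delta x,s\Delta t)|\le C\,\Delta x^{1/6}.$$ -/

import Mathlib

open Set

namespace KirchhoffHJ

/-!
The network is the union of `K` copies of the half-line `(-∞, 0]`, glued at `0`.  A function on
the network is a family `v : Fin K → ℝ → ℝ`, where `v i x` (only `x ≤ 0` matters) is the value at
the point `x` of the `i`-th edge, and the values `v i 0` do not depend on `i`.  In the same way a
function on network × `[0, T]` is a family `u i x t`, with `u i 0 t` independent of `i`.
-/

/-- The space-time domain `(-∞, 0] × [0, T]` over one closed edge. -/
def edgeDomain (T : ℝ) : Set (ℝ × ℝ) := Iic 0 ×ˢ Icc 0 T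

/-! ### Hamiltonians.  `h i t x p` is the Hamiltonian of the `i`-th edge. -/

/-- Hamiltonians in separated form: `h i t x p = H i p - f i t x`. -/
def separated {K : ℕ} (H : Fin K → ℝ → ℝ) (f : Fin K → ℝ → ℝ → ℝ) (i : Fin K) (t x p : ℝ) : ℝ :=
  H i p - f i t x

/-- For every `R > 0` each Hamiltonian is uniformly Lipschitz on `[0, T] × (-∞, 0] × [-R, R]`. -/
def HamLocallyLipschitz {K : ℕ} (T : ℝ) (h : Fin K → ℝ → ℝ → ℝ → ℝ) : Prop :=
  ∀ i : Fin K, ∀ R : ℝ, 0 < R → ∃ c : ℝ, ∀ t ∈ Icc 0 T, ∀ s ∈ Icc 0 T, ∀ x ≤ 0, ∀ y ≤ 0,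
    ∀ p q : ℝ, |p| ≤ R → |q| ≤ R →
      |h i t x p - h i s y q| ≤ c * (|t - s| + |x - y| + |p - q|)

/-- `h i t x p → ∞` as `|p| → ∞`, uniformly in `(t, x)`. -/
def HamCoercive {K : ℕ} (T : ℝ) (h : Fin K → ℝ → ℝ → ℝ → ℝ) : Prop :=
  ∀ i : Fin K, ∀ A : ℝ, ∃ R : ℝ, ∀ t ∈ Icc 0 T, ∀ x ≤ 0, ∀ p : ℝ, R ≤ |p| → A ≤ h i t x p

/-- `|h i t x p - h i s y p| ≤ C_R (1 + |p|) (|x - y| + |t - s|)` for `|p| ≤ R`. -/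
def HamLipschitzSpaceTime {K : ℕ} (T : ℝ) (h : Fin K → ℝ → ℝ → ℝ → ℝ) : Prop :=
  ∀ R : ℝ, 0 < R → ∃ c : ℝ, 0 < c ∧ ∀ i : Fin K, ∀ t ∈ Icc 0 T, ∀ s ∈ Icc 0 T,
    ∀ x ≤ 0, ∀ y ≤ 0, ∀ p : ℝ, |p| ≤ R →
      |h i t x p - h i s y p| ≤ c * (1 + |p|) * (|x - y| + |t - s|)

/-- `v` is a function on the network that is Lipschitz with constant `ℓ`. -/
def IsNetworkLipschitz {K : ℕ} (ℓ : ℝ) (v : Fin K → ℝ → ℝ) : Prop :=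
  (∀ i j : Fin K, v i 0 = v j 0) ∧
  ∀ i : Fin K, ∀ x ≤ 0, ∀ y ≤ 0, |v i x - v i y| ≤ ℓ * |x - y|

/-! ### Viscosity solutions -/

/-- A test function: a continuous function on network × `[0, T]` which is `C¹` up to the boundary
on every closed edge; `dx` and `dt` are its partial derivatives (one-sided at `x = 0` and at
`t = 0, T`).  No relation is imposed between the slopes `dx i 0 t` of different edges. -/
structure TestFunction (K : ℕ) (T : ℝ) where
  /-- the function -/
  val : Fin K → ℝ → ℝ → ℝ
  /-- the space derivative -/
  dx : Fin K → ℝ → ℝ → ℝ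
  /-- the time derivative -/
  dt : Fin K → ℝ → ℝ → ℝ
  glue : ∀ i j : Fin K, ∀ t ∈ Icc 0 T, val i 0 t = val j 0 t
  continuousOn_val : ∀ i : Fin K,
    ContinuousOn (fun z : ℝ × ℝ => val i z.1 z.2) (edgeDomain T)
  hasDeriv_dx : ∀ i : Fin K, ∀ x ≤ 0, ∀ t ∈ Icc 0 T,
    HasDerivWithinAt (fun y => val i y t) (dx i x t) (Iic 0) x
  hasDeriv_dt : ∀ i : Fin K, ∀ x ≤ 0, ∀ t ∈ Icc 0 T,
    HasDerivWithinAt (fun s => val i x s) (dt i x t) (Icc 0 T) t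
  continuousOn_dx : ∀ i : Fin K,
    ContinuousOn (fun z : ℝ × ℝ => dx i z.1 z.2) (edgeDomain T)
  continuousOn_dt : ∀ i : Fin K,
    ContinuousOn (fun z : ℝ × ℝ => dt i z.1 z.2) (edgeDomain T)

/-- The difference `u - φ` on the `i`-th edge, as a function of `(x, t)`. -/
def TestFunction.diff {K : ℕ} {T : ℝ} (φ : TestFunction K T) (u : Fin K → ℝ → ℝ → ℝ)
    (i : Fin K) (z : ℝ × ℝ) : ℝ :=
  u i z.1 z.2 - φ.val i z.1 z.2

/-- Viscosity sub-solution of `u_t + h i (t, x, u_x) = 0` on the edges with the Kirchhoff condition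
`∑ i, u_{x_i} = 0` at the junction.  A local maximum at `(0, t)` over the network is a local
maximum over each of the (finitely many) closed edges. -/
def IsSubsolution {K : ℕ} (T : ℝ) (h : Fin K → ℝ → ℝ → ℝ → ℝ) (u : Fin K → ℝ → ℝ → ℝ) : Prop :=
  ∀ φ : TestFunction K T,
    (∀ i : Fin K, ∀ x < 0, ∀ t ∈ Ioc 0 T,
      IsLocalMaxOn (φ.diff u i) (edgeDomain T) (x, t) →
        φ.dt i x t + h i t x (φ.dx i x t) ≤ 0) ∧
    (∀ t ∈ Ioc 0 T,
      (∀ i : Fin K, IsLocalMaxOn (φ.diff u i) (edgeDomain T) (0, t)) →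
        ∑ i : Fin K, φ.dx i 0 t ≤ 0 ∨ ∃ i : Fin K, φ.dt i 0 t + h i t 0 (φ.dx i 0 t) ≤ 0)

/-- Viscosity super-solution of the same problem. -/
def IsSupersolution {K : ℕ} (T : ℝ) (h : Fin K → ℝ → ℝ → ℝ → ℝ) (u : Fin K → ℝ → ℝ → ℝ) : Prop :=
  ∀ φ : TestFunction K T,
    (∀ i : Fin K, ∀ x < 0, ∀ t ∈ Ioc 0 T,
      IsLocalMinOn (φ.diff u i) (edgeDomain T) (x, t) →
        0 ≤ φ.dt i x t + h i t x (φ.dx i x t)) ∧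
    (∀ t ∈ Ioc 0 T,
      (∀ i : Fin K, IsLocalMinOn (φ.diff u i) (edgeDomain T) (0, t)) →
        0 ≤ ∑ i : Fin K, φ.dx i 0 t ∨ ∃ i : Fin K, 0 ≤ φ.dt i 0 t + h i t 0 (φ.dx i 0 t))

/-- `u` is a uniformly continuous viscosity solution on network × `[0, T]` of the Cauchy problem
with Hamiltonians `h`, Kirchhoff junction condition and initial datum `u₀`. -/
structure IsCauchySolution {K : ℕ} (T : ℝ) (h : Fin K → ℝ → ℝ → ℝ → ℝ) (u₀ : Fin K → ℝ → ℝ)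
    (u : Fin K → ℝ → ℝ → ℝ) : Prop where
  glue : ∀ i j : Fin K, ∀ t ∈ Icc 0 T, u i 0 t = u j 0 t
  uniformContinuousOn : ∀ i : Fin K,
    UniformContinuousOn (fun z : ℝ × ℝ => u i z.1 z.2) (edgeDomain T)
  subsolution : IsSubsolution T h u
  supersolution : IsSupersolution T h u
  initial : ∀ i : Fin K, ∀ x ≤ 0, u i x 0 = u₀ i x

/-! ### The finite-difference scheme.  The node `m` of the `i`-th discretized edge is the point
`-m Δx`, and the discrete time `s` is the time `s Δt`. -/

/-- `D⁺V(m) = (V(m - 1) - V(m)) / Δx`, used for `m ≥ 1` only. -/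
noncomputable def Dplus (Δx : ℝ) (V : ℕ → ℝ) (m : ℕ) : ℝ := (V (m - 1) - V m) / Δx

/-- `D⁻V(m) = (V(m) - V(m + 1)) / Δx`. -/
noncomputable def Dminus (Δx : ℝ) (V : ℕ → ℝ) (m : ℕ) : ℝ := (V m - V (m + 1)) / Δx

/-- `F(p₁, p₂) = -(ε / Δx) (p₁ - p₂) + G(p₁, p₂)`. -/
noncomputable def numF (ε Δx : ℝ) (G : ℝ → ℝ → ℝ) (p₁ p₂ : ℝ) : ℝ :=
  -(ε / Δx) * (p₁ - p₂) + G p₁ p₂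

/-- The number of time steps, `N = ⌈T / Δt⌉`. -/
noncomputable def numSteps (T Δt : ℝ) : ℕ := ⌈T / Δt⌉₊

/-- `U i m s` solves the explicit scheme. -/
structure IsSchemeSolution {K : ℕ} (T ε Δx Δt : ℝ) (G : Fin K → ℝ → ℝ → ℝ)
    (f : Fin K → ℝ → ℝ → ℝ) (u₀ : Fin K → ℝ → ℝ) (U : Fin K → ℕ → ℕ → ℝ) : Prop where
  glue : ∀ i j : Fin K, ∀ s ≤ numSteps T Δt, U i 0 s = U j 0 s
  edge : ∀ i : Fin K, ∀ m : ℕ, 1 ≤ m → ∀ s < numSteps T Δt,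
    (U i m (s + 1) - U i m s) / Δt
      + numF ε Δx (G i) (Dplus Δx (fun k => U i k s) m) (Dminus Δx (fun k => U i k s) m)
      - f i (s * Δt) (-(m * Δx)) = 0
  junction : ∀ j : Fin K, ∀ s : ℕ, 1 ≤ s → s ≤ numSteps T Δt →
    U j 0 s = (1 / (K : ℝ)) * ∑ i : Fin K, U i 1 s
  initial : ∀ i : Fin K, ∀ m : ℕ, U i m 0 = u₀ i (-(m * Δx))

/-- Monotonicity of the explicit scheme: on every edge the new value at a node, which up to the
source term is `b - Δt F((a - b) / Δx, (b - c) / Δx)`, is a nondecreasing function of the three old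
values `a`, `b`, `c` at the nodes `m - 1`, `m`, `m + 1`. -/
def IsMonotoneScheme {K : ℕ} (ε Δx Δt : ℝ) (G : Fin K → ℝ → ℝ → ℝ) : Prop :=
  ∀ i : Fin K, ∀ a b c a' b' c' : ℝ, a ≤ a' → b ≤ b' → c ≤ c' →
    b - Δt * numF ε Δx (G i) ((a - b) / Δx) ((b - c) / Δx)
      ≤ b' - Δt * numF ε Δx (G i) ((a' - b') / Δx) ((b' - c') / Δx)

/-- `sup |g|` over `[0, T] × (-∞, 0]`, for a function `g t x` that is bounded there. -/
noncomputable def supAbs (T : ℝ) (g : ℝ → ℝ → ℝ) : ℝ :=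
  sSup {y : ℝ | ∃ t ∈ Icc 0 T, ∃ x ≤ (0 : ℝ), y = |g t x|}

/-- The numerical Hamiltonians are Lipschitz on `ℝ × ℝ` with common constant `L₁`. -/
def NumHamLipschitz {K : ℕ} (L₁ : ℝ) (G : Fin K → ℝ → ℝ → ℝ) : Prop :=
  ∀ i : Fin K, ∀ p₁ p₂ q₁ q₂ : ℝ, |G i p₁ p₂ - G i q₁ q₂| ≤ L₁ * (|p₁ - q₁| + |p₂ - q₂|)

/-- Consistency: `G i p p = min (H i p) (M + sup |f i| + 1)`. -/
def NumHamConsistent {K : ℕ} (T M : ℝ) (H : Fin K → ℝ → ℝ) (f : Fin K → ℝ → ℝ → ℝ)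
    (G : Fin K → ℝ → ℝ → ℝ) : Prop :=
  ∀ i : Fin K, ∀ p : ℝ, G i p p = min (H i p) (M + supAbs T (f i) + 1)

end KirchhoffHJ

/-!
The scheme is compared with the viscosity solution `u` by doubling the variables. The
Hamiltonians are only known to be coercive, neither convex nor quasi-convex, and the Kirchhoff
condition for `u` holds in the weak viscosity sense, so that the junction is the point of the argument.

*Regularized data.* At a kink of the initial values the numerical viscosity may change the solution
`U` of the scheme at a rate above `M`, at which the truncated Hamiltonians no longer control the
slopes. The initial values are therefore made constant near the junction and averaged over about
`Δx ^ (-1/2)` nodes (`smoothInitial`). By the comparison principle of the monotone scheme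
(`SolvesScheme.le`) this costs less than `O(Δx ^ (1/6))`, and the new solution `V` is
Lipschitz in time with constant `A = M + 1/4`. Hence its flux stays below the truncation level of
the Hamiltonians, which makes `V` Lipschitz in space (`exists_lipschitz_solution`). No Lipschitz bound for `u` is used: a maximum of the doubled
functional inherits its slopes from `V`.

*Off the junction.* Put `z = Δx ^ (1/6)`. The penalties are `(x + m Δx - …)² / (2 z⁵)` and
`(t - s Δt + …)² / (2 z)`, with shifts that keep the discrete point off the junction and off the
initial time. If the maximum has `x < 0` and `t > 0`, then both equations hold there with errors
`O(z)`, the largest one being `Δx / z⁵ = z` from the numerical viscosity, and the term `Λ z t`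
contradicts them (`IsDoublingMax.x_eq_zero`).

*At the junction.* Let the maximum have `x = 0`. The doubled functional then gives a comparison of
`u` and `V` near the junction with the time penalty decoupled and an error `O(z⁵)` that is
negligible at distance `r ≈ z³` (`JunctionData`). On the edge `i`, let `M i` be the slope of `V`
between the junction and the distance `r`; the slopes of `u` there are bounded below by the same
`M i` up to `o(z)`. By coercivity there are slopes `q i` at the junction, bounded independently of
the mesh, with `∑ q i ≥ 0` or `∑ q i ≤ 0` as follows (`SlopeAlternative`). In the first case each
`q i` is joined to a slope at most `M i` through slopes at which the Hamiltonian is at least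
`f - τ`, and after a perturbation of order `z` the corresponding profile is a strict test function
for `u` from above with positive sum of slopes (`JunctionData.not_above`). In the second case each
`q i` is joined to a slope at least `M i` through slopes at which the Hamiltonian is at most
`f - τ`, and the profile tests `V` from below with negative sum (`JunctionData.not_below`). Each
test is impossible, unless `u` is touched at the initial time; in that case the initial data decide.
Thus the two viscosity inequalities at the junction are never used with the same test
function, and no choice of the slopes in advance is needed.

This is `u - V ≤ C z` (`ComparisonPair.sub_le`). Its hypotheses are invariant under
`(u, V, H, f) ↦ (-u, -V, -H(-·), -f)`: coercivity is not, but it enters only through the slope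
alternative and the Lipschitz bound of `V`, which are. So the reverse inequality follows by
reflection (`ComparisonPair.reflect`). The truncation `G i p p = min (H i p) (b i)` is harmless
because only test functions with a time derivative of at most `A + 1/4` occur, in both the original
and the reflected problem (`IsSubsolutionBelow`).
-/

namespace KirchhoffHJ

variable {K : ℕ}

/-! ### Tests at the junction -/

/-- The test function `a i x + b t`. -/
def TestFunction.separable (T : ℝ) (a a' : Fin K → ℝ → ℝ) (b b' : ℝ → ℝ)
    (ha0 : ∀ i, a i 0 = 0) (ha : ∀ i x, HasDerivAt (a i) (a' i x) x)
    (hb : ∀ t, HasDerivAt b (b' t) t) (ha' : ∀ i, Continuous (a' i)) (hb' : Continuous b') :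
    TestFunction K T where
  val i x t := a i x + b t
  dx i x _ := a' i x
  dt _ _ t := b' t
  glue i j t _ := by rw [ha0 i, ha0 j]
  continuousOn_val i := by
    have h1 : Continuous (a i) := continuous_iff_continuousAt.2 fun x => (ha i x).continuousAt
    have h2 : Continuous b := continuous_iff_continuousAt.2 fun x => (hb x).continuousAt
    exact ((h1.comp continuous_fst).add (h2.comp continuous_snd)).continuousOn
  hasDeriv_dx i x _ t _ := ((ha i x).add_const (b t)).hasDerivWithinAt
  hasDeriv_dt i x _ t _ := ((hb t).const_add (a i x)).hasDerivWithinAt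
  continuousOn_dx i := ((ha' i).comp continuous_fst).continuousOn
  continuousOn_dt _ := (hb'.comp continuous_snd).continuousOn

/-- A viscosity subsolution of `u_t + H i (u_x) = f i` with Kirchhoff condition, where only test
functions whose time derivative at the point of contact is at most `M₁` are taken into account.
The restriction makes room for Hamiltonians that are truncated at a high level. -/
def IsSubsolutionBelow (T M₁ : ℝ) (H : Fin K → ℝ → ℝ) (f : Fin K → ℝ → ℝ → ℝ)
    (u : Fin K → ℝ → ℝ → ℝ) : Prop :=
  ∀ φ : TestFunction K T,
    (∀ i : Fin K, ∀ x < 0, ∀ t ∈ Ioc 0 T,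
      IsLocalMaxOn (φ.diff u i) (edgeDomain T) (x, t) → φ.dt i x t ≤ M₁ →
        φ.dt i x t + H i (φ.dx i x t) ≤ f i t x) ∧
    (∀ t ∈ Ioc 0 T,
      (∀ i : Fin K, IsLocalMaxOn (φ.diff u i) (edgeDomain T) (0, t)) →
      (∀ i : Fin K, φ.dt i 0 t ≤ M₁) →
        ∑ i : Fin K, φ.dx i 0 t ≤ 0 ∨ ∃ i : Fin K, φ.dt i 0 t + H i (φ.dx i 0 t) ≤ f i t 0)

/-- A discrete supersolution `V i m s`, `s ≤ N`, of the scheme with space step `h` and time step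
`k`. -/
structure IsDiscreteSuper (ε h k : ℝ) (N : ℕ) (G : Fin K → ℝ → ℝ → ℝ) (f : Fin K → ℝ → ℝ → ℝ)
    (V : Fin K → ℕ → ℕ → ℝ) : Prop where
  glue : ∀ i j : Fin K, ∀ s ≤ N, V i 0 s = V j 0 s
  edge : ∀ i : Fin K, ∀ m : ℕ, 1 ≤ m → ∀ s < N,
    f i (s * k) (-(m * h)) ≤ (V i m (s + 1) - V i m s) / k
      + numF ε h (G i) (Dplus h (fun j => V i j s) m) (Dminus h (fun j => V i j s) m)
  junction : ∀ s : ℕ, 1 ≤ s → s ≤ N → ∑ i : Fin K, (V i 1 s - V i 0 s) ≤ 0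

/-- A strict test from above at the junction is impossible: if the maximum of `u - a - b` over the
edges cut at `-r` is not reached at the ends `-r`, then it contradicts the subsolution property. -/
theorem IsSubsolutionBelow.no_junction_test {T M₁ : ℝ} {H : Fin K → ℝ → ℝ}
    {f : Fin K → ℝ → ℝ → ℝ} {u : Fin K → ℝ → ℝ → ℝ} (hu : IsSubsolutionBelow T M₁ H f u)
    (hglue : ∀ i j : Fin K, ∀ t ∈ Icc 0 T, u i 0 t = u j 0 t)
    (hcont : ∀ i : Fin K, ContinuousOn (fun z : ℝ × ℝ => u i z.1 z.2) (edgeDomain T))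
    {r : ℝ} (hr : 0 < r) {t₀ : ℝ} (ht₀ : t₀ ∈ Icc 0 T) (i₀ : Fin K)
    (a a' : Fin K → ℝ → ℝ) (b b' : ℝ → ℝ)
    (ha0 : ∀ i, a i 0 = 0) (ha : ∀ i x, HasDerivAt (a i) (a' i x) x)
    (hb : ∀ t, HasDerivAt b (b' t) t) (ha' : ∀ i, Continuous (a' i)) (hb' : Continuous b')
    (hend : ∀ i, ∀ t ∈ Icc 0 T, u i (-r) t - a i (-r) - b t < u i 0 t₀ - b t₀)
    (hpt : ∀ i, ∀ x ∈ Icc (-r) 0, ∀ t ∈ Icc 0 T, u i 0 t₀ - b t₀ ≤ u i x t - a i x - b t →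
      0 < t ∧ b' t ≤ M₁ ∧ f i t x < b' t + H i (a' i x))
    (hsum : 0 < ∑ i, a' i 0) : False := by
  classical
  have ca : ∀ i, Continuous (a i) := fun i =>
    continuous_iff_continuousAt.2 fun x => (ha i x).continuousAt
  have cb : Continuous b := continuous_iff_continuousAt.2 fun x => (hb x).continuousAt
  set S : Set (ℝ × ℝ) := Icc (-r) 0 ×ˢ Icc 0 T with hS
  have hSc : IsCompact S := isCompact_Icc.prod isCompact_Icc
  have h0S : ((0 : ℝ), t₀) ∈ S := ⟨⟨by linarith, le_rfl⟩, ht₀⟩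
  have hSsub : S ⊆ edgeDomain T := fun z hz => ⟨hz.1.2, hz.2⟩
  have hex : ∀ i, ∃ z ∈ S, IsMaxOn (fun z : ℝ × ℝ => u i z.1 z.2 - a i z.1 - b z.2) S z := by
    intro i
    refine hSc.exists_isMaxOn ⟨_, h0S⟩ ?_
    exact (((hcont i).mono hSsub).sub ((ca i).comp continuous_fst).continuousOn).sub
      (cb.comp continuous_snd).continuousOn
  choose zz hzS hzmax using hex
  obtain ⟨i, -, hi⟩ := Finset.exists_max_image Finset.univ
    (fun i => u i (zz i).1 (zz i).2 - a i (zz i).1 - b (zz i).2) ⟨i₀, Finset.mem_univ _⟩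
  obtain ⟨x, t, hz⟩ : ∃ x t, zz i = (x, t) := ⟨_, _, rfl⟩
  have hxt : (x, t) ∈ S := hz ▸ hzS i
  have hmax : ∀ j, ∀ y ∈ Icc (-r) 0, ∀ s ∈ Icc 0 T,
      u j y s - a j y - b s ≤ u i x t - a i x - b t := by
    intro j y hy s hs
    have h1 := hzmax j (show (y, s) ∈ S from ⟨hy, hs⟩)
    have h2 := hi j (Finset.mem_univ _)
    rw [hz] at h2
    exact le_trans h1 h2
  have hx : x ∈ Icc (-r) 0 := hxt.1
  have ht : t ∈ Icc 0 T := hxt.2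
  have hge : u i 0 t₀ - b t₀ ≤ u i x t - a i x - b t := by
    have := hmax i 0 ⟨by linarith, le_rfl⟩ t₀ ht₀
    rw [ha0] at this; linarith
  obtain ⟨htpos, hbM, hHf⟩ := hpt i x hx t ht hge
  have hxr : -r < x := by
    rcases hx.1.lt_or_eq with h | h
    · exact h
    · subst h; exact absurd (hend i t ht) (not_lt.2 hge)
  set φ := TestFunction.separable T a a' b b' ha0 ha hb ha' hb' with hφ
  have hnhds : ∀ᶠ y : ℝ × ℝ in nhdsWithin (x, t) (edgeDomain T), y ∈ S := by
    have h1 : ∀ᶠ y : ℝ × ℝ in nhds (x, t), -r < y.1 :=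
      (continuous_fst.tendsto (x, t)).eventually (lt_mem_nhds hxr)
    filter_upwards [nhdsWithin_le_nhds h1, self_mem_nhdsWithin] with y hy hy'
    exact ⟨⟨hy.le, hy'.1⟩, hy'.2⟩
  rcases hx.2.lt_or_eq with hx0 | hx0
  · have hloc : IsLocalMaxOn (φ.diff u i) (edgeDomain T) (x, t) := by
      filter_upwards [hnhds] with y hy
      have := hmax i y.1 hy.1 y.2 hy.2
      simp only [TestFunction.diff, hφ, TestFunction.separable]
      linarith
    have := (hu φ).1 i x hx0 t ⟨htpos, ht.2⟩ hloc hbM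
    simp only [hφ, TestFunction.separable] at this
    linarith
  · subst hx0
    have hloc : ∀ j, IsLocalMaxOn (φ.diff u j) (edgeDomain T) (0, t) := by
      intro j
      filter_upwards [hnhds] with y hy
      have := hmax j y.1 hy.1 y.2 hy.2
      have hg := hglue i j t ht
      have h1 := ha0 i
      have h2 := ha0 j
      simp only [TestFunction.diff, hφ, TestFunction.separable]
      linarith
    rcases (hu φ).2 t ⟨htpos, ht.2⟩ hloc (fun _ => hbM) with h | ⟨j, h⟩
    · simp only [hφ, TestFunction.separable] at h; linarith
    · simp only [hφ, TestFunction.separable] at h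
      have hj : u j 0 t₀ - b t₀ ≤ u j 0 t - a j 0 - b t := by
        have := hglue i j t ht
        have := hglue i j t₀ ht₀
        rw [ha0] at hge ⊢; linarith
      have := (hpt j 0 hx t ht hj).2.2
      linarith

/-- The scheme inequality may be applied to a function that touches a discrete supersolution from
below. -/
theorem IsDiscreteSuper.touch {ε h k : ℝ} {N : ℕ} {G : Fin K → ℝ → ℝ → ℝ}
    {f : Fin K → ℝ → ℝ → ℝ} {V : Fin K → ℕ → ℕ → ℝ} (hV : IsDiscreteSuper ε h k N G f V)
    (hk : 0 < k) (hmon : IsMonotoneScheme ε h k G) (i : Fin K) {m s : ℕ}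
    (hm : 1 ≤ m) (hs : s < N) (ψ : ℕ → ℝ) (β : ℕ → ℝ)
    (hmin : ∀ j : ℕ, V i m (s + 1) - ψ m - β (s + 1) ≤ V i j s - ψ j - β s ∨
      (j ≠ m - 1 ∧ j ≠ m ∧ j ≠ m + 1)) :
    f i (s * k) (-(m * h)) ≤ (β (s + 1) - β s) / k
      + numF ε h (G i) (Dplus h ψ m) (Dminus h ψ m) := by
  set c := V i m (s + 1) - ψ m - β (s + 1) with hc
  have h1 : ψ (m - 1) + β s + c ≤ V i (m - 1) s := by
    rcases hmin (m - 1) with h | h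
    · linarith
    · exact absurd rfl h.1
  have h2 : ψ m + β s + c ≤ V i m s := by
    rcases hmin m with h | h
    · linarith
    · exact absurd rfl h.2.1
  have h3 : ψ (m + 1) + β s + c ≤ V i (m + 1) s := by
    rcases hmin (m + 1) with h | h
    · linarith
    · exact absurd rfl h.2.2
  have key := hmon i _ _ _ _ _ _ h1 h2 h3
  have e := hV.edge i m hm s hs
  have e1 : (ψ (m - 1) + β s + c - (ψ m + β s + c)) / h = Dplus h ψ m := by
    unfold Dplus; congr 1; ring
  have e2 : (ψ m + β s + c - (ψ (m + 1) + β s + c)) / h = Dminus h ψ m := by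
    unfold Dminus; congr 1; ring
  rw [e1, e2] at key
  have e3 : (V i (m - 1) s - V i m s) / h = Dplus h (fun j => V i j s) m := rfl
  have e4 : (V i m s - V i (m + 1) s) / h = Dminus h (fun j => V i j s) m := rfl
  rw [e3, e4] at key
  set X := numF ε h (G i) (Dplus h (fun j => V i j s) m) (Dminus h (fun j => V i j s) m)
  set Y := numF ε h (G i) (Dplus h ψ m) (Dminus h ψ m)
  have e5 : f i (s * k) (-(m * h)) * k ≤ V i m (s + 1) - V i m s + X * k := by
    have := mul_le_mul_of_nonneg_right e hk.le
    rwa [add_mul, div_mul_cancel₀ _ hk.ne'] at this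
  have e6 : f i (s * k) (-(m * h)) * k ≤ β (s + 1) - β s + Y * k := by
    have : V i m (s + 1) = ψ m + β (s + 1) + c := by rw [hc]; ring
    nlinarith
  rw [← sub_nonneg] at e6 ⊢
  have : (β (s + 1) - β s) / k + Y - f i (s * k) (-(m * h))
      = (β (s + 1) - β s + Y * k - f i (s * k) (-(m * h)) * k) / k := by
    field_simp
  rw [this]
  exact div_nonneg e6 hk.le

/-- A strict test from below at the junction is impossible for a discrete supersolution. -/
theorem IsDiscreteSuper.no_junction_test {ε h k : ℝ} {N : ℕ} {G : Fin K → ℝ → ℝ → ℝ}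
    {f : Fin K → ℝ → ℝ → ℝ} {V : Fin K → ℕ → ℕ → ℝ} (hV : IsDiscreteSuper ε h k N G f V)
    (hk : 0 < k) (hmon : IsMonotoneScheme ε h k G)
    {n : ℕ} (hn : 1 ≤ n) {s₀ : ℕ} (hs₀ : s₀ ≤ N) (i₀ : Fin K)
    (ψ : Fin K → ℕ → ℝ) (β : ℕ → ℝ) (hψ0 : ∀ i, ψ i 0 = 0)
    (hend : ∀ i, ∀ s ≤ N, V i 0 s₀ - β s₀ < V i n s - ψ i n - β s)
    (hpt : ∀ i, ∀ m ≤ n, ∀ s ≤ N, V i m s - ψ i m - β s ≤ V i 0 s₀ - β s₀ → 1 ≤ s)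
    (hpt' : ∀ i, ∀ m < n, 1 ≤ m → ∀ s < N,
      V i m (s + 1) - ψ i m - β (s + 1) ≤ V i 0 s₀ - β s₀ →
      (β (s + 1) - β s) / k + numF ε h (G i) (Dplus h (ψ i) m) (Dminus h (ψ i) m)
        < f i (s * k) (-(m * h)))
    (hsum : 0 < ∑ i, ψ i 1) : False := by
  classical
  obtain ⟨⟨i, m, s⟩, hmem, hmin⟩ := Finset.exists_min_image
    ((Finset.univ : Finset (Fin K)) ×ˢ (Finset.range (n + 1) ×ˢ Finset.range (N + 1)))
    (fun q => V q.1 q.2.1 q.2.2 - ψ q.1 q.2.1 - β q.2.2)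
    ⟨(i₀, 0, 0), by simp⟩
  simp only [Finset.mem_product, Finset.mem_univ, Finset.mem_range, true_and] at hmem
  have hmin' : ∀ j, ∀ y ≤ n, ∀ s' ≤ N, V i m s - ψ i m - β s ≤ V j y s' - ψ j y - β s' := by
    intro j y hy s' hs'
    refine hmin (j, y, s') ?_
    simp only [Finset.mem_product, Finset.mem_univ, Finset.mem_range, true_and]
    omega
  have hle : V i m s - ψ i m - β s ≤ V i 0 s₀ - β s₀ := by
    have := hmin' i 0 (by omega) s₀ hs₀
    rw [hψ0] at this; linarith
  have hs1 := hpt i m (by omega) s (by omega) hle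
  have hmn : m ≠ n := by
    rintro rfl
    have := hend i s (by omega)
    linarith
  rcases Nat.eq_zero_or_pos m with h0 | hpos
  · subst h0
    have hj : ∀ j, ψ j 1 ≤ V j 1 s - V j 0 s := by
      intro j
      have h1 := hmin' j 1 hn s (by omega)
      have h2 := hV.glue i j s (by omega)
      rw [hψ0] at h1; linarith
    have := hV.junction s hs1 (by omega)
    have := Finset.sum_le_sum (fun j (_ : j ∈ Finset.univ) => hj j)
    linarith
  · obtain ⟨s', rfl⟩ : ∃ s', s = s' + 1 := ⟨s - 1, by omega⟩
    have h1 := hpt' i m (by omega) hpos s' (by omega) hle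
    have h2 := hV.touch hk hmon i hpos (show s' < N by omega) (ψ i) β (by
      intro j
      by_cases hj : j ≤ n
      · exact Or.inl (hmin' i j hj s' (by omega))
      · exact Or.inr (by omega))
    linarith

/-! ### The numerical flux -/

theorem numF_sub_le {ε h L₁ : ℝ} {G : Fin K → ℝ → ℝ → ℝ} (hG : NumHamLipschitz L₁ G)
    (hL₁ : 0 ≤ L₁) (hεh : 0 ≤ ε / h) (i : Fin K) {p p₁ p₂ d : ℝ} (h₁ : |p₁ - p| ≤ d)
    (h₂ : |p₂ - p| ≤ d) :
    |numF ε h (G i) p₁ p₂ - G i p p| ≤ 2 * (ε / h + L₁) * d := by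
  have h3 : |p₁ - p₂| ≤ 2 * d := by
    have := abs_sub_le p₁ p p₂
    rw [abs_sub_comm p p₂] at this; linarith
  have h4 := hG i p₁ p₂ p p
  have h5 : |-(ε / h) * (p₁ - p₂)| ≤ ε / h * (2 * d) := by
    rw [abs_mul, abs_neg, abs_of_nonneg hεh]; gcongr
  have h6 : numF ε h (G i) p₁ p₂ - G i p p = -(ε / h) * (p₁ - p₂) + (G i p₁ p₂ - G i p p) := by
    unfold numF; ring
  rw [h6]
  have h7 : L₁ * (|p₁ - p| + |p₂ - p|) ≤ L₁ * (2 * d) := by gcongr; linarith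
  calc _ ≤ _ := abs_add_le _ _
    _ ≤ ε / h * (2 * d) + L₁ * (2 * d) := by linarith
    _ = _ := by ring

/-- The numerical flux is nonincreasing in its first and nondecreasing in its second slope. -/
theorem IsMonotoneScheme.numF_le {ε h k : ℝ} {G : Fin K → ℝ → ℝ → ℝ}
    (hmon : IsMonotoneScheme ε h k G) (hh : 0 < h) (hk : 0 < k) (i : Fin K) {p₁ p₂ q₁ q₂ : ℝ}
    (h₁ : q₁ ≤ p₁) (h₂ : p₂ ≤ q₂) : numF ε h (G i) p₁ p₂ ≤ numF ε h (G i) q₁ q₂ := by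
  have := hmon i (h * q₁) 0 (-(h * q₂)) (h * p₁) 0 (-(h * p₂)) (by gcongr) le_rfl
    (by gcongr)
  have e : ∀ x y : ℝ, (h * x - 0) / h = x ∧ (0 - -(h * y)) / h = y := by
    intro x y; constructor <;> field_simp <;> ring
  rw [(e q₁ q₂).1, (e q₁ q₂).2, (e p₁ p₂).1, (e p₁ p₂).2] at this
  have h3 : k * numF ε h (G i) p₁ p₂ ≤ k * numF ε h (G i) q₁ q₂ := by linarith
  exact le_of_mul_le_mul_left h3 hk

/-! ### Profiles with a prescribed slope at the junction -/

/-- The profile on `(-∞, 0]` which vanishes at `0`, has slope `q` at `0`, and whose slope goes over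
to `p` exponentially on the length scale `ρ`. -/
noncomputable def profile (p q ρ x : ℝ) : ℝ := p * x + (q - p) * (ρ * (Real.exp (x / ρ) - 1))

/-- The derivative of `profile p q ρ`. -/
noncomputable def profileSlope (p q ρ x : ℝ) : ℝ := p + (q - p) * Real.exp (x / ρ)

theorem profile_zero (p q ρ : ℝ) : profile p q ρ 0 = 0 := by simp [profile]

theorem profileSlope_zero (p q ρ : ℝ) : profileSlope p q ρ 0 = q := by simp [profileSlope]

theorem hasDerivAt_profile (p q : ℝ) {ρ : ℝ} (hρ : 0 < ρ) (x : ℝ) :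
    HasDerivAt (profile p q ρ) (profileSlope p q ρ x) x := by
  have h1 : HasDerivAt (fun x : ℝ => Real.exp (x / ρ)) (Real.exp (x / ρ) * (1 / ρ)) x :=
    ((hasDerivAt_id x).div_const ρ).exp
  have h2 := ((hasDerivAt_id x).const_mul p).add
    (((h1.sub_const 1).const_mul ρ).const_mul (q - p))
  refine HasDerivAt.congr_deriv (f := profile p q ρ) h2 ?_
  unfold profileSlope; field_simp

theorem continuous_profileSlope (p q ρ : ℝ) : Continuous (profileSlope p q ρ) := by
  unfold profileSlope; fun_prop

theorem profileSlope_mem (p q : ℝ) {ρ x : ℝ} (hρ : 0 < ρ) (hx : x ≤ 0) :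
    profileSlope p q ρ x ∈ uIcc p q := by
  have h1 : Real.exp (x / ρ) ≤ 1 := Real.exp_le_one_iff.2 (div_nonpos_of_nonpos_of_nonneg hx hρ.le)
  have h2 := (Real.exp_pos (x / ρ)).le
  unfold profileSlope
  rw [mem_uIcc]
  rcases le_total p q with h | h
  · left; constructor <;> nlinarith
  · right; constructor <;> nlinarith

theorem abs_profile_sub_le (p q : ℝ) {ρ x : ℝ} (hρ : 0 < ρ) (hx : x ≤ 0) :
    |profile p q ρ x - p * x| ≤ |q - p| * ρ := by
  have h1 : Real.exp (x / ρ) ≤ 1 := Real.exp_le_one_iff.2 (div_nonpos_of_nonpos_of_nonneg hx hρ.le)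
  have h2 := (Real.exp_pos (x / ρ)).le
  have : profile p q ρ x - p * x = (q - p) * (ρ * (Real.exp (x / ρ) - 1)) := by
    unfold profile; ring
  rw [this, abs_mul, abs_mul, abs_of_pos hρ]
  have : |Real.exp (x / ρ) - 1| ≤ 1 := by rw [abs_le]; constructor <;> linarith
  calc _ ≤ |q - p| * (ρ * 1) := by gcongr
    _ = _ := by ring

/-- Difference quotients of the profile, compared with the slope at a point of the interval. -/
theorem abs_profile_quotient_sub_le (p q : ℝ) {ρ h x y : ℝ} (hρ : 0 < ρ) (hh : 0 < h)
    (hx : x + h ≤ 0) (hy : x ≤ y) (hy' : y ≤ x + h) :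
    |(profile p q ρ (x + h) - profile p q ρ x) / h - profileSlope p q ρ y| ≤ |q - p| * (h / ρ) := by
  set a := x / ρ with ha
  set d := h / ρ with hd
  have hdpos : 0 < d := div_pos hh hρ
  have had : (x + h) / ρ = a + d := by rw [ha, hd]; ring
  have had0 : a + d ≤ 0 := had ▸ div_nonpos_of_nonpos_of_nonneg hx hρ.le
  have e1 : (profile p q ρ (x + h) - profile p q ρ x) / h - profileSlope p q ρ y
      = (q - p) * ((Real.exp (a + d) - Real.exp a) / d - Real.exp (y / ρ)) := by
    have : h = d * ρ := by rw [hd]; field_simp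
    unfold profile profileSlope
    rw [had, ← ha]
    rw [this]; field_simp; ring
  rw [e1, abs_mul]
  gcongr
  have l1 : Real.exp a ≤ (Real.exp (a + d) - Real.exp a) / d := by
    rw [le_div_iff₀ hdpos, Real.exp_add]
    have := Real.add_one_le_exp d
    nlinarith [Real.exp_pos a]
  have l2 : (Real.exp (a + d) - Real.exp a) / d ≤ Real.exp (a + d) := by
    rw [div_le_iff₀ hdpos]
    have h1 := Real.add_one_le_exp (-d)
    have h2 : Real.exp a = Real.exp (a + d) * Real.exp (-d) := by rw [← Real.exp_add]; ring_nf
    nlinarith [Real.exp_pos (a + d)]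
  have l3 : Real.exp (a + d) - Real.exp a ≤ d := by
    rw [div_le_iff₀ hdpos] at l2
    have : Real.exp (a + d) ≤ 1 := Real.exp_le_one_iff.2 had0
    nlinarith
  have l4 : Real.exp a ≤ Real.exp (y / ρ) := Real.exp_le_exp.2 (by rw [ha]; gcongr)
  have l5 : Real.exp (y / ρ) ≤ Real.exp (a + d) := Real.exp_le_exp.2 (by rw [← had]; gcongr)
  rw [abs_le]; constructor <;> linarith

theorem abs_Dplus_profile_sub_le (p q : ℝ) {ρ h : ℝ} (hρ : 0 < ρ) (hh : 0 < h) {m : ℕ}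
    (hm : 1 ≤ m) :
    |Dplus h (fun j : ℕ => profile p q ρ (-(j * h))) m - profileSlope p q ρ (-(m * h))|
      ≤ |q - p| * (h / ρ) := by
  obtain ⟨m, rfl⟩ : ∃ j, m = j + 1 := ⟨m - 1, by omega⟩
  have h0 : (0 : ℝ) ≤ m * h := by positivity
  have := abs_profile_quotient_sub_le p q (x := -((m + 1 : ℕ) * h)) (y := -((m + 1 : ℕ) * h)) hρ hh
    (by push_cast; linarith) le_rfl (by linarith)
  rw [show -((m + 1 : ℕ) * h) + h = -(m * h) by push_cast; ring] at this
  exact this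

theorem abs_Dminus_profile_sub_le (p q : ℝ) {ρ h : ℝ} (hρ : 0 < ρ) (hh : 0 < h) (m : ℕ) :
    |Dminus h (fun j : ℕ => profile p q ρ (-(j * h))) m - profileSlope p q ρ (-(m * h))|
      ≤ |q - p| * (h / ρ) := by
  have h0 : (0 : ℝ) ≤ m * h := by positivity
  have := abs_profile_quotient_sub_le p q (x := -((m + 1 : ℕ) * h)) (y := -(m * h)) hρ hh
    (by push_cast; linarith) (by push_cast; linarith) (by push_cast; linarith)
  rw [show -((m + 1 : ℕ) * h) + h = -(m * h) by push_cast; ring] at this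
  exact this

/-! ### Doubling of variables -/

/-- The doubled functional attains its maximum: the linear term `ϖ x`, `x ≤ 0`, and the quadratic
penalization confine maximizing points to a compact set. -/
theorem exists_doubling_max {T : ℝ} (hT : 0 < T) (i₀ : Fin K) {u : Fin K → ℝ → ℝ → ℝ}
    (hcont : ∀ i : Fin K, ContinuousOn (fun z : ℝ × ℝ => u i z.1 z.2) (edgeDomain T))
    {V : Fin K → ℕ → ℕ → ℝ} {N : ℕ} {h κ ω ϖ C ℓ : ℝ} (hh : 0 < h) (hκ : 0 < κ) (hω : 0 ≤ ω)
    (hϖ : 0 < ϖ) (hℓ : 0 ≤ ℓ)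
    (hgrow : ∀ i, ∀ x ≤ 0, ∀ t ∈ Icc 0 T, ∀ m : ℕ, ∀ s ≤ N,
      u i x t - V i m s ≤ C + ℓ * |x + m * h|)
    (q : ℝ → ℕ → ℝ) (hq : ∀ t ∈ Icc 0 T, ∀ s, 0 ≤ q t s)
    (hqc : ∀ s, Continuous fun t => q t s) :
    ∃ i : Fin K, ∃ x ≤ 0, ∃ t ∈ Icc 0 T, ∃ m s : ℕ, s ≤ N ∧
      ∀ j, ∀ y ≤ 0, ∀ t' ∈ Icc 0 T, ∀ m' : ℕ, ∀ s' ≤ N,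
        u j y t' - V j m' s' - (y + m' * h - ω) ^ 2 / (2 * κ) - q t' s' + ϖ * y
          ≤ u i x t - V i m s - (x + m * h - ω) ^ 2 / (2 * κ) - q t s + ϖ * x := by
  classical
  set Φ : Fin K → ℝ → ℝ → ℕ → ℕ → ℝ := fun i x t m s =>
    u i x t - V i m s - (x + m * h - ω) ^ 2 / (2 * κ) - q t s + ϖ * x with hΦ
  set v₀ := Φ i₀ 0 0 0 0 with hv₀
  set c := C + ℓ * ω + ℓ ^ 2 * κ - v₀ with hc
  -- the points where `Φ` is at least `v₀` are bounded
  have hb : ∀ i, ∀ x ≤ 0, ∀ t ∈ Icc 0 T, ∀ m : ℕ, ∀ s ≤ N, v₀ ≤ Φ i x t m s →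
      ϖ * (-x) ≤ c ∧ m * h ≤ 1 + 4 * κ * c + ω + c / ϖ := by
    intro i x hx t ht m s hs hv
    have h1 := hgrow i x hx t ht m s hs
    have h2 := hq t ht s
    set e := x + m * h - ω with he
    have h3 : |x + m * h| ≤ |e| + ω := by
      have : x + m * h = e + ω := by rw [he]; ring
      rw [this]; exact (abs_add_le _ _).trans (by rw [abs_of_nonneg hω])
    have h4 : ℓ * |e| ≤ ℓ ^ 2 * κ + e ^ 2 / (4 * κ) := by
      have : ℓ ^ 2 * κ + e ^ 2 / (4 * κ) - ℓ * |e| = (2 * ℓ * κ - |e|) ^ 2 / (4 * κ) := by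
        rw [← sq_abs e]; field_simp; ring
      have : 0 ≤ (2 * ℓ * κ - |e|) ^ 2 / (4 * κ) := by positivity
      linarith
    have h5 : e ^ 2 / (2 * κ) = 2 * (e ^ 2 / (4 * κ)) := by field_simp; ring
    have h6 : v₀ ≤ u i x t - V i m s - e ^ 2 / (2 * κ) - q t s + ϖ * x := hv
    have h7 : ℓ * |x + m * h| ≤ ℓ * |e| + ℓ * ω := by
      rw [← mul_add]; gcongr
    have h8 : 0 ≤ e ^ 2 / (4 * κ) := by positivity
    have h9 : ϖ * (-x) + e ^ 2 / (4 * κ) ≤ c := by rw [hc]; linarith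
    have h10 : 0 ≤ ϖ * (-x) := mul_nonneg hϖ.le (by linarith)
    refine ⟨by linarith, ?_⟩
    have h11 : e ^ 2 ≤ 4 * κ * c := by
      have : e ^ 2 / (4 * κ) ≤ c := by linarith
      rw [div_le_iff₀ (by positivity)] at this; linarith
    have h12 : -x ≤ c / ϖ := by rw [le_div_iff₀ hϖ]; linarith
    nlinarith [sq_nonneg (e - 1)]
  have hT0 : (0 : ℝ) ∈ Icc 0 T := ⟨le_rfl, hT.le⟩
  have hc0 : 0 ≤ c := by
    have := (hb i₀ 0 le_rfl 0 hT0 0 0 (Nat.zero_le _) le_rfl).1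
    simpa using this
  set X := c / ϖ with hX
  have hX0 : 0 ≤ X := by positivity
  obtain ⟨Mm, hMm⟩ := exists_nat_gt ((1 + 4 * κ * c + ω + c / ϖ) / h)
  set S : Set (ℝ × ℝ) := Icc (-X) 0 ×ˢ Icc 0 T with hS
  have hSc : IsCompact S := isCompact_Icc.prod isCompact_Icc
  have hSsub : S ⊆ edgeDomain T := fun z hz => ⟨hz.1.2, hz.2⟩
  have hex : ∀ a : Fin K × ℕ × ℕ, ∃ z ∈ S,
      IsMaxOn (fun z : ℝ × ℝ => Φ a.1 z.1 z.2 a.2.1 a.2.2) S z := by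
    rintro ⟨i, m, s⟩
    refine hSc.exists_isMaxOn ⟨(0, 0), ⟨by linarith, le_rfl⟩, hT0⟩ ?_
    have h1 := (hcont i).mono hSsub
    have h2 : Continuous fun z : ℝ × ℝ => q z.2 s := (hqc s).comp continuous_snd
    simp only [hΦ]
    refine ContinuousOn.add (ContinuousOn.sub (ContinuousOn.sub (h1.sub continuousOn_const) ?_)
      h2.continuousOn) ?_
    · exact Continuous.continuousOn (by fun_prop)
    · exact Continuous.continuousOn (by fun_prop)
  choose zz hzS hzmax using hex
  obtain ⟨⟨i, m, s⟩, hmem, hmax⟩ := Finset.exists_max_image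
    ((Finset.univ : Finset (Fin K)) ×ˢ (Finset.range (Mm + 1) ×ˢ Finset.range (N + 1)))
    (fun a => Φ a.1 (zz a).1 (zz a).2 a.2.1 a.2.2)
    ⟨(i₀, 0, 0), by simp⟩
  simp only [Finset.mem_product, Finset.mem_univ, Finset.mem_range, true_and] at hmem
  obtain ⟨x, t, hz⟩ : ∃ x t, zz (i, m, s) = (x, t) := ⟨_, _, rfl⟩
  have hxt : (x, t) ∈ S := hz ▸ hzS (i, m, s)
  have hin : ∀ j, ∀ y ∈ Icc (-X) 0, ∀ t' ∈ Icc 0 T, ∀ m' ≤ Mm, ∀ s' ≤ N,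
      Φ j y t' m' s' ≤ Φ i x t m s := by
    intro j y hy t' ht' m' hm' s' hs'
    have h1 := hzmax (j, m', s') (show (y, t') ∈ S from ⟨hy, ht'⟩)
    have h2 := hmax (j, m', s') (by
      simp only [Finset.mem_product, Finset.mem_univ, Finset.mem_range, true_and]; omega)
    simp only [hz] at h2
    exact le_trans h1 h2
  refine ⟨i, x, hxt.1.2, t, hxt.2, m, s, by omega, ?_⟩
  intro j y hy t' ht' m' s' hs'
  change Φ j y t' m' s' ≤ Φ i x t m s
  rcases lt_or_ge (Φ j y t' m' s') v₀ with hlt | hge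
  · exact hlt.le.trans (hin i₀ 0 ⟨by linarith, le_rfl⟩ 0 hT0 0 (Nat.zero_le _) 0 (Nat.zero_le _))
  · obtain ⟨h1, h2⟩ := hb j y hy t' ht' m' s' hs' hge
    refine hin j y ⟨?_, hy⟩ t' ht' m' ?_ s' hs'
    · have : -y ≤ X := by rw [hX, le_div_iff₀ hϖ]; linarith
      linarith
    · have h3 : (m' : ℝ) ≤ (1 + 4 * κ * c + ω + c / ϖ) / h := by rw [le_div_iff₀ hh]; exact h2
      exact_mod_cast (h3.trans hMm.le)

/-! ### The doubled functional and the localization of its maximum -/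

/-- A subsolution `u` and a Lipschitz discrete supersolution `V` of the same problem, with the
Hamiltonians `p ↦ G i p p`, together with the bounds that enter the comparison of the two.  Here
`A` and `L` are Lipschitz constants of `V` in time and space, `c₀` is one of `f`, `CF` bounds the
numerical viscosity, `E₀ z` is the error of the initial values, and `z` is the sixth root of the
space step `h` (only `h ≤ z ^ 6` is needed).  Time levels beyond `T` are left out. -/
structure ComparisonPair (T A L c₀ L₁ CF ℓ E₀ : ℝ) (G : Fin K → ℝ → ℝ → ℝ)
    (f u : Fin K → ℝ → ℝ → ℝ) (z ε h k : ℝ) (N : ℕ) (V : Fin K → ℕ → ℕ → ℝ) : Prop where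
  T_pos : 0 < T
  A_nonneg : 0 ≤ A
  L_nonneg : 0 ≤ L
  c₀_nonneg : 0 ≤ c₀
  L₁_nonneg : 0 ≤ L₁
  ℓ_nonneg : 0 ≤ ℓ
  E₀_nonneg : 0 ≤ E₀
  f_lip : ∀ i, ∀ t ∈ Icc 0 T, ∀ s ∈ Icc 0 T, ∀ x ≤ 0, ∀ y ≤ 0,
    |f i t x - f i s y| ≤ c₀ * (|t - s| + |x - y|)
  G_lip : NumHamLipschitz L₁ G
  u_glue : ∀ i j : Fin K, ∀ t ∈ Icc 0 T, u i 0 t = u j 0 t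
  u_cont : ∀ i : Fin K, ContinuousOn (fun y : ℝ × ℝ => u i y.1 y.2) (edgeDomain T)
  u_sub : IsSubsolutionBelow T (A + 1 / 4) (fun i p => G i p p) f u
  u_bdd : ∃ C, ∀ i, ∀ x ≤ 0, ∀ t ∈ Icc 0 T, u i x t ≤ u i x 0 + C
  z_pos : 0 < z
  z_le : z ≤ 1
  z_le_T : z ≤ T
  h_pos : 0 < h
  h_le : h ≤ z ^ 6
  k_pos : 0 < k
  k_le : k ≤ z ^ 5 / 100
  ε_pos : 0 < ε
  CF_le : ε / h + L₁ ≤ CF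
  mono : IsMonotoneScheme ε h k G
  N_pos : 1 ≤ N
  N_le : N * k ≤ T
  T_lt : T < N * k + k
  V_super : IsDiscreteSuper ε h k N G f V
  V_space : ∀ i, ∀ m, ∀ s ≤ N, |V i m s - V i (m + 1) s| ≤ L * h
  V_time : ∀ i, ∀ m, ∀ s < N, |V i m (s + 1) - V i m s| ≤ A * k
  initial : ∀ i, ∀ x ≤ 0, ∀ m : ℕ, u i x 0 - V i m 0 ≤ ℓ * |x + m * h| + E₀ * z

/-- `(i, x, t; m, s)` maximizes the doubled functional.  The shift `L z⁵ + h` in the space penalty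
keeps the discrete point off the junction, the shift `(A + 1/8) z + 2 k` in the time penalty keeps
it off the initial time. -/
structure IsDoublingMax (T A L Λ ϖ z h k : ℝ) (N : ℕ) (u : Fin K → ℝ → ℝ → ℝ)
    (V : Fin K → ℕ → ℕ → ℝ) (i : Fin K) (x t : ℝ) (m s : ℕ) : Prop where
  x_le : x ≤ 0
  t_mem : t ∈ Icc 0 T
  s_le : s ≤ N
  max : ∀ j, ∀ y ≤ 0, ∀ t' ∈ Icc 0 T, ∀ m' : ℕ, ∀ s' ≤ N,
    u j y t' - V j m' s' - (y + m' * h - (L * z ^ 5 + h)) ^ 2 / (2 * z ^ 5)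
        - (t' - s' * k + ((A + 1 / 8) * z + 2 * k)) ^ 2 / (2 * z) - Λ * z * t' + ϖ * y
      ≤ u i x t - V i m s - (x + m * h - (L * z ^ 5 + h)) ^ 2 / (2 * z ^ 5)
        - (t - s * k + ((A + 1 / 8) * z + 2 * k)) ^ 2 / (2 * z) - Λ * z * t + ϖ * x

section
variable {T A L c₀ L₁ CF ℓ E₀ Λ ϖ z ε h k : ℝ} {G : Fin K → ℝ → ℝ → ℝ}
  {f u : Fin K → ℝ → ℝ → ℝ} {N : ℕ} {V : Fin K → ℕ → ℕ → ℝ} {i : Fin K} {x t : ℝ} {m s : ℕ}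

theorem ComparisonPair.abs_space_le (P : ComparisonPair T A L c₀ L₁ CF ℓ E₀ G f u z ε h k N V)
    (i : Fin K) (m m' : ℕ) {s : ℕ} (hs : s ≤ N) :
    |V i m s - V i m' s| ≤ L * |(m : ℝ) * h - m' * h| := by
  have key : ∀ m d : ℕ, |V i m s - V i (m + d) s| ≤ L * (d * h) := by
    intro m d
    induction d with
    | zero => simp
    | succ d ih =>
      have h1 := P.V_space i (m + d) s hs
      have h2 := abs_sub_le (V i m s) (V i (m + d) s) (V i (m + d + 1) s)
      rw [← add_assoc]; push_cast; linarith
  have hh := P.h_pos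
  rcases le_total m m' with hm | hm
  · obtain ⟨d, rfl⟩ := Nat.exists_eq_add_of_le hm
    have := key m d
    have e : |(m : ℝ) * h - (m + d : ℕ) * h| = d * h := by
      rw [show (m : ℝ) * h - (m + d : ℕ) * h = -(d * h) by push_cast; ring, abs_neg,
        abs_of_nonneg (by positivity)]
    rw [e]; exact this
  · obtain ⟨d, rfl⟩ := Nat.exists_eq_add_of_le hm
    have := key m' d
    have e : |((m' + d : ℕ) : ℝ) * h - m' * h| = d * h := by
      rw [show ((m' + d : ℕ) : ℝ) * h - m' * h = d * h by push_cast; ring,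
        abs_of_nonneg (by positivity)]
    rw [e, abs_sub_comm]; exact this

theorem ComparisonPair.abs_time_le (P : ComparisonPair T A L c₀ L₁ CF ℓ E₀ G f u z ε h k N V)
    (i : Fin K) (m : ℕ) {s : ℕ} (hs : s ≤ N) : |V i m s - V i m 0| ≤ A * (s * k) := by
  induction s with
  | zero => simp
  | succ s ih =>
    have h1 := P.V_time i m s (by omega)
    have h2 := ih (by omega)
    have h3 := abs_sub_le (V i m (s + 1)) (V i m s) (V i m 0)
    push_cast; linarith

theorem ComparisonPair.exists_doublingMax
    (P : ComparisonPair T A L c₀ L₁ CF ℓ E₀ G f u z ε h k N V) (i₀ : Fin K) (hΛ : 0 ≤ Λ)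
    (hϖ : 0 < ϖ) : ∃ i x t m s, IsDoublingMax T A L Λ ϖ z h k N u V i x t m s := by
  have hz := P.z_pos
  obtain ⟨C, hC⟩ := P.u_bdd
  have hh := P.h_pos
  have hgrow : ∀ i, ∀ x ≤ 0, ∀ t ∈ Icc 0 T, ∀ m : ℕ, ∀ s ≤ N,
      u i x t - V i m s ≤ (C + E₀ * z + A * T) + ℓ * |x + m * h| := by
    intro i x hx t ht m s hs
    have h1 := hC i x hx t ht
    have h2 := P.initial i x hx m
    have h3 := (abs_le.1 (P.abs_time_le i m hs)).1
    have h4 : A * (s * k) ≤ A * T := by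
      refine mul_le_mul_of_nonneg_left (le_trans ?_ P.N_le) P.A_nonneg
      have : (s : ℝ) ≤ N := by exact_mod_cast hs
      exact mul_le_mul_of_nonneg_right this P.k_pos.le
    linarith
  have hL := P.L_nonneg
  obtain ⟨i, x, hx, t, ht, m, s, hs, hmax⟩ := exists_doubling_max P.T_pos i₀ P.u_cont
    (κ := z ^ 5) (ω := L * z ^ 5 + h) P.h_pos (by positivity) (by positivity) hϖ P.ℓ_nonneg hgrow
    (fun t s => (t - s * k + ((A + 1 / 8) * z + 2 * k)) ^ 2 / (2 * z) + Λ * z * t)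
    (fun t ht s => by have := ht.1; positivity) (fun s => by fun_prop)
  refine ⟨i, x, t, m, s, hx, ht, hs, ?_⟩
  intro j y hy t' ht' m' s' hs'
  have := hmax j y hy t' ht' m' s' hs'
  linarith

theorem ComparisonPair.pow_le_pow (P : ComparisonPair T A L c₀ L₁ CF ℓ E₀ G f u z ε h k N V) :
    z ^ 5 ≤ z ∧ z ^ 6 ≤ z ^ 5 ∧ z ^ 5 ≤ z ^ 4 ∧ z ^ 4 ≤ z ^ 3 ∧ z ^ 3 ≤ z ^ 2 ∧ z ^ 2 ≤ z := by
  have h0 := P.z_pos.le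
  have h1 := P.z_le
  refine ⟨?_, ?_, ?_, ?_, ?_, ?_⟩
  · simpa using pow_le_pow_of_le_one h0 h1 (show 1 ≤ 5 by norm_num)
  all_goals first
    | exact pow_le_pow_of_le_one h0 h1 (by norm_num)
    | simpa using pow_le_pow_of_le_one h0 h1 (show 1 ≤ 2 by norm_num)

namespace IsDoublingMax

/-- By the shift `(A + 1/8) z + 2 k`, a step forward from the time level `0` gains more in the
penalty than `V` can change. -/
theorem one_le_s (P : ComparisonPair T A L c₀ L₁ CF ℓ E₀ G f u z ε h k N V)
    (D : IsDoublingMax T A L Λ ϖ z h k N u V i x t m s) : 1 ≤ s := by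
  by_contra hcon
  obtain rfl : s = 0 := by omega
  have h1 := D.max i x D.x_le t D.t_mem m 1 P.N_pos
  have h2 := (abs_le.1 (P.V_time i m 0 P.N_pos)).2
  rw [zero_add] at h2
  have hz := P.z_pos
  have hk := P.k_pos
  have ht := D.t_mem.1
  simp only [Nat.cast_zero, Nat.cast_one, zero_mul, sub_zero, one_mul] at h1
  set a := t + ((A + 1 / 8) * z + 2 * k) with ha
  have e1 : t - k + ((A + 1 / 8) * z + 2 * k) = a - k := by rw [ha]; ring
  rw [e1] at h1
  have e2 : a ^ 2 / (2 * z) - (a - k) ^ 2 / (2 * z) = k * (2 * a - k) / (2 * z) := by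
    field_simp; ring
  have e3 : A * k < k * (2 * a - k) / (2 * z) := by
    rw [lt_div_iff₀ (by positivity)]
    have : A * (2 * z) < 2 * a - k := by rw [ha]; nlinarith
    nlinarith
  linarith

/-- By the shift `L z⁵ + h`, a step away from the junction gains more in the penalty than `V` can
change. -/
theorem one_le_m (P : ComparisonPair T A L c₀ L₁ CF ℓ E₀ G f u z ε h k N V)
    (D : IsDoublingMax T A L Λ ϖ z h k N u V i x t m s) : 1 ≤ m := by
  by_contra hcon
  obtain rfl : m = 0 := by omega
  have h1 := D.max i x D.x_le t D.t_mem 1 s D.s_le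
  have h2 := (abs_le.1 (P.V_space i 0 s D.s_le)).1
  rw [zero_add] at h2
  have hz := P.z_pos
  have hh := P.h_pos
  have hx := D.x_le
  simp only [Nat.cast_zero, Nat.cast_one, zero_mul, add_zero, one_mul] at h1
  set a := x - (L * z ^ 5 + h) with ha
  have e1 : x + h - (L * z ^ 5 + h) = a + h := by rw [ha]; ring
  rw [e1] at h1
  have e2 : a ^ 2 / (2 * z ^ 5) - (a + h) ^ 2 / (2 * z ^ 5) = h * (-2 * a - h) / (2 * z ^ 5) := by
    field_simp; ring
  have e3 : L * h < h * (-2 * a - h) / (2 * z ^ 5) := by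
    rw [lt_div_iff₀ (by positivity)]
    have : L * (2 * z ^ 5) < -2 * a - h := by rw [ha]; nlinarith
    nlinarith
  linarith

theorem slope_t_ge (P : ComparisonPair T A L c₀ L₁ CF ℓ E₀ G f u z ε h k N V)
    (D : IsDoublingMax T A L Λ ϖ z h k N u V i x t m s) :
    -(A + 1 / 16) ≤ (t - s * k + ((A + 1 / 8) * z + 2 * k)) / z := by
  have hs1 := D.one_le_s P
  have hsN := D.s_le
  obtain ⟨s, rfl⟩ : ∃ j, s = j + 1 := ⟨s - 1, by omega⟩
  have h1 := D.max i x D.x_le t D.t_mem m s (by omega)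
  have h2 := (abs_le.1 (P.V_time i m s (by omega))).1
  have hz := P.z_pos
  have hk := P.k_pos
  have hk2 := P.k_le
  have hz5 := P.pow_le_pow
  set a := t - (s + 1 : ℕ) * k + ((A + 1 / 8) * z + 2 * k) with ha
  have e1 : t - s * k + ((A + 1 / 8) * z + 2 * k) = a + k := by rw [ha]; push_cast; ring
  rw [e1] at h1
  have e2 : (a + k) ^ 2 / (2 * z) - a ^ 2 / (2 * z) = k * (2 * a + k) / (2 * z) := by
    field_simp; ring
  have e3 : -(A * k) ≤ k * (2 * a + k) / (2 * z) := by linarith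
  rw [le_div_iff₀ (by positivity)] at e3
  have e4 : -(A * (2 * z)) ≤ 2 * a + k := by
    by_contra hc; push Not at hc; nlinarith
  rw [le_div_iff₀ hz]
  nlinarith

/-- At the last time level there is no room for the comparison with the next one; there the bound
comes from `t ≤ T < s k + k`. -/
theorem slope_t_le (P : ComparisonPair T A L c₀ L₁ CF ℓ E₀ G f u z ε h k N V)
    (D : IsDoublingMax T A L Λ ϖ z h k N u V i x t m s) :
    (t - s * k + ((A + 1 / 8) * z + 2 * k)) / z ≤ A + 3 / 16 ∧ z / 8 ≤ s * k := by
  have hz := P.z_pos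
  have hk := P.k_pos
  have hk2 := P.k_le
  have hz5 := P.pow_le_pow
  have hA := P.A_nonneg
  rcases lt_or_ge s N with hs | hs
  · have h1 := D.max i x D.x_le t D.t_mem m (s + 1) (by omega)
    have h2 := (abs_le.1 (P.V_time i m s hs)).2
    set a := t - s * k + ((A + 1 / 8) * z + 2 * k) with ha
    have e1 : t - (s + 1 : ℕ) * k + ((A + 1 / 8) * z + 2 * k) = a - k := by
      rw [ha]; push_cast; ring
    rw [e1] at h1
    have e2 : a ^ 2 / (2 * z) - (a - k) ^ 2 / (2 * z) = k * (2 * a - k) / (2 * z) := by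
      field_simp; ring
    have e3 : k * (2 * a - k) / (2 * z) ≤ A * k := by linarith
    rw [div_le_iff₀ (by positivity)] at e3
    have e4 : 2 * a - k ≤ A * (2 * z) := by
      by_contra hc; push Not at hc; nlinarith
    have ht := D.t_mem.1
    refine ⟨?_, ?_⟩
    · rw [div_le_iff₀ hz]; nlinarith
    · rw [ha] at e4; nlinarith
  · obtain rfl : s = N := le_antisymm D.s_le hs
    have ht := D.t_mem.2
    have h1 := P.T_lt
    have h2 := P.z_le_T
    refine ⟨?_, ?_⟩
    · rw [div_le_iff₀ hz]; nlinarith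
    · nlinarith

theorem abs_slope_x_le (P : ComparisonPair T A L c₀ L₁ CF ℓ E₀ G f u z ε h k N V)
    (D : IsDoublingMax T A L Λ ϖ z h k N u V i x t m s) :
    |x + m * h - (L * z ^ 5 + h)| ≤ (L + z) * z ^ 5 := by
  have hz := P.z_pos
  have hh := P.h_pos
  have hh2 := P.h_le
  have hm1 := D.one_le_m P
  have hz5 : 0 < z ^ 5 := by positivity
  obtain ⟨m, rfl⟩ : ∃ j, m = j + 1 := ⟨m - 1, by omega⟩
  set a := x + (m + 1 : ℕ) * h - (L * z ^ 5 + h) with ha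
  have e0 : z ^ 6 = z * z ^ 5 := by ring
  rw [abs_le]
  constructor
  · have h1 := D.max i x D.x_le t D.t_mem (m + 1 + 1) s D.s_le
    have h2 := (abs_le.1 (P.V_space i (m + 1) s D.s_le)).1
    have e1 : x + (m + 1 + 1 : ℕ) * h - (L * z ^ 5 + h) = a + h := by rw [ha]; push_cast; ring
    rw [e1] at h1
    have e2 : (a + h) ^ 2 / (2 * z ^ 5) - a ^ 2 / (2 * z ^ 5) = h * (2 * a + h) / (2 * z ^ 5) := by
      field_simp; ring
    have e3 : -(L * h) ≤ h * (2 * a + h) / (2 * z ^ 5) := by linarith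
    rw [le_div_iff₀ (by positivity)] at e3
    have e4 : -(L * (2 * z ^ 5)) ≤ 2 * a + h := by
      by_contra hc; push Not at hc; nlinarith
    nlinarith
  · have h1 := D.max i x D.x_le t D.t_mem m s D.s_le
    have h2 := (abs_le.1 (P.V_space i m s D.s_le)).2
    have e1 : x + m * h - (L * z ^ 5 + h) = a - h := by rw [ha]; push_cast; ring
    rw [e1] at h1
    have e2 : a ^ 2 / (2 * z ^ 5) - (a - h) ^ 2 / (2 * z ^ 5) = h * (2 * a - h) / (2 * z ^ 5) := by
      field_simp; ring
    have e3 : h * (2 * a - h) / (2 * z ^ 5) ≤ L * h := by linarith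
    rw [div_le_iff₀ (by positivity)] at e3
    have e4 : 2 * a - h ≤ L * (2 * z ^ 5) := by
      by_contra hc; push Not at hc; nlinarith
    nlinarith

theorem abs_x_add_le (P : ComparisonPair T A L c₀ L₁ CF ℓ E₀ G f u z ε h k N V)
    (D : IsDoublingMax T A L Λ ϖ z h k N u V i x t m s) :
    |x + m * h| ≤ (2 * L + 2) * z ^ 5 := by
  have h1 := abs_le.1 (D.abs_slope_x_le P)
  have hz := P.z_pos
  have hz1 := P.z_le
  have hz5 := P.pow_le_pow
  have hL := P.L_nonneg
  have hh := P.h_pos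
  have hh2 := P.h_le
  have h5 : 0 < z ^ 5 := by positivity
  have : z * z ^ 5 ≤ z ^ 5 := by nlinarith
  have : 0 ≤ L * z ^ 5 := by positivity
  rw [abs_le]; constructor <;> nlinarith

theorem abs_t_sub_le (P : ComparisonPair T A L c₀ L₁ CF ℓ E₀ G f u z ε h k N V)
    (D : IsDoublingMax T A L Λ ϖ z h k N u V i x t m s) :
    |t - s * k| ≤ 2 * (A + 1) * z := by
  have h1 := D.slope_t_ge P
  have h2 := (D.slope_t_le P).1
  have hz := P.z_pos
  have hz5 := P.pow_le_pow
  have hA := P.A_nonneg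
  have hk := P.k_pos
  have hk2 := P.k_le
  rw [le_div_iff₀ hz] at h1
  rw [div_le_iff₀ hz] at h2
  rw [abs_le]; constructor <;> nlinarith

end IsDoublingMax
end

/-! ### Maxima off the junction -/

section
variable {T A L c₀ L₁ CF ℓ E₀ Λ ϖ z ε h k : ℝ} {G : Fin K → ℝ → ℝ → ℝ}
  {f u : Fin K → ℝ → ℝ → ℝ} {N : ℕ} {V : Fin K → ℕ → ℕ → ℝ} {i : Fin K} {x t : ℝ} {m s : ℕ}

theorem hasDerivAt_sq_div (c d x : ℝ) :
    HasDerivAt (fun y : ℝ => (y + c) ^ 2 / (2 * d)) ((x + c) / d) x := by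
  have h1 := (((hasDerivAt_id x).add_const c).pow 2).div_const (2 * d)
  refine h1.congr_deriv ?_
  by_cases hd : d = 0
  · simp [hd]
  · simp only [id]; field_simp; norm_num; ring

namespace IsDoublingMax

/-- The equation for `u` at a maximum off the junction and after the initial time. -/
theorem equation_sub (P : ComparisonPair T A L c₀ L₁ CF ℓ E₀ G f u z ε h k N V)
    (D : IsDoublingMax T A L Λ ϖ z h k N u V i x t m s) (ht : 0 < t) (hx : x < 0)
    (hΛz : Λ * z ≤ 1 / 16) {ξ τ : ℝ} (hξ : ξ = (x + m * h - (L * z ^ 5 + h)) / z ^ 5)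
    (hτ : τ = (t - s * k + ((A + 1 / 8) * z + 2 * k)) / z) :
    τ + Λ * z + G i (ξ - ϖ) (ξ - ϖ) ≤ f i t x := by
  have hsN := D.s_le
  have hτle : τ ≤ A + 3 / 16 := hτ ▸ (D.slope_t_le P).1
  set ω := L * z ^ 5 + h with hω
  set ω' := (A + 1 / 8) * z + 2 * k with hω'
  set a : Fin K → ℝ → ℝ := fun _ y =>
    (y + (m * h - ω)) ^ 2 / (2 * z ^ 5) - (0 + (m * h - ω)) ^ 2 / (2 * z ^ 5) - ϖ * y with ha
  set a' : Fin K → ℝ → ℝ := fun _ y => (y + (m * h - ω)) / z ^ 5 - ϖ with ha'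
  set b : ℝ → ℝ := fun y => (y + (-(s * k) + ω')) ^ 2 / (2 * z) + Λ * z * y with hb
  set b' : ℝ → ℝ := fun y => (y + (-(s * k) + ω')) / z + Λ * z with hb'
  set φ := TestFunction.separable T a a' b b' (fun i => by simp [ha])
    (fun i y => by
      have := ((hasDerivAt_sq_div (m * h - ω) (z ^ 5) y).sub_const
        ((0 + (m * h - ω)) ^ 2 / (2 * z ^ 5))).sub ((hasDerivAt_id y).const_mul ϖ)
      refine this.congr_deriv ?_
      simp [ha'])
    (fun y => by
      have := (hasDerivAt_sq_div (-(s * k) + ω') z y).add ((hasDerivAt_id y).const_mul (Λ * z))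
      refine this.congr_deriv ?_
      simp [hb'])
    (fun i => by simp only [ha']; fun_prop) (by simp only [hb']; fun_prop) with hφ
  have hloc : IsLocalMaxOn (φ.diff u i) (edgeDomain T) (x, t) := by
    filter_upwards [self_mem_nhdsWithin] with y hy
    have := D.max i y.1 hy.1 y.2 hy.2 m s hsN
    simp only [TestFunction.diff, hφ, TestFunction.separable, ha, hb]
    rw [show y.1 + (m * h - ω) = y.1 + m * h - ω by ring,
      show y.2 + (-(s * k) + ω') = y.2 - s * k + ω' by ring,
      show x + (m * h - ω) = x + m * h - ω by ring,
      show t + (-(s * k) + ω') = t - s * k + ω' by ring]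
    linarith
  have e1 : φ.dt i x t = τ + Λ * z := by
    simp only [hφ, TestFunction.separable, hb', hτ]; congr 2; ring
  have e2 : φ.dx i x t = ξ - ϖ := by
    simp only [hφ, TestFunction.separable, ha', hξ]; congr 2; ring
  have := (P.u_sub φ).1 i x hx t ⟨ht, D.t_mem.2⟩ hloc (by rw [e1]; linarith)
  rw [e1, e2] at this
  exact this

/-- The scheme inequality for `V` at a maximum. -/
theorem equation_super (P : ComparisonPair T A L c₀ L₁ CF ℓ E₀ G f u z ε h k N V)
    (D : IsDoublingMax T A L Λ ϖ z h k N u V i x t m (s + 1)) {ξ τ : ℝ}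
    (hξ : ξ = (x + m * h - (L * z ^ 5 + h)) / z ^ 5)
    (hτ : τ = (t - (s + 1 : ℕ) * k + ((A + 1 / 8) * z + 2 * k)) / z) :
    f i (s * k) (-(m * h)) ≤ τ + k / (2 * z) + G i ξ ξ
      + 2 * (ε / h + L₁) * (h / (2 * z ^ 5)) := by
  have hz := P.z_pos
  have hh := P.h_pos
  have hk := P.k_pos
  have hm1 := D.one_le_m P
  have hsN := D.s_le
  set ω := L * z ^ 5 + h with hω
  set ω' := (A + 1 / 8) * z + 2 * k with hω'
  have hv := P.V_super.touch hk P.mono i hm1 (show s < N by omega)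
    (fun j => -((x + j * h - ω) ^ 2 / (2 * z ^ 5)))
    (fun j => -((t - j * k + ω') ^ 2 / (2 * z))) (by
      intro j
      left
      have := D.max i x D.x_le t D.t_mem j s (by omega)
      linarith)
  have hF := (abs_le.1 (numF_sub_le (ε := ε) (h := h) P.G_lip P.L₁_nonneg
    (div_pos P.ε_pos hh).le i (p := ξ)
    (p₁ := Dplus h (fun j : ℕ => -((x + j * h - ω) ^ 2 / (2 * z ^ 5))) m)
    (p₂ := Dminus h (fun j : ℕ => -((x + j * h - ω) ^ 2 / (2 * z ^ 5))) m)
    (d := h / (2 * z ^ 5)) (by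
      have e : Dplus h (fun j : ℕ => -((x + j * h - ω) ^ 2 / (2 * z ^ 5))) m - ξ
          = -(h / (2 * z ^ 5)) := by
        unfold Dplus
        simp only []
        rw [Nat.cast_sub hm1, hξ]; field_simp; push_cast; ring
      rw [e, abs_neg, abs_of_nonneg (by positivity)]) (by
      have e : Dminus h (fun j : ℕ => -((x + j * h - ω) ^ 2 / (2 * z ^ 5))) m - ξ
          = h / (2 * z ^ 5) := by
        unfold Dminus
        rw [hξ]; field_simp; push_cast; ring
      rw [e, abs_of_nonneg (by positivity)]))).2
  have hβ : (-((t - (s + 1 : ℕ) * k + ω') ^ 2 / (2 * z)) - -((t - s * k + ω') ^ 2 / (2 * z))) / k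
      = τ + k / (2 * z) := by
    rw [hτ]; field_simp; push_cast; ring
  rw [hβ] at hv
  linarith

/-- At a maximum off the junction and after the initial time the two equations contradict each
other, once the slope `Λ z` in time exceeds all the errors. -/
theorem x_eq_zero (P : ComparisonPair T A L c₀ L₁ CF ℓ E₀ G f u z ε h k N V)
    (D : IsDoublingMax T A L Λ ϖ z h k N u V i x t m s) (ht : 0 < t) (hϖ : 0 ≤ ϖ) (hϖz : ϖ ≤ z)
    (hΛz : Λ * z ≤ 1 / 16) (hΛ : 2 * L₁ + c₀ * (2 * A + 2 * L + 5) + 1 + CF < Λ) : x = 0 := by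
  by_contra hx0
  have hx : x < 0 := lt_of_le_of_ne D.x_le hx0
  have hs1 := D.one_le_s P
  obtain ⟨s, rfl⟩ : ∃ j, s = j + 1 := ⟨s - 1, by omega⟩
  obtain ⟨ξ, hξ⟩ : ∃ ξ, ξ = (x + m * h - (L * z ^ 5 + h)) / z ^ 5 := ⟨_, rfl⟩
  obtain ⟨τ, hτ⟩ : ∃ τ, τ = (t - (s + 1 : ℕ) * k + ((A + 1 / 8) * z + 2 * k)) / z := ⟨_, rfl⟩
  have hu := D.equation_sub P ht hx hΛz hξ hτ
  have hv := D.equation_super P hξ hτ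
  have hz := P.z_pos
  have hz1 := P.z_le
  have hh := P.h_pos
  have hk := P.k_pos
  have hk2 := P.k_le
  have hz5 := P.pow_le_pow
  have hz5pos : 0 < z ^ 5 := by positivity
  have hsN := D.s_le
  have hG := (abs_le.1 (P.G_lip i ξ ξ (ξ - ϖ) (ξ - ϖ))).2
  rw [show ξ - (ξ - ϖ) = ϖ by ring, abs_of_nonneg hϖ] at hG
  have hsk : (s : ℝ) * k ∈ Icc 0 T := by
    refine ⟨by positivity, le_trans ?_ P.N_le⟩
    exact mul_le_mul_of_nonneg_right (by exact_mod_cast (show s ≤ N by omega)) hk.le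
  have hf := (abs_le.1 (P.f_lip i t D.t_mem (s * k) hsk x hx.le (-(m * h))
    (neg_nonpos.2 (by positivity)))).2
  have h1 := D.abs_t_sub_le P
  have h2 := D.abs_x_add_le P
  have h3 : |t - s * k| ≤ 2 * (A + 1) * z + k := by
    have : t - s * k = (t - (s + 1 : ℕ) * k) + k := by push_cast; ring
    rw [this]
    exact (abs_add_le _ _).trans (by rw [abs_of_pos hk]; linarith)
  rw [show x - -(m * h) = x + m * h by ring] at hf
  have h4 : c₀ * (|t - s * k| + |x + m * h|) ≤ c₀ * (2 * A + 2 * L + 5) * z := by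
    have hL := P.L_nonneg
    rw [mul_assoc]
    refine mul_le_mul_of_nonneg_left ?_ P.c₀_nonneg
    have : L * z ^ 5 ≤ L * z := by gcongr; exact hz5.1
    linarith
  have h5 : k / (2 * z) ≤ z := by
    rw [div_le_iff₀ (by positivity)]
    have : z * (2 * z) = 2 * z ^ 2 := by ring
    linarith
  have h6 : 2 * (ε / h + L₁) * (h / (2 * z ^ 5)) ≤ CF * z := by
    have e1 : h / (2 * z ^ 5) ≤ z / 2 := by
      rw [div_le_iff₀ (by positivity), show z / 2 * (2 * z ^ 5) = z ^ 6 by ring]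
      exact P.h_le
    have e2 := P.CF_le
    have e3 : 0 ≤ ε / h + L₁ := add_nonneg (div_pos P.ε_pos hh).le P.L₁_nonneg
    have e4 : 0 ≤ CF := e3.trans e2
    calc _ ≤ 2 * CF * (z / 2) := by gcongr
      _ = _ := by ring
  have h7 : L₁ * (ϖ + ϖ) ≤ 2 * L₁ * z := by
    have := P.L₁_nonneg
    nlinarith
  have h8 := mul_lt_mul_of_pos_right hΛ hz
  linarith

end IsDoublingMax
end

/-! ### Maxima at the junction -/

section
variable {T A L B D E c₀ L₁ CF ℓ E₀ Λ ϖ z ε h k τ r : ℝ} {G : Fin K → ℝ → ℝ → ℝ}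
  {f u : Fin K → ℝ → ℝ → ℝ} {N n : ℕ} {V : Fin K → ℕ → ℕ → ℝ} {i : Fin K} {x t : ℝ} {m s : ℕ}

/-- What a maximum of the doubled functional at the junction, `x = 0`, says about `u` and `V` near
the junction.  The penalty in time has been replaced by its second order Taylor polynomial and
decoupled. -/
theorem IsDoublingMax.junction_comparison
    (P : ComparisonPair T A L c₀ L₁ CF ℓ E₀ G f u z ε h k N V)
    (D : IsDoublingMax T A L Λ ϖ z h k N u V i 0 t m s) (hϖ : 0 ≤ ϖ) (hϖz : ϖ ≤ z ^ 6)
    (hE : E = L * (2 * L + 2) + (L + 2) ^ 2 + 1)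
    (hτ : τ = (t - s * k + ((A + 1 / 8) * z + 2 * k)) / z) (j : Fin K) {y t' : ℝ} {m' s' : ℕ}
    (hy : y ∈ Icc (-1) 0) (ht' : t' ∈ Icc 0 T) (hs' : s' ≤ N) (hym : |y + m' * h| ≤ h) :
    (u j y t' - u i 0 t) - (V j m' s' - V i 0 s) ≤ τ * ((t' - t) - (s' * k - s * k))
      + ((t' - t) ^ 2 + (s' * k - s * k) ^ 2) / z + Λ * z * (t' - t) + E * z ^ 5 := by
  have h1 := D.max j y hy.2 t' ht' m' s' hs'
  have h2 := D.abs_x_add_le P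
  have hz := P.z_pos
  have hh := P.h_pos
  have hL := P.L_nonneg
  have hz5 := P.pow_le_pow
  have hz5pos : 0 < z ^ 5 := by positivity
  rw [zero_add, abs_of_nonneg (by positivity)] at h2
  have h3 := (abs_le.1 (P.abs_space_le i m 0 D.s_le)).1
  rw [Nat.cast_zero, zero_mul, sub_zero, abs_of_nonneg (by positivity)] at h3
  have h4 : 0 ≤ (0 + m * h - (L * z ^ 5 + h)) ^ 2 / (2 * z ^ 5) := by positivity
  have h5 : (y + m' * h - (L * z ^ 5 + h)) ^ 2 / (2 * z ^ 5) ≤ (L + 2) ^ 2 * z ^ 5 := by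
    rw [div_le_iff₀ (by positivity)]
    have e1 : |y + m' * h - (L * z ^ 5 + h)| ≤ (L + 2) * z ^ 5 := by
      have := P.h_le
      have e0 := abs_le.1 hym
      have : 0 ≤ L * z ^ 5 := by positivity
      rw [abs_le]; constructor <;> linarith
    have e2 := sq_le_sq' (abs_le.1 e1).1 (abs_le.1 e1).2
    have e3 : 0 ≤ ((L + 2) * z ^ 5) ^ 2 := by positivity
    linarith
  have h6 : -(ϖ * y) ≤ z ^ 5 := by
    have : ϖ * (-y) ≤ ϖ * 1 := mul_le_mul_of_nonneg_left (by linarith [hy.1]) hϖ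
    linarith
  have h7 : L * (m * h) ≤ L * (2 * L + 2) * z ^ 5 := by
    rw [mul_assoc]; exact mul_le_mul_of_nonneg_left h2 hL
  set a := t - s * k + ((A + 1 / 8) * z + 2 * k) with ha
  set d := (t' - t) - (s' * k - s * k) with hd
  have e1 : t' - s' * k + ((A + 1 / 8) * z + 2 * k) = a + d := by rw [ha, hd]; ring
  rw [e1] at h1
  have e2 : (a + d) ^ 2 / (2 * z) = a ^ 2 / (2 * z) + τ * d + d ^ 2 / (2 * z) := by
    rw [hτ]; field_simp; ring
  have e3 : d ^ 2 / (2 * z) ≤ ((t' - t) ^ 2 + (s' * k - s * k) ^ 2) / z := by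
    rw [div_le_div_iff₀ (by positivity) hz]
    have : d ^ 2 ≤ 2 * ((t' - t) ^ 2 + (s' * k - s * k) ^ 2) := by
      rw [hd]
      have := sq_nonneg ((t' - t) + (s' * k - s * k))
      linarith
    have := mul_le_mul_of_nonneg_right this hz.le
    linarith
  rw [hE]
  linarith

/-- The hypotheses of the two tests at the junction, around the times `t` and `s k`, where `u` and
`V` take the values `u₀` and `V₀`.  The number `τ` is the slope in time of the penalty.  The tests
are made on the scale `r = n h`, which is comparable to `z ^ 3`.  Up to the term `E z ^ 5 = o(r z)`,
the same slope `M j` of the chord over `[-r, 0]` bounds `V` from below (`V_end`) and `u` from above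
(`u_end`), at all times, once the quadratic terms of the tests in time are added.  The inequality
`comp` is the one of `IsDoublingMax.junction_comparison`. -/
structure JunctionData (T A L B D E Λ z h k τ r : ℝ) (N n : ℕ) (u : Fin K → ℝ → ℝ → ℝ)
    (V : Fin K → ℕ → ℕ → ℝ) (u₀ V₀ t : ℝ) (s : ℕ) (M : Fin K → ℝ) : Prop where
  B_nonneg : 0 ≤ B
  D_eq : D = 2 * L + 2 * B + 5
  E_nonneg : 0 ≤ E
  t_mem : t ∈ Icc 0 T
  s_le : s ≤ N
  u₀_eq : ∀ j, u j 0 t = u₀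
  V₀_eq : ∀ j, V j 0 s = V₀
  n_pos : 1 ≤ n
  r_eq : r = n * h
  r_ge : z ^ 3 ≤ r
  r_le : r ≤ 2 * z ^ 3
  Λ_nonneg : 0 ≤ Λ
  small₁ : (4 * D + Λ) * z ≤ 1 / 16
  small₂ : 4 * E * z ≤ 1
  small₃ : 16 * (B + 1) ^ 2 * z < 1
  τ_ge : -(A + 1 / 16) ≤ τ
  τ_le : τ ≤ A + 3 / 16
  ts : |t - s * k| ≤ 2 * (A + 1) * z
  s_ge : z / 8 ≤ s * k
  comp : ∀ j, ∀ y ∈ Icc (-1) (0 : ℝ), ∀ t' ∈ Icc 0 T, ∀ m' : ℕ, ∀ s' ≤ N, |y + m' * h| ≤ h →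
    (u j y t' - u₀) - (V j m' s' - V₀) ≤ τ * ((t' - t) - (s' * k - s * k))
      + ((t' - t) ^ 2 + (s' * k - s * k) ^ 2) / z + Λ * z * (t' - t) + E * z ^ 5
  V_end : ∀ j, ∀ s' ≤ N,
    -M j * r ≤ V j n s' - (τ * (s' * k - s * k) - 2 * (s' * k - s * k) ^ 2 / z) - V₀
  u_end : ∀ j, ∀ t' ∈ Icc 0 T,
    u j (-r) t' - (τ * (t' - t) + 2 * (t' - t) ^ 2 / z + Λ * z * (t' - t)) - u₀
      ≤ -M j * r + E * z ^ 5

/-- Bounds for a profile with slopes at most `B + 1`, on the length scale `z r / (8 (B + 1))`. -/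
theorem JunctionData.profile_bounds {u₀ V₀ : ℝ} {M : Fin K → ℝ}
    (P : ComparisonPair T A L c₀ L₁ CF ℓ E₀ G f u z ε h k N V)
    (J : JunctionData T A L B D E Λ z h k τ r N n u V u₀ V₀ t s M) {p q : ℝ}
    (hp : |p| ≤ B + 1) (hq : |q| ≤ B + 1) :
    0 < z * r / (8 * (B + 1)) ∧ |q - p| * (z * r / (8 * (B + 1))) ≤ z * r / 4 ∧
    |q - p| * (h / (z * r / (8 * (B + 1)))) ≤ 16 * (B + 1) ^ 2 * z ^ 2 ∧
    ∀ y ∈ Icc (-r) 0, |profile p q (z * r / (8 * (B + 1))) y| ≤ (B + 2) * r := by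
  have hz := P.z_pos
  have hz1 := P.z_le
  have hh := P.h_pos
  have hB := J.B_nonneg
  have hr : 0 < r := lt_of_lt_of_le (by positivity) J.r_ge
  have hρ : 0 < z * r / (8 * (B + 1)) := by positivity
  have hqp : |q - p| ≤ 2 * (B + 1) := by
    have := abs_sub q p; linarith
  have h1 : |q - p| * (z * r / (8 * (B + 1))) ≤ z * r / 4 := by
    calc _ ≤ 2 * (B + 1) * (z * r / (8 * (B + 1))) := by gcongr
      _ = _ := by field_simp; ring
  refine ⟨hρ, h1, ?_, ?_⟩
  · calc |q - p| * (h / (z * r / (8 * (B + 1))))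
        ≤ 2 * (B + 1) * (h / (z * r / (8 * (B + 1)))) := by gcongr
      _ = 16 * (B + 1) ^ 2 * (h / (z * r)) := by field_simp; ring
      _ ≤ 16 * (B + 1) ^ 2 * z ^ 2 := by
        gcongr
        rw [div_le_iff₀ (by positivity)]
        calc h ≤ z ^ 6 := P.h_le
          _ = z ^ 2 * (z * z ^ 3) := by ring
          _ ≤ z ^ 2 * (z * r) := by gcongr; exact J.r_ge
  · intro y hy
    have h2 := abs_profile_sub_le p q hρ hy.2
    have h3 : |p * y| ≤ (B + 1) * r := by
      rw [abs_mul]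
      have : |y| ≤ r := by rw [abs_of_nonpos hy.2]; linarith [hy.1]
      gcongr
    have h4 := abs_add_le (profile p q (z * r / (8 * (B + 1))) y - p * y) (p * y)
    rw [sub_add_cancel] at h4
    nlinarith

/-- Time localization: the quadratic parts of the tests dominate. -/
theorem JunctionData.abs_le_of_sq {u₀ V₀ : ℝ} {M : Fin K → ℝ}
    (P : ComparisonPair T A L c₀ L₁ CF ℓ E₀ G f u z ε h k N V)
    (J : JunctionData T A L B D E Λ z h k τ r N n u V u₀ V₀ t s M) {d : ℝ}
    (hd : d ^ 2 / z ≤ (L + B + 2) * r + E * z ^ 5) : |d| ≤ D * z ^ 2 := by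
  have hz := P.z_pos
  have hz5 := P.pow_le_pow
  have hL := P.L_nonneg
  have hB := J.B_nonneg
  have hE := J.E_nonneg
  have h1 : E * z ^ 5 ≤ z ^ 3 := by
    have : E * z ^ 5 = (4 * E * z) * (z * z ^ 3 / 4) := by ring
    rw [this]
    calc _ ≤ 1 * (z * z ^ 3 / 4) := by gcongr; exact J.small₂
      _ ≤ z ^ 3 := by
        have : z * z ^ 3 = z ^ 4 := by ring
        have : 0 < z ^ 4 := by positivity
        linarith
  have h2 : (L + B + 2) * r ≤ (L + B + 2) * (2 * z ^ 3) := by gcongr; exact J.r_le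
  rw [div_le_iff₀ hz] at hd
  have hD1 : 1 ≤ D := by rw [J.D_eq]; linarith
  have h3 : d ^ 2 ≤ (D * z ^ 2) ^ 2 := by
    have e1 : d ^ 2 ≤ D * z ^ 4 := by
      rw [J.D_eq]
      have : (2 * L + 2 * B + 5) * z ^ 4 = ((L + B + 2) * (2 * z ^ 3) + z ^ 3) * z := by ring
      rw [this]
      exact hd.trans (mul_le_mul_of_nonneg_right (by linarith) hz.le)
    have e2 : D * z ^ 4 ≤ D * D * z ^ 4 := by
      have : D * 1 ≤ D * D := by gcongr
      have : 0 ≤ z ^ 4 := by positivity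
      nlinarith
    calc _ ≤ _ := e1
      _ ≤ _ := e2
      _ = _ := by ring
  exact abs_le_of_sq_le_sq h3 (by positivity)

end

section
variable {T A L B D E c₀ L₁ CF ℓ E₀ Λ ϖ z ε h k τ r : ℝ} {G : Fin K → ℝ → ℝ → ℝ}
  {f u : Fin K → ℝ → ℝ → ℝ} {N n : ℕ} {V : Fin K → ℕ → ℕ → ℝ} {i : Fin K} {x t : ℝ} {m s : ℕ}
  {u₀ V₀ : ℝ} {M : Fin K → ℝ}

/-- The smallness conditions in the form in which the two tests use them. -/
theorem JunctionData.scale_bounds (P : ComparisonPair T A L c₀ L₁ CF ℓ E₀ G f u z ε h k N V)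
    (J : JunctionData T A L B D E Λ z h k τ r N n u V u₀ V₀ t s M) :
    5 ≤ D ∧ 0 < r ∧ r ≤ 1 ∧ r ≤ 2 * z ∧ E * z ^ 5 ≤ z * r / 4 ∧ D * z ^ 2 ≤ z / 64 := by
  have hz := P.z_pos
  have hz5 := P.pow_le_pow
  have hD : 5 ≤ D := by
    have := P.L_nonneg
    have := J.B_nonneg
    rw [J.D_eq]; linarith
  have hr : 0 < r := lt_of_lt_of_le (by positivity) J.r_ge
  have h1 := J.small₁
  have h2 : 0 ≤ Λ * z := mul_nonneg J.Λ_nonneg hz.le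
  have h3 : 5 * z ≤ D * z := by gcongr
  have h4 := J.r_le
  refine ⟨hD, hr, by linarith, by linarith, ?_, ?_⟩
  · have e1 : E * z ^ 5 = (4 * E * z) * (z * z ^ 3) / 4 := by ring
    rw [e1]
    have e2 : (4 * E * z) * (z * z ^ 3) ≤ 1 * (z * r) := by
      have := J.E_nonneg
      have := J.r_ge
      gcongr
      exact J.small₂
    linarith
  · have : D * z ^ 2 = (D * z) * z := by ring
    rw [this]
    have : D * z * z ≤ 1 / 64 * z := mul_le_mul_of_nonneg_right (by linarith) hz.le
    linarith

/-- The closest node to `y` on the side of the junction. -/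
theorem exists_node (h : ℝ) (hh : 0 < h) {y : ℝ} (hy : y ≤ 0) :
    ∃ m : ℕ, |y + m * h| ≤ h ∧ m * h ≤ -y := by
  have h0 : 0 ≤ -y / h := div_nonneg (by linarith) hh.le
  have h1 := Nat.floor_le h0
  have h2 := Nat.lt_floor_add_one (-y / h)
  rw [le_div_iff₀ hh] at h1
  rw [div_lt_iff₀ hh] at h2
  refine ⟨⌊-y / h⌋₊, ?_, h1⟩
  rw [abs_le]; constructor <;> linarith

/-- At the junction the values of `u` and `V` near the initial time are close. -/
theorem JunctionData.near_initial (P : ComparisonPair T A L c₀ L₁ CF ℓ E₀ G f u z ε h k N V)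
    (J : JunctionData T A L B D E Λ z h k τ r N n u V u₀ V₀ t s M) {j : Fin K} {y b : ℝ}
    (hy : y ∈ Icc (-r) 0) (ht : t ≤ D * z ^ 2) (hb : |b| ≤ (B + 2) * r)
    (hu : u₀ - (τ * (t - t) + 2 * (t - t) ^ 2 / z + Λ * z * (t - t))
      ≤ u j y 0 - b - (τ * (0 - t) + 2 * (0 - t) ^ 2 / z + Λ * z * (0 - t))) :
    u₀ - V₀ ≤ (ℓ + E₀ + 2 * L + A * (D + 2 * (A + 1)) + 2 * (B + 2) + (A + 1) * D) * z := by
  have hz := P.z_pos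
  have hz5 := P.pow_le_pow
  have hh := P.h_pos
  have hA := P.A_nonneg
  have hL := P.L_nonneg
  obtain ⟨hD, hr, hr1, hr2, hE, hDz⟩ := J.scale_bounds P
  obtain ⟨m, hm, hm2⟩ := exists_node h hh hy.2
  have h1 := P.initial j y hy.2 m
  have h2 := (abs_le.1 (P.abs_space_le j m 0 (Nat.zero_le N))).2
  rw [Nat.cast_zero, zero_mul, sub_zero, abs_of_nonneg (by positivity)] at h2
  have h3 := (abs_le.1 (P.abs_time_le j 0 J.s_le)).1
  rw [J.V₀_eq] at h3
  have h4 : ℓ * |y + m * h| ≤ ℓ * z :=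
    mul_le_mul_of_nonneg_left (by have := P.h_le; linarith) P.ℓ_nonneg
  have h5 : L * (m * h) ≤ 2 * L * z := by
    have : L * (m * h) ≤ L * (2 * z) := mul_le_mul_of_nonneg_left (by linarith [hy.1]) hL
    linarith
  have htz : t ≤ D * z := by
    have : D * z ^ 2 ≤ D * z := mul_le_mul_of_nonneg_left hz5.2.2.2.2.2 (by linarith)
    linarith
  have h6 : A * (s * k) ≤ A * (D + 2 * (A + 1)) * z := by
    have := (abs_le.1 J.ts).1
    rw [mul_assoc]
    exact mul_le_mul_of_nonneg_left (by linarith) hA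
  have h7 := (abs_le.1 hb).1
  have h8 : (B + 2) * r ≤ 2 * (B + 2) * z := by
    have := mul_le_mul_of_nonneg_left hr2 (show 0 ≤ B + 2 by linarith [J.B_nonneg])
    linarith
  have h9 : (τ + Λ * z) * t ≤ (A + 1) * D * z := by
    have e1 : τ + Λ * z ≤ A + 1 := by
      have := J.τ_le
      have := J.small₁
      have : 0 ≤ D * z := by positivity
      linarith
    have e2 := mul_le_mul_of_nonneg_right e1 J.t_mem.1
    have e3 : (A + 1) * t ≤ (A + 1) * (D * z) := by gcongr
    linarith
  have h10 : 0 ≤ 2 * (0 - t) ^ 2 / z := by positivity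
  have h11 : 2 * (t - t) ^ 2 / z = 0 := by simp
  linarith

/-- The tests of `u` from above at the junction. -/
theorem JunctionData.not_above (P : ComparisonPair T A L c₀ L₁ CF ℓ E₀ G f u z ε h k N V)
    (J : JunctionData T A L B D E Λ z h k τ r N n u V u₀ V₀ t s M) (i₀ : Fin K)
    (hΛ : 4 * D + 2 * L₁ + c₀ * (D + 2) < Λ / 2)
    (hbig : (ℓ + E₀ + 2 * L + A * (D + 2 * (A + 1)) + 2 * (B + 2) + (A + 1) * D) * z < u₀ - V₀)
    (p q : Fin K → ℝ) (hp : ∀ j, |p j| ≤ B + 1) (hq : ∀ j, |q j| ≤ B + 1)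
    (hpM : ∀ j, p j ≤ M j - z) (hsum : 0 < ∑ j, q j)
    (hH : ∀ j, ∀ y ∈ uIcc (p j) (q j), f j t 0 - τ - Λ / 2 * z - 2 * L₁ * z ≤ G j y y) :
    False := by
  have hz := P.z_pos
  have hz5 := P.pow_le_pow
  have hh := P.h_pos
  obtain ⟨hD, hr, hr1, hr2, hE, hDz⟩ := J.scale_bounds P
  -- the slope `q j` is only needed at the junction: over the distance `r` the profile is `p j x`
  -- up to `z r / 4`, less than the gap `z r` between `p j r` and `M j r`
  set ρ := z * r / (8 * (B + 1)) with hρdef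
  have hb := fun j => J.profile_bounds P (hp j) (hq j)
  have hρ : 0 < ρ := (hb i₀).1
  set α : ℝ → ℝ := fun y => τ * (y - t) + 2 * (y - t) ^ 2 / z + Λ * z * (y - t) with hα
  have hαd : ∀ y, HasDerivAt α (τ + 4 * (y - t) / z + Λ * z) y := by
    intro y
    have h1 := (hasDerivAt_id y).sub_const t
    have h2 := ((h1.const_mul τ).add (((h1.pow 2).const_mul 2).div_const z)).add
      (h1.const_mul (Λ * z))
    refine h2.congr_deriv ?_
    simp only [id]; push_cast; ring
  have hα0 : α t = 0 := by simp [hα]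
  have hr0 : -r ∈ Icc (-1 : ℝ) 0 := ⟨by linarith, by linarith⟩
  -- a contact point is within `D z²` of `t` in time, as the quadratic term is `O(r) = O(z³)` there
  have hloc : ∀ j, ∀ y ∈ Icc (-r) 0, ∀ t' ∈ Icc 0 T,
      u j 0 t - α t ≤ u j y t' - profile (p j) (q j) ρ y - α t' → |t' - t| ≤ D * z ^ 2 := by
    intro j y hy t' ht' hle
    apply J.abs_le_of_sq P
    obtain ⟨m', hm', hm2⟩ := exists_node h hh hy.2
    have h1 := J.comp j y ⟨by linarith [hy.1], hy.2⟩ t' ht' m' s J.s_le hm'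
    have h2 := (abs_le.1 (P.abs_space_le j m' 0 J.s_le)).2
    rw [Nat.cast_zero, zero_mul, sub_zero, abs_of_nonneg (by positivity), J.V₀_eq] at h2
    have h3 := (abs_le.1 ((hb j).2.2.2 y hy)).1
    rw [J.u₀_eq, hα0] at hle
    have h4 : L * (m' * h) ≤ L * r :=
      mul_le_mul_of_nonneg_left (by linarith [hy.1]) P.L_nonneg
    have e1 : ((t' - t) ^ 2 + ((s : ℝ) * k - s * k) ^ 2) / z = (t' - t) ^ 2 / z := by
      congr 1; ring
    have e2 : α t' = τ * (t' - t) + 2 * ((t' - t) ^ 2 / z) + Λ * z * (t' - t) := by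
      simp only [hα]; ring
    rw [e1] at h1
    rw [e2] at hle
    linarith
  refine P.u_sub.no_junction_test P.u_glue P.u_cont hr J.t_mem i₀
    (fun j => profile (p j) (q j) ρ) (fun j => profileSlope (p j) (q j) ρ) α
    (fun y => τ + 4 * (y - t) / z + Λ * z) (fun j => profile_zero _ _ _)
    (fun j y => hasDerivAt_profile _ _ hρ y) hαd (fun j => continuous_profileSlope _ _ _)
    (by fun_prop) ?_ ?_ ?_
  · intro j t' ht'
    have h1 := J.u_end j t' ht'
    have h2 := (abs_le.1 (abs_profile_sub_le (p j) (q j) hρ (show -r ≤ 0 by linarith))).1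
    have h3 := (hb j).2.1
    have h4 : p j * r ≤ (M j - z) * r := mul_le_mul_of_nonneg_right (hpM j) hr.le
    have h5 : 0 < z * r := by positivity
    rw [J.u₀_eq, hα0]
    simp only [hα]
    linarith
  · intro j y hy t' ht' hle
    have hd := hloc j y hy t' ht' hle
    have hd4 : |4 * (t' - t) / z| ≤ 4 * D * z := by
      rw [abs_div, abs_mul, abs_of_pos hz, div_le_iff₀ hz, abs_of_pos (by norm_num : (0:ℝ) < 4)]
      linarith
    have hd4' := abs_le.1 hd4
    refine ⟨?_, ?_, ?_⟩
    · rcases ht'.1.lt_or_eq with h | h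
      · exact h
      · exfalso
        subst h
        have h1 : t ≤ D * z ^ 2 := by
          have := (abs_le.1 hd).1; linarith
        rw [J.u₀_eq] at hle
        exact absurd (J.near_initial P hy h1 ((hb j).2.2.2 y hy) hle) (not_le.2 hbig)
    · have := J.τ_le
      have := J.small₁
      show τ + 4 * (t' - t) / z + Λ * z ≤ A + 1 / 4
      linarith
    · have h1 := hH j _ (profileSlope_mem (p j) (q j) hρ hy.2)
      have h2 := (abs_le.1 (P.f_lip j t' ht' t J.t_mem y hy.2 0 le_rfl)).2
      have h3 : c₀ * (|t' - t| + |y - 0|) ≤ c₀ * (D + 2) * z := by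
        rw [mul_assoc]
        refine mul_le_mul_of_nonneg_left ?_ P.c₀_nonneg
        have e1 : |y - 0| ≤ 2 * z := by
          rw [sub_zero, abs_of_nonpos hy.2]; linarith [hy.1]
        have e2 : D * z ^ 2 ≤ D * z := mul_le_mul_of_nonneg_left hz5.2.2.2.2.2 (by linarith)
        linarith
      have h4 := mul_lt_mul_of_pos_right hΛ hz
      show f j t' y < τ + 4 * (t' - t) / z + Λ * z
        + G j (profileSlope (p j) (q j) ρ y) (profileSlope (p j) (q j) ρ y)
      linarith
  · simpa only [profileSlope_zero] using hsum

/-- The tests of `V` from below at the junction. -/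
theorem JunctionData.not_below (P : ComparisonPair T A L c₀ L₁ CF ℓ E₀ G f u z ε h k N V)
    (J : JunctionData T A L B D E Λ z h k τ r N n u V u₀ V₀ t s M) (i₀ : Fin K)
    (hΛ : 4 * D + 2 * L₁ + 1 + 32 * CF * (B + 1) ^ 2 + c₀ * (D + 2 * A + 5) < Λ / 2)
    (p q : Fin K → ℝ) (hp : ∀ j, |p j| ≤ B + 1) (hq : ∀ j, |q j| ≤ B + 1)
    (hpM : ∀ j, M j + z ≤ p j) (hsum : ∑ j, q j ≤ -(K * z))
    (hH : ∀ j, ∀ y ∈ uIcc (p j) (q j), G j y y ≤ f j t 0 - τ - Λ / 2 * z + 2 * L₁ * z) :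
    False := by
  have hz := P.z_pos
  have hz5 := P.pow_le_pow
  have hh := P.h_pos
  have hk := P.k_pos
  obtain ⟨hD, hr, hr1, hr2, hE, hDz⟩ := J.scale_bounds P
  set ρ := z * r / (8 * (B + 1)) with hρdef
  have hb := fun j => J.profile_bounds P (hp j) (hq j)
  have hρ : 0 < ρ := (hb i₀).1
  set β : ℕ → ℝ := fun s' => τ * (s' * k - s * k) - 2 * (s' * k - s * k) ^ 2 / z with hβ
  have hβ0 : β s = 0 := by simp [hβ]
  have hmr : ∀ m' ≤ n, (m' : ℝ) * h ≤ r := by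
    intro m' hm'
    rw [J.r_eq]
    exact mul_le_mul_of_nonneg_right (by exact_mod_cast hm') hh.le
  -- a contact point is within `D z²` of `s k` in time, as the quadratic term is `O(r)` there
  have hloc : ∀ j, ∀ m' ≤ n, ∀ s' ≤ N,
      V j m' s' - profile (p j) (q j) ρ (-(m' * h)) - β s' ≤ V j 0 s - β s →
        |s' * k - s * k| ≤ D * z ^ 2 := by
    intro j m' hm' s' hs' hle
    apply J.abs_le_of_sq P
    have h1 := J.comp j 0 ⟨by norm_num, le_rfl⟩ t J.t_mem 0 s' hs' (by simp [hh.le])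
    have h2 := (abs_le.1 (P.abs_space_le j m' 0 hs')).1
    rw [Nat.cast_zero, zero_mul, sub_zero, abs_of_nonneg (by positivity)] at h2
    have h3 := (abs_le.1 ((hb j).2.2.2 (-(m' * h)) ⟨by linarith [hmr m' hm'],
      neg_nonpos.2 (by positivity)⟩)).2
    rw [J.V₀_eq, hβ0] at hle
    rw [J.u₀_eq] at h1
    have h4 : L * (m' * h) ≤ L * r := mul_le_mul_of_nonneg_left (hmr m' hm') P.L_nonneg
    have e1 : ((t - t) ^ 2 + ((s' : ℝ) * k - s * k) ^ 2) / z = (s' * k - s * k) ^ 2 / z := by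
      congr 1; ring
    have e2 : β s' = τ * (s' * k - s * k) - 2 * ((s' * k - s * k) ^ 2 / z) := by
      simp only [hβ]; ring
    rw [e1] at h1
    rw [e2] at hle
    linarith
  refine P.V_super.no_junction_test hk P.mono J.n_pos J.s_le i₀
    (fun j m' => profile (p j) (q j) ρ (-(m' * h))) β (fun j => by simp [profile_zero]) ?_ ?_ ?_ ?_
  · intro j s' hs'
    have h1 := J.V_end j s' hs'
    have h2 := (abs_le.1 (abs_profile_sub_le (p j) (q j) hρ (show -r ≤ 0 by linarith))).2
    have h3 := (hb j).2.1
    have h4 : (M j + z) * r ≤ p j * r := mul_le_mul_of_nonneg_right (hpM j) hr.le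
    have h5 : 0 < z * r := by positivity
    rw [J.V₀_eq, hβ0, ← J.r_eq]
    simp only [hβ]
    linarith
  · intro j m' hm' s' hs' hle
    have hd := hloc j m' hm' s' hs' hle
    by_contra hcon
    obtain rfl : s' = 0 := by omega
    have h1 := (abs_le.1 hd).1
    have h2 := J.s_ge
    rw [Nat.cast_zero, zero_mul] at h1
    linarith
  · intro j m' hm' hm1 s' hs' hle
    have hd := hloc j m' hm'.le (s' + 1) (by omega) hle
    have hm0 : -((m' : ℝ) * h) ≤ 0 := neg_nonpos.2 (by positivity)
    have hsk : (s' : ℝ) * k ∈ Icc 0 T := by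
      refine ⟨by positivity, le_trans ?_ P.N_le⟩
      exact mul_le_mul_of_nonneg_right (by exact_mod_cast hs'.le) hk.le
    have hβd : (β (s' + 1) - β s') / k
        = τ - 4 * ((s' + 1 : ℕ) * k - s * k) / z + 2 * k / z := by
      simp only [hβ]; field_simp; push_cast; ring
    have hd4 : -(4 * ((s' + 1 : ℕ) * k - s * k) / z) ≤ 4 * D * z := by
      rw [← neg_div, div_le_iff₀ hz]
      have := (abs_le.1 hd).1
      linarith
    have hkz : 2 * k / z ≤ z := by
      rw [div_le_iff₀ hz]
      have := P.k_le
      have : z * z = z ^ 2 := by ring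
      linarith
    have hF := (abs_le.1 (numF_sub_le (ε := ε) (h := h) P.G_lip P.L₁_nonneg
      (div_pos P.ε_pos hh).le j
      ((abs_Dplus_profile_sub_le (p j) (q j) hρ hh hm1).trans (hb j).2.2.1)
      ((abs_Dminus_profile_sub_le (p j) (q j) hρ hh m').trans (hb j).2.2.1))).2
    have hCF : 2 * (ε / h + L₁) * (16 * (B + 1) ^ 2 * z ^ 2) ≤ 32 * CF * (B + 1) ^ 2 * z := by
      have e3 : 0 ≤ ε / h + L₁ := add_nonneg (div_pos P.ε_pos hh).le P.L₁_nonneg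
      have e4 : 0 ≤ CF := e3.trans P.CF_le
      calc _ ≤ 2 * CF * (16 * (B + 1) ^ 2 * z) := by
            gcongr
            · exact P.CF_le
            · exact hz5.2.2.2.2.2
        _ = _ := by ring
    have h1 := hH j _ (profileSlope_mem (p j) (q j) hρ hm0)
    have h2 := (abs_le.1 (P.f_lip j t J.t_mem (s' * k) hsk 0 le_rfl _ hm0)).2
    have h3 : c₀ * (|t - s' * k| + |0 - -((m' : ℝ) * h)|) ≤ c₀ * (D + 2 * A + 5) * z := by
      rw [mul_assoc]
      refine mul_le_mul_of_nonneg_left ?_ P.c₀_nonneg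
      have e1 : |0 - -((m' : ℝ) * h)| ≤ 2 * z := by
        rw [zero_sub, neg_neg, abs_of_nonneg (by positivity)]
        linarith [hmr m' hm'.le]
      have e2 : D * z ^ 2 ≤ D * z := mul_le_mul_of_nonneg_left hz5.2.2.2.2.2 (by linarith)
      have e3 : |t - s' * k| ≤ 2 * (A + 1) * z + D * z ^ 2 + k := by
        have h4 := abs_le.1 J.ts
        have h5 := abs_le.1 hd
        push_cast at h5
        rw [abs_le]; constructor <;> linarith
      have := P.k_le
      linarith
    have h4 := mul_lt_mul_of_pos_right hΛ hz
    rw [hβd]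
    linarith
  · have h1 : ∀ j, -h * (q j + 16 * (B + 1) ^ 2 * z ^ 2) ≤ profile (p j) (q j) ρ (-((1 : ℕ) * h)) := by
      intro j
      have h2 := (abs_Dminus_profile_sub_le (p j) (q j) hρ hh 0).trans (hb j).2.2.1
      have h3 := (abs_le.1 h2).2
      unfold Dminus at h3
      simp only [Nat.cast_zero, zero_mul, neg_zero, profile_zero, profileSlope_zero, zero_add] at h3
      have h4 : (0 - profile (p j) (q j) ρ (-((1 : ℕ) * h))) / h ≤ q j + 16 * (B + 1) ^ 2 * z ^ 2 := by
        linarith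
      rw [div_le_iff₀ hh] at h4
      linarith
    refine lt_of_lt_of_le ?_ (Finset.sum_le_sum fun j _ => h1 j)
    rw [← Finset.mul_sum, Finset.sum_add_distrib, Finset.sum_const, Finset.card_univ,
      Fintype.card_fin, nsmul_eq_mul]
    have hKpos : (0 : ℝ) < K := by
      have : 0 < K := i₀.pos
      exact_mod_cast this
    have h5 : 16 * (B + 1) ^ 2 * z ^ 2 < z := by
      have := mul_lt_mul_of_pos_right J.small₃ hz
      linarith
    have h6 : K * (16 * (B + 1) ^ 2 * z ^ 2) < K * z := mul_lt_mul_of_pos_left h5 hKpos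
    rw [neg_mul, Left.neg_pos_iff]
    exact mul_neg_of_pos_of_neg hh (by linarith)

end

/-! ### The one-sided error estimate -/

/-- At every level `c i = f i t 0 - τ` with `|τ| ≤ M₁`, and for all slopes `M i`, there are slopes
`q i` at the junction such that one of the following holds: `∑ q i ≥ 0`, and every `q i` can be
joined to a slope `l i ≤ M i` inside the superlevel set of `H i`; or `∑ q i ≤ 0`, and every `q i`
can be joined to a slope `l i ≥ M i` inside the sublevel set.  These are the slopes of the tests
from above and from below at the junction.  The notion is invariant under `H ↦ -H(-·)`. -/
def SlopeAlternative (T M₁ L B : ℝ) (H : Fin K → ℝ → ℝ) (f : Fin K → ℝ → ℝ → ℝ) : Prop :=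
  ∀ t ∈ Icc 0 T, ∀ τ : ℝ, |τ| ≤ M₁ → ∀ M : Fin K → ℝ, (∀ i, |M i| ≤ L + 1) →
    ∃ q l : Fin K → ℝ, (∀ i, |q i| ≤ B ∧ |l i| ≤ B) ∧
      ((0 ≤ ∑ i, q i ∧ ∀ i, l i ≤ M i ∧ ∀ y ∈ uIcc (l i) (q i), f i t 0 - τ ≤ H i y) ∨
       (∑ i, q i ≤ 0 ∧ ∀ i, M i ≤ l i ∧ ∀ y ∈ uIcc (l i) (q i), H i y ≤ f i t 0 - τ))

/-- Shifting the ends of an interval by at most `d` moves its points by at most `d`. -/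
theorem exists_mem_uIcc_abs_sub_le {l q l' q' d y : ℝ} (hl : |l' - l| ≤ d) (hq : |q' - q| ≤ d)
    (hy : y ∈ uIcc l' q') : ∃ w ∈ uIcc l q, |y - w| ≤ d := by
  rw [abs_le] at hl hq
  rw [mem_uIcc] at hy
  rcases le_total l q with h | h
  · refine ⟨max l (min y q), by
      rw [uIcc_of_le h]; exact ⟨le_max_left _ _, max_le h (min_le_right _ _)⟩, ?_⟩
    rw [abs_le]
    rcases hy with hy | hy <;> rcases le_total y q with h1 | h1 <;>
      rcases le_total l y with h2 | h2 <;>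
      simp only [min_eq_left h1, min_eq_right h1, max_eq_right h, max_eq_left h2, max_eq_right h2] <;>
      constructor <;> linarith
  · refine ⟨max q (min y l), by
      rw [uIcc_of_ge h]; exact ⟨le_max_left _ _, max_le h (min_le_right _ _)⟩, ?_⟩
    rw [abs_le]
    rcases hy with hy | hy <;> rcases le_total y l with h1 | h1 <;>
      rcases le_total q y with h2 | h2 <;>
      simp only [min_eq_left h1, min_eq_right h1, max_eq_right h, max_eq_left h2, max_eq_right h2] <;>
      constructor <;> linarith

section
variable {T A L B D E c₀ L₁ CF ℓ E₀ Λ ϖ z ε h k τ r : ℝ} {G : Fin K → ℝ → ℝ → ℝ}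
  {f u : Fin K → ℝ → ℝ → ℝ} {N n : ℕ} {V : Fin K → ℕ → ℕ → ℝ} {i : Fin K} {x t : ℝ} {m s : ℕ}
  {u₀ V₀ : ℝ} {M : Fin K → ℝ}

/-- The chord slopes `M j` are those of `V`, with the time of the far end chosen to be the worst;
the comparison of `u` with `V` at this time bounds the far end of `u` at all times. -/
theorem IsDoublingMax.exists_junctionData
    (P : ComparisonPair T A L c₀ L₁ CF ℓ E₀ G f u z ε h k N V)
    (Q : IsDoublingMax T A L Λ ϖ z h k N u V i 0 t m s) (hϖ : 0 ≤ ϖ) (hϖz : ϖ ≤ z ^ 6)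
    (hB : 0 ≤ B) (hD : D = 2 * L + 2 * B + 5) (hE : E = L * (2 * L + 2) + (L + 2) ^ 2 + 1)
    (hΛ : 0 ≤ Λ) (small₁ : (4 * D + Λ) * z ≤ 1 / 16) (small₂ : 4 * E * z ≤ 1)
    (small₃ : 16 * (B + 1) ^ 2 * z < 1) :
    ∃ (τ r : ℝ) (n : ℕ) (M : Fin K → ℝ), (∀ j, |M j| ≤ L + 1) ∧
      JunctionData T A L B D E Λ z h k τ r N n u V (u i 0 t) (V i 0 s) t s M := by
  classical
  obtain ⟨τ, hτ⟩ : ∃ τ, τ = (t - s * k + ((A + 1 / 8) * z + 2 * k)) / z := ⟨_, rfl⟩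
  have hz := P.z_pos
  have hz1 := P.z_le
  have hz5 := P.pow_le_pow
  have hh := P.h_pos
  have hL := P.L_nonneg
  have hE0 : 0 ≤ E := by rw [hE]; positivity
  set n := ⌈z ^ 3 / h⌉₊ with hn
  have hn1 : 1 ≤ n := Nat.one_le_iff_ne_zero.2 (Nat.ceil_pos.2 (by positivity)).ne'
  set r := (n : ℝ) * h with hr
  have hr1 : z ^ 3 ≤ r := by
    have := Nat.le_ceil (z ^ 3 / h)
    rwa [div_le_iff₀ hh] at this
  have hr2 : r ≤ 2 * z ^ 3 := by
    have := Nat.ceil_lt_add_one (show 0 ≤ z ^ 3 / h by positivity)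
    have h1 : r < (z ^ 3 / h + 1) * h := mul_lt_mul_of_pos_right this hh
    rw [add_mul, div_mul_cancel₀ _ hh.ne'] at h1
    have := P.h_le
    linarith
  have hr0 : 0 < r := lt_of_lt_of_le (by positivity) hr1
  have hD5 : 5 ≤ D := by rw [hD]; linarith
  have hzs : z ≤ 1 / 320 := by
    have h2 : 0 ≤ Λ * z := by positivity
    have h3 : 5 * z ≤ D * z := by gcongr
    linarith
  have hr3 : r ≤ 1 := by linarith
  have comp : ∀ j, ∀ y ∈ Icc (-1) (0 : ℝ), ∀ t' ∈ Icc 0 T, ∀ m' : ℕ, ∀ s' ≤ N,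
      |y + m' * h| ≤ h → (u j y t' - u i 0 t) - (V j m' s' - V i 0 s)
        ≤ τ * ((t' - t) - (s' * k - s * k))
          + ((t' - t) ^ 2 + (s' * k - s * k) ^ 2) / z + Λ * z * (t' - t) + E * z ^ 5 :=
    fun j y hy t' ht' m' s' hs' hym =>
      Q.junction_comparison P hϖ hϖz hE hτ j hy ht' hs' hym
  set v : Fin K → ℕ → ℕ → ℝ := fun j m' s' =>
    V j m' s' - (τ * (s' * k - s * k) - 2 * (s' * k - s * k) ^ 2 / z) - V i 0 s with hv
  have hmin : ∀ j, ∃ s' ≤ N, ∀ s'' ≤ N, v j n s' ≤ v j n s'' := by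
    intro j
    obtain ⟨s', h1, h2⟩ := Finset.exists_min_image (Finset.range (N + 1)) (fun s' => v j n s')
      ⟨0, by simp⟩
    refine ⟨s', by simpa [Nat.lt_succ_iff] using h1, fun s'' hs'' => h2 s'' (by simp; omega)⟩
  choose σ hσN hσ using hmin
  have hVu : ∀ j, V j 0 s = V i 0 s := fun j => P.V_super.glue j i s Q.s_le
  refine ⟨τ, r, n, fun j => -(v j n (σ j)) / r, ?_, ?_⟩
  · intro j
    rw [abs_div, abs_neg, abs_of_pos hr0, div_le_iff₀ hr0, abs_le]
    have hEr : E * z ^ 5 ≤ r := by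
      have : E * z ^ 5 = (4 * E * z) * (z * z ^ 3) / 4 := by ring
      rw [this]
      have : (4 * E * z) * (z * z ^ 3) ≤ 1 * (1 * r) := by gcongr
      linarith
    constructor
    · have h1 := comp j 0 ⟨by norm_num, le_rfl⟩ t Q.t_mem 0 (σ j) (hσN j) (by simp [hh.le])
      have h2 := (abs_le.1 (P.abs_space_le j n 0 (hσN j))).1
      rw [Nat.cast_zero, zero_mul, sub_zero, abs_of_nonneg (by positivity)] at h2
      have h3 := P.u_glue i j t Q.t_mem
      have e1 : ((t - t) ^ 2 + ((σ j : ℕ) * k - s * k) ^ 2) / z = (σ j * k - s * k) ^ 2 / z := by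
        congr 1; ring
      have e2 : 0 ≤ ((σ j : ℕ) * k - s * k) ^ 2 / z := by positivity
      rw [e1] at h1
      have e3 : v j n (σ j) = V j n (σ j) - τ * (σ j * k - s * k)
          + 2 * ((σ j * k - s * k) ^ 2 / z) - V i 0 s := by
        simp only [hv]; ring
      rw [e3]
      linarith
    · have h1 := hσ j s Q.s_le
      have h2 := (abs_le.1 (P.abs_space_le j n 0 Q.s_le)).2
      rw [Nat.cast_zero, zero_mul, sub_zero, abs_of_nonneg (by positivity), hVu] at h2
      have e1 : v j n s = V j n s - V i 0 s := by simp [hv]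
      rw [e1] at h1
      linarith
  · have hM : ∀ j, -(-(v j n (σ j)) / r) * r = v j n (σ j) := by
      intro j; field_simp
    refine ⟨hB, hD, hE0, Q.t_mem, Q.s_le, fun j => P.u_glue j i t Q.t_mem, hVu, hn1, rfl, hr1, hr2,
      hΛ, small₁, small₂, small₃, ?_, hτ ▸ (Q.slope_t_le P).1, Q.abs_t_sub_le P,
      (Q.slope_t_le P).2, comp, ?_, ?_⟩
    · exact hτ ▸ Q.slope_t_ge P
    · intro j s' hs'
      rw [hM]
      exact hσ j s' hs'
    · intro j t' ht'
      rw [hM]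
      have h1 := comp j (-r) ⟨by linarith, by linarith⟩ t' ht' n (σ j) (hσN j) (by
        rw [hr]; simp [hh.le])
      have e1 : ((t' - t) ^ 2 + ((σ j : ℕ) * k - s * k) ^ 2) / z
          = (t' - t) ^ 2 / z + (σ j * k - s * k) ^ 2 / z := by ring
      have e3 : v j n (σ j) = V j n (σ j) - τ * (σ j * k - s * k)
          + 2 * ((σ j * k - s * k) ^ 2 / z) - V i 0 s := by
        simp only [hv]; ring
      have e4 : 2 * (t' - t) ^ 2 / z = 2 * ((t' - t) ^ 2 / z) := by ring
      have e2 : 0 ≤ ((σ j : ℕ) * k - s * k) ^ 2 / z := by positivity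
      have e5 : 0 ≤ (t' - t) ^ 2 / z := by positivity
      rw [e1] at h1
      rw [e3, e4]
      linarith

/-- A maximum of the doubled functional at the junction forces `u` and `V` to be close there. -/
theorem IsDoublingMax.junction_le
    (P : ComparisonPair T A L c₀ L₁ CF ℓ E₀ G f u z ε h k N V)
    (hSA : SlopeAlternative T (A + 1 / 4) L B (fun i p => G i p p) f)
    (Q : IsDoublingMax T A L Λ ϖ z h k N u V i 0 t m s) (hϖ : 0 ≤ ϖ) (hϖz : ϖ ≤ z ^ 6)
    (hB : 0 ≤ B) (hD : D = 2 * L + 2 * B + 5) (hE : E = L * (2 * L + 2) + (L + 2) ^ 2 + 1)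
    (hΛ : 4 * D + 2 * L₁ + 1 + 32 * CF * (B + 1) ^ 2 + c₀ * (D + 2 * A + 5) < Λ / 2)
    (small₁ : (4 * D + Λ) * z ≤ 1 / 16) (small₂ : 4 * E * z ≤ 1)
    (small₃ : 16 * (B + 1) ^ 2 * z < 1) :
    u i 0 t - V i 0 s
      ≤ (ℓ + E₀ + 2 * L + A * (D + 2 * (A + 1)) + 2 * (B + 2) + (A + 1) * D) * z := by
  by_contra hbig
  push Not at hbig
  have hz := P.z_pos
  have hz1 := P.z_le
  have hL := P.L_nonneg
  have hL₁ := P.L₁_nonneg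
  have hA := P.A_nonneg
  have hc₀ := P.c₀_nonneg
  have hCF : 0 ≤ CF := le_trans (add_nonneg (div_pos P.ε_pos P.h_pos).le hL₁) P.CF_le
  have hD0 : 0 ≤ D := by rw [hD]; positivity
  have hcD : 0 ≤ c₀ * (2 * A + 3) := by positivity
  have hCB : 0 ≤ 32 * CF * (B + 1) ^ 2 := by positivity
  have hΛ' : 4 * D + 2 * L₁ + c₀ * (D + 2) < Λ / 2 := by linarith
  have hcD2 : 0 ≤ c₀ * (D + 2) := by positivity
  have hΛ0 : 0 ≤ Λ := by linarith
  obtain ⟨τ, r, n, M, hM, J⟩ := Q.exists_junctionData P hϖ hϖz hB hD hE hΛ0 small₁ small₂ small₃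
  have hτ : |τ + Λ / 2 * z| ≤ A + 1 / 4 := by
    have h1 := J.τ_ge
    have h2 := J.τ_le
    have h3 : 0 ≤ D * z := by positivity
    have h4 : 0 ≤ Λ * z := by positivity
    rw [abs_le]; constructor <;> linarith
  obtain ⟨q, l, hql, hup | hdown⟩ := hSA t J.t_mem _ hτ M hM
  all_goals
    have hlip : ∀ j, ∀ y w : ℝ, |y - w| ≤ z → |G j y y - G j w w| ≤ 2 * L₁ * z := by
      intro j y w hyw
      have := P.G_lip j y y w w
      have := mul_le_mul_of_nonneg_left hyw hL₁
      linarith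
    have hKpos : (0 : ℝ) < K := by
      have : 0 < K := i.pos
      exact_mod_cast this
    have habs : ∀ y d : ℝ, |y| ≤ B → |d| ≤ z → |y + d| ≤ B + 1 := fun y d hy hd =>
      (abs_add_le _ _).trans (by linarith)
    have hz' : |z| ≤ z := (abs_of_pos hz).le
    have hzn : |-z| ≤ z := by rw [abs_neg]; exact hz'
  · refine J.not_above P i hΛ' hbig (fun j => l j + -z) (fun j => q j + z)
      (fun j => habs _ _ (hql j).2 hzn) (fun j => habs _ _ (hql j).1 hz')
      (fun j => by linarith [(hup.2 j).1]) ?_ ?_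
    · rw [Finset.sum_add_distrib, Finset.sum_const, Finset.card_univ, Fintype.card_fin,
        nsmul_eq_mul]
      have : 0 < K * z := by positivity
      linarith [hup.1]
    · intro j y hy
      obtain ⟨w, hw, hyw⟩ := exists_mem_uIcc_abs_sub_le (l := l j) (q := q j) (d := z)
        (by simpa using hz') (by simpa using hz') hy
      have h1 := (hup.2 j).2 w hw
      have h2 := (abs_le.1 (hlip j y w hyw)).1
      linarith
  · refine J.not_below P i hΛ (fun j => l j + z) (fun j => q j + -z)
      (fun j => habs _ _ (hql j).2 hz') (fun j => habs _ _ (hql j).1 hzn)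
      (fun j => by linarith [(hdown.2 j).1]) ?_ ?_
    · rw [Finset.sum_add_distrib, Finset.sum_const, Finset.card_univ, Fintype.card_fin,
        nsmul_eq_mul]
      linarith [hdown.1]
    · intro j y hy
      obtain ⟨w, hw, hyw⟩ := exists_mem_uIcc_abs_sub_le (l := l j) (q := q j) (d := z)
        (by simpa using hz') (by simpa using hz') hy
      have h1 := (hdown.2 j).2 w hw
      have h2 := (abs_le.1 (hlip j y w hyw)).2
      linarith

/-- The one-sided error estimate.  A maximum of the doubled functional lies at the initial time or
at the junction. -/
theorem ComparisonPair.sub_le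
    (P : ComparisonPair T A L c₀ L₁ CF ℓ E₀ G f u z ε h k N V)
    (hSA : SlopeAlternative T (A + 1 / 4) L B (fun i p => G i p p) f)
    (hB : 0 ≤ B) (hD : D = 2 * L + 2 * B + 5) (hE : E = L * (2 * L + 2) + (L + 2) ^ 2 + 1)
    (hΛ : 4 * D + 2 * L₁ + 1 + 32 * CF * (B + 1) ^ 2 + c₀ * (D + 2 * A + 5) < Λ / 2)
    (small₁ : (4 * D + Λ) * z ≤ 1 / 16) (small₂ : 4 * E * z ≤ 1)
    (small₃ : 16 * (B + 1) ^ 2 * z < 1) (hΛ' : 2 * L₁ + c₀ * (2 * A + 2 * L + 5) + 1 + CF < Λ)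
    (j : Fin K) (m' s' : ℕ) (hs' : s' ≤ N) :
    u j (-(m' * h)) (s' * k) - V j m' s'
      ≤ ((ℓ * (2 * L + 2) + E₀ + 2 * A * (A + 1))
        + (ℓ + E₀ + 2 * L + A * (D + 2 * (A + 1)) + 2 * (B + 2) + (A + 1) * D)
        + L * (2 * L + 2) + (L + 1) ^ 2 + (A + 1) ^ 2 + Λ * T + 1) * z := by
  have hz := P.z_pos
  have hz1 := P.z_le
  have hz5 := P.pow_le_pow
  have hh := P.h_pos
  have hk := P.k_pos
  have hL := P.L_nonneg
  have hA := P.A_nonneg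
  have hℓ := P.ℓ_nonneg
  have hE₀ := P.E₀_nonneg
  have hL₁ := P.L₁_nonneg
  have hc₀ := P.c₀_nonneg
  have hCF : 0 ≤ CF := le_trans (add_nonneg (div_pos P.ε_pos P.h_pos).le hL₁) P.CF_le
  have hD0 : 0 ≤ D := by rw [hD]; positivity
  have hcc : 0 ≤ c₀ * (2 * A + 2 * L + 5) := by positivity
  have hΛ0 : 0 < Λ := by linarith
  have hm'h : 0 ≤ (m' : ℝ) * h := by positivity
  -- the linear term `ϖ x` has to be small at the node `m'` where the estimate is wanted
  set ϖ := z ^ 6 / (1 + m' * h) with hϖdef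
  have hϖ : 0 < ϖ := by positivity
  have hϖz : ϖ ≤ z ^ 6 := div_le_self (by positivity) (by linarith)
  obtain ⟨i, x, t, m, s, Q⟩ := P.exists_doublingMax j hΛ0.le hϖ
  have hsk : 0 ≤ (s : ℝ) * k := by positivity
  -- the value of the functional at its maximum
  have hmax : u i x t - V i m s ≤ ((ℓ * (2 * L + 2) + E₀ + 2 * A * (A + 1))
        + (ℓ + E₀ + 2 * L + A * (D + 2 * (A + 1)) + 2 * (B + 2) + (A + 1) * D)
        + L * (2 * L + 2)) * z := by
    have h1 := Q.abs_x_add_le P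
    have h0 : |x + m * h| ≤ (2 * L + 2) * z :=
      h1.trans (mul_le_mul_of_nonneg_left hz5.1 (by positivity))
    have p1 : 0 ≤ (ℓ * (2 * L + 2) + E₀ + 2 * A * (A + 1)) * z := by positivity
    have p2 : 0 ≤ (ℓ + E₀ + 2 * L + A * (D + 2 * (A + 1)) + 2 * (B + 2) + (A + 1) * D) * z := by
      positivity
    have p3 : 0 ≤ L * (2 * L + 2) * z := by positivity
    rcases Q.t_mem.1.lt_or_eq with ht | ht
    · have hx := Q.x_eq_zero P ht hϖ.le (hϖz.trans (by linarith)) (by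
        have : 0 ≤ D * z := by positivity
        linarith) hΛ'
      subst hx
      have h2 := Q.junction_le P hSA hϖ.le hϖz hB hD hE hΛ small₁ small₂ small₃
      have h3 := (abs_le.1 (P.abs_space_le i m 0 Q.s_le)).1
      rw [Nat.cast_zero, zero_mul, sub_zero, abs_of_nonneg (by positivity)] at h3
      rw [zero_add, abs_of_nonneg (by positivity)] at h0
      have h4 := mul_le_mul_of_nonneg_left h0 hL
      linarith
    · subst ht
      have h2 := P.initial i x Q.x_le m
      have h3 := (abs_le.1 (P.abs_time_le i m Q.s_le)).1
      have h4 := Q.abs_t_sub_le P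
      rw [zero_sub, abs_neg, abs_of_nonneg hsk] at h4
      have h5 := mul_le_mul_of_nonneg_left h4 hA
      have h6 := mul_le_mul_of_nonneg_left h0 hℓ
      linarith
  have hskT : (s' : ℝ) * k ∈ Icc 0 T := by
    refine ⟨by positivity, le_trans ?_ P.N_le⟩
    exact mul_le_mul_of_nonneg_right (by exact_mod_cast hs') hk.le
  have hcmp := Q.max j (-(m' * h)) (by linarith) (s' * k) hskT m' s' hs'
  have q1 : 0 ≤ (x + m * h - (L * z ^ 5 + h)) ^ 2 / (2 * z ^ 5) := by positivity
  have q2 : 0 ≤ (t - s * k + ((A + 1 / 8) * z + 2 * k)) ^ 2 / (2 * z) := by positivity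
  have q3 : 0 ≤ Λ * z * t := by have := Q.t_mem.1; positivity
  have q4 : ϖ * x ≤ 0 := mul_nonpos_of_nonneg_of_nonpos hϖ.le Q.x_le
  have q5 : (-(m' * h) + m' * h - (L * z ^ 5 + h)) ^ 2 / (2 * z ^ 5) ≤ (L + 1) ^ 2 * z := by
    rw [div_le_iff₀ (by positivity)]
    have e1 : L * z ^ 5 + h ≤ (L + 1) * z ^ 5 := by
      have := P.h_le; linarith
    have e2 : 0 ≤ L * z ^ 5 + h := by positivity
    have e3 : (L * z ^ 5 + h) ^ 2 ≤ ((L + 1) * z ^ 5) ^ 2 := pow_le_pow_left₀ e2 e1 2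
    have e4 : ((L + 1) * z ^ 5) ^ 2 ≤ (L + 1) ^ 2 * (z ^ 5 * z) := by
      have : ((L + 1) * z ^ 5) ^ 2 = (L + 1) ^ 2 * (z ^ 5 * z ^ 5) := by ring
      rw [this]
      gcongr
      exact hz5.1
    have e5 : 0 ≤ (L + 1) ^ 2 * (z ^ 5 * z) := by positivity
    have e6 : (-(m' * h) + m' * h - (L * z ^ 5 + h)) ^ 2 = (L * z ^ 5 + h) ^ 2 := by ring
    linarith
  have q6 : (s' * k - s' * k + ((A + 1 / 8) * z + 2 * k)) ^ 2 / (2 * z) ≤ (A + 1) ^ 2 * z := by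
    rw [div_le_iff₀ (by positivity), sub_self, zero_add]
    have e1 : (A + 1 / 8) * z + 2 * k ≤ (A + 1) * z := by
      have := P.k_le; linarith
    have e2 : 0 ≤ (A + 1 / 8) * z + 2 * k := by positivity
    have e3 := pow_le_pow_left₀ e2 e1 2
    have e4 : 0 ≤ ((A + 1) * z) ^ 2 := by positivity
    linarith
  have q7 : Λ * z * (s' * k) ≤ Λ * T * z := by
    have := mul_le_mul_of_nonneg_left hskT.2 (show 0 ≤ Λ * z by positivity)
    linarith
  have q8 : ϖ * (m' * h) ≤ z := by
    rw [hϖdef, div_mul_eq_mul_div, div_le_iff₀ (by positivity)]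
    have : z ^ 6 * (m' * h) ≤ z * (m' * h) := mul_le_mul_of_nonneg_right (by linarith) hm'h
    linarith
  linarith

end

/-! ### The slope alternative for coercive Hamiltonians -/

/-- On one edge: walk from `M` to the right as long as the Hamiltonian is at least `c`, or to the
left as long as it is below `c`.  Coercivity stops the walk to the left; the walk to the right is
stopped at `B`. -/
theorem exists_slope_of_coercive {H : ℝ → ℝ} (hH : Continuous H) {c Q B M : ℝ} (hM : |M| ≤ Q)
    (hQB : Q ≤ B) (hco : ∀ p, Q ≤ |p| → c ≤ H p) :
    ∃ q, -Q ≤ q ∧ q ≤ B ∧ (∃ l ≤ M, |l| ≤ B ∧ ∀ y ∈ uIcc l q, c ≤ H y) ∧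
      (q = B ∨ ∃ l, M ≤ l ∧ |l| ≤ B ∧ ∀ y ∈ uIcc l q, H y ≤ c) := by
  have hM' := abs_le.1 hM
  have hQ0 : 0 ≤ Q := (abs_nonneg M).trans hM
  rcases lt_or_ge (H M) c with hMc | hMc
  · -- to the left
    set S := Icc (-Q) M ∩ {p | c ≤ H p} with hS
    have hSc : IsCompact S := isCompact_Icc.inter_right (isClosed_le continuous_const hH)
    have hne : S.Nonempty := ⟨-Q, ⟨le_rfl, hM'.1⟩, hco _ (by rw [abs_neg, abs_of_nonneg hQ0])⟩
    obtain ⟨q, ⟨⟨hq1, hq2⟩, hqc⟩, hmax⟩ := hSc.exists_isGreatest hne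
    have hqc : c ≤ H q := hqc
    have hq : ∀ y ∈ Icc q M, H y ≤ c := by
      intro y hy
      by_contra hcon
      push Not at hcon
      have : y ≤ q := hmax ⟨⟨hq1.trans hy.1, hy.2⟩, hcon.le⟩
      obtain rfl : y = q := le_antisymm this hy.1
      obtain ⟨w, hw, hwc⟩ := intermediate_value_Icc' hq2 hH.continuousOn
        (show c ∈ Icc (H M) (H y) from ⟨hMc.le, hqc⟩)
      have : w ≤ y := hmax ⟨⟨hq1.trans hw.1, hw.2⟩, hwc.ge⟩
      obtain rfl : w = y := le_antisymm this hw.1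
      linarith
    refine ⟨q, hq1, by linarith, ⟨q, hq2, abs_le.2 ⟨by linarith, by linarith⟩, ?_⟩,
      Or.inr ⟨M, le_rfl, hM.trans hQB, ?_⟩⟩
    · intro y hy
      rw [uIcc_self, mem_singleton_iff] at hy
      rw [hy]; exact hqc
    · intro y hy
      rw [uIcc_of_ge hq2] at hy
      exact hq y hy
  · by_cases hall : ∀ p ∈ Icc M B, c ≤ H p
    · refine ⟨B, by linarith, le_rfl, ⟨M, le_rfl, hM.trans hQB, ?_⟩, Or.inl rfl⟩
      intro y hy
      rw [uIcc_of_le (by linarith)] at hy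
      exact hall y hy
    · push Not at hall
      obtain ⟨p₀, hp₀, hp₀c⟩ := hall
      set S := Icc M B ∩ {p | H p ≤ c} with hS
      have hSc : IsCompact S := isCompact_Icc.inter_right (isClosed_le hH continuous_const)
      obtain ⟨q, ⟨⟨hq1, hq2⟩, hqc⟩, hmin⟩ := hSc.exists_isLeast ⟨p₀, hp₀, hp₀c.le⟩
      have hqc : H q ≤ c := hqc
      have hq : ∀ y ∈ Icc M q, c ≤ H y := by
        intro y hy
        by_contra hcon
        push Not at hcon
        have : q ≤ y := hmin ⟨⟨hy.1, hy.2.trans hq2⟩, hcon.le⟩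
        obtain rfl : y = q := le_antisymm hy.2 this
        obtain ⟨w, hw, hwc⟩ := intermediate_value_Icc' hq1 hH.continuousOn
          (show c ∈ Icc (H y) (H M) from ⟨hqc, hMc⟩)
        have : y ≤ w := hmin ⟨⟨hw.1, hw.2.trans hq2⟩, hwc.le⟩
        obtain rfl : w = y := le_antisymm hw.2 this
        linarith
      refine ⟨q, by linarith, hq2, ⟨M, le_rfl, hM.trans hQB, ?_⟩,
        Or.inr ⟨q, hq1, abs_le.2 ⟨by linarith, hq2⟩, ?_⟩⟩
      · intro y hy
        rw [uIcc_of_le hq1] at hy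
        exact hq y hy
      · intro y hy
        rw [uIcc_self, mem_singleton_iff] at hy
        rw [hy]; exact hqc

/-- If the slopes chosen on the edges have a negative sum, none of them is the cap `K Q`, since the
others are at least `-Q`; so the second alternative is available on every edge. -/
theorem slopeAlternative_of_coercive {T M₁ L Q : ℝ} {H : Fin K → ℝ → ℝ}
    {f : Fin K → ℝ → ℝ → ℝ} (hK : 0 < K) (hH : ∀ i, Continuous (H i)) (hLQ : L + 1 ≤ Q)
    (hQ0 : 0 ≤ Q)
    (hco : ∀ i, ∀ t ∈ Icc 0 T, ∀ τ, |τ| ≤ M₁ → ∀ p, Q ≤ |p| → f i t 0 - τ ≤ H i p) :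
    SlopeAlternative T M₁ L (K * Q) H f := by
  classical
  intro t ht τ hτ M hM
  have hK1 : (1 : ℝ) ≤ K := by exact_mod_cast hK
  have hQB : Q ≤ K * Q := by nlinarith
  have hex := fun i => exists_slope_of_coercive (hH i) ((hM i).trans hLQ) hQB (hco i t ht τ hτ)
  choose q hq1 hq2 hup hdown using hex
  have hqabs : ∀ i, |q i| ≤ K * Q := fun i => abs_le.2 ⟨by linarith [hq1 i], hq2 i⟩
  rcases le_or_gt 0 (∑ i, q i) with hs | hs
  · choose l hl1 hl2 hl3 using hup
    exact ⟨q, l, fun i => ⟨hqabs i, hl2 i⟩, Or.inl ⟨hs, fun i => ⟨hl1 i, hl3 i⟩⟩⟩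
  · have hne : ∀ i, q i ≠ K * Q := by
      intro i hi
      have h1 : ∑ j ∈ Finset.univ.erase i, (-Q) ≤ ∑ j ∈ Finset.univ.erase i, q j :=
        Finset.sum_le_sum fun j _ => hq1 j
      rw [Finset.sum_const, Finset.card_erase_of_mem (Finset.mem_univ i), Finset.card_univ,
        Fintype.card_fin, nsmul_eq_mul, Nat.cast_sub hK] at h1
      have h2 := Finset.add_sum_erase Finset.univ q (Finset.mem_univ i)
      push_cast at h1
      linarith
    have hdown' := fun i => (hdown i).resolve_left (hne i)
    choose l hl1 hl2 hl3 using hdown'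
    exact ⟨q, l, fun i => ⟨hqabs i, hl2 i⟩, Or.inr ⟨hs.le, fun i => ⟨hl1 i, hl3 i⟩⟩⟩

/-! ### Reflection `u ↦ -u` -/

theorem SlopeAlternative.reflect {T M₁ L B : ℝ} {H : Fin K → ℝ → ℝ} {f : Fin K → ℝ → ℝ → ℝ}
    (h : SlopeAlternative T M₁ L B H f) :
    SlopeAlternative T M₁ L B (fun i p => -H i (-p)) (fun i t x => -f i t x) := by
  intro t ht τ hτ M hM
  obtain ⟨q, l, hql, hor⟩ := h t ht (-τ) (by rwa [abs_neg]) (fun i => -M i)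
    (fun i => by rw [abs_neg]; exact hM i)
  have hmem : ∀ i, ∀ y ∈ uIcc (-l i) (-q i), -y ∈ uIcc (l i) (q i) := by
    intro i y hy
    rw [mem_uIcc] at hy ⊢
    rcases hy with hy | hy
    · right; constructor <;> linarith
    · left; constructor <;> linarith
  refine ⟨fun i => -q i, fun i => -l i, fun i => by simpa only [abs_neg] using hql i, ?_⟩
  rw [Finset.sum_neg_distrib]
  rcases hor with hup | hdown
  · right
    refine ⟨by linarith [hup.1], fun i => ⟨by linarith [(hup.2 i).1], fun y hy => ?_⟩⟩
    have := (hup.2 i).2 (-y) (hmem i y hy)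
    linarith
  · left
    refine ⟨by linarith [hdown.1], fun i => ⟨by linarith [(hdown.2 i).1], fun y hy => ?_⟩⟩
    have := (hdown.2 i).2 (-y) (hmem i y hy)
    linarith

/-- The test function `-φ`. -/
def TestFunction.reflect {T : ℝ} (φ : TestFunction K T) : TestFunction K T where
  val i x t := -φ.val i x t
  dx i x t := -φ.dx i x t
  dt i x t := -φ.dt i x t
  glue i j t ht := by rw [φ.glue i j t ht]
  continuousOn_val i := (φ.continuousOn_val i).neg
  hasDeriv_dx i x hx t ht := (φ.hasDeriv_dx i x hx t ht).neg
  hasDeriv_dt i x hx t ht := (φ.hasDeriv_dt i x hx t ht).neg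
  continuousOn_dx i := (φ.continuousOn_dx i).neg
  continuousOn_dt i := (φ.continuousOn_dt i).neg

theorem IsSubsolution.below {T M₁ : ℝ} {H H' : Fin K → ℝ → ℝ} {f u : Fin K → ℝ → ℝ → ℝ}
    (h : IsSubsolution T (separated H f) u) (hH : ∀ i p, H' i p ≤ H i p) :
    IsSubsolutionBelow T M₁ H' f u := by
  intro φ
  refine ⟨fun i x hx t ht hloc _ => ?_, fun t ht hloc _ => ?_⟩
  · have h1 := (h φ).1 i x hx t ht hloc
    have h2 := hH i (φ.dx i x t)
    unfold separated at h1
    linarith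
  · rcases (h φ).2 t ht hloc with h1 | ⟨i, h1⟩
    · exact Or.inl h1
    · refine Or.inr ⟨i, ?_⟩
      have h2 := hH i (φ.dx i 0 t)
      unfold separated at h1
      linarith

/-- A supersolution for the Hamiltonians `H` is one for the truncated Hamiltonians `min H b`, as
long as the time derivative of the test function is at least `-M₁`. -/
theorem IsSupersolution.reflect_below {T M₁ : ℝ} {H H' : Fin K → ℝ → ℝ}
    {f u : Fin K → ℝ → ℝ → ℝ} (h : IsSupersolution T (separated H f) u) (b : Fin K → ℝ)
    (hH : ∀ i p, H' i p = min (H i p) (b i))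
    (hb : ∀ i, ∀ t ∈ Icc 0 T, ∀ x ≤ 0, f i t x + M₁ ≤ b i) :
    IsSubsolutionBelow T M₁ (fun i p => -H' i (-p)) (fun i t x => -f i t x)
      (fun i x t => -u i x t) := by
  intro φ
  have hmin : ∀ i x t, IsLocalMaxOn (φ.diff (fun i x t => -u i x t) i) (edgeDomain T) (x, t) →
      IsLocalMinOn (φ.reflect.diff u i) (edgeDomain T) (x, t) := by
    intro i x t hloc
    filter_upwards [hloc] with y hy
    simp only [TestFunction.diff, TestFunction.reflect] at hy ⊢
    linarith
  have key : ∀ i, ∀ x ≤ 0, ∀ t ∈ Ioc 0 T, φ.dt i x t ≤ M₁ →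
      0 ≤ φ.reflect.dt i x t + separated H f i t x (φ.reflect.dx i x t) →
      φ.dt i x t + -H' i (-φ.dx i x t) ≤ -f i t x := by
    intro i x hx t ht hM h1
    have h2 := hb i t ⟨ht.1.le, ht.2⟩ x hx
    simp only [separated, TestFunction.reflect] at h1
    have h3 : f i t x + φ.dt i x t ≤ H' i (-φ.dx i x t) := by
      rw [hH]; exact le_min (by linarith) (by linarith)
    linarith
  refine ⟨fun i x hx t ht hloc hM => ?_, fun t ht hloc hM => ?_⟩
  · exact key i x hx.le t ht hM ((h φ.reflect).1 i x hx t ht (hmin i x t hloc))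
  · rcases (h φ.reflect).2 t ht (fun i => hmin i 0 t (hloc i)) with h1 | ⟨i, h1⟩
    · left
      simp only [TestFunction.reflect, Finset.sum_neg_distrib] at h1
      linarith
    · exact Or.inr ⟨i, key i 0 le_rfl t ht (hM i) h1⟩

theorem numF_reflect (ε h : ℝ) (g : ℝ → ℝ → ℝ) (p q : ℝ) :
    numF ε h (fun p q => -g (-p) (-q)) p q = -numF ε h g (-p) (-q) := by
  unfold numF; ring

theorem NumHamLipschitz.reflect {L₁ : ℝ} {G : Fin K → ℝ → ℝ → ℝ} (h : NumHamLipschitz L₁ G) :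
    NumHamLipschitz L₁ (fun i p q => -G i (-p) (-q)) := by
  intro i p₁ p₂ q₁ q₂
  have := h i (-p₁) (-p₂) (-q₁) (-q₂)
  rw [show -p₁ - -q₁ = -(p₁ - q₁) by ring, show -p₂ - -q₂ = -(p₂ - q₂) by ring, abs_neg,
    abs_neg] at this
  rw [show -G i (-p₁) (-p₂) - -G i (-q₁) (-q₂) = -(G i (-p₁) (-p₂) - G i (-q₁) (-q₂)) by ring,
    abs_neg]
  exact this

theorem IsMonotoneScheme.reflect {ε h k : ℝ} {G : Fin K → ℝ → ℝ → ℝ}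
    (hm : IsMonotoneScheme ε h k G) : IsMonotoneScheme ε h k (fun i p q => -G i (-p) (-q)) := by
  intro i a b c a' b' c' ha hb hc
  have := hm i (-a') (-b') (-c') (-a) (-b) (-c) (by linarith) (by linarith) (by linarith)
  rw [show (-a' - -b') / h = -((a' - b') / h) by ring,
    show (-b' - -c') / h = -((b' - c') / h) by ring, show (-a - -b) / h = -((a - b) / h) by ring,
    show (-b - -c) / h = -((b - c) / h) by ring] at this
  rw [numF_reflect, numF_reflect]
  linarith

/-! ### Comparison and a priori bounds for the scheme -/

/-- `U i m s`, `s ≤ N`, solves the scheme with the source term `g i m s`, without prescribed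
initial values. -/
structure SolvesScheme (ε h k : ℝ) (N : ℕ) (G : Fin K → ℝ → ℝ → ℝ) (g U : Fin K → ℕ → ℕ → ℝ) :
    Prop where
  edge : ∀ i, ∀ m : ℕ, 1 ≤ m → ∀ s < N, U i m (s + 1) = U i m s
    - k * numF ε h (G i) (Dplus h (fun j => U i j s) m) (Dminus h (fun j => U i j s) m)
    + k * g i m s
  junction : ∀ j, ∀ s : ℕ, 1 ≤ s → s ≤ N → U j 0 s = (1 / (K : ℝ)) * ∑ i, U i 1 s

theorem average_le {a : Fin K → ℝ} {c : ℝ} (hK : 0 < K) (h : ∀ i, a i ≤ c) :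
    (1 / (K : ℝ)) * ∑ i, a i ≤ c := by
  have hK' : (0 : ℝ) < K := by exact_mod_cast hK
  have := Finset.sum_le_sum fun i (_ : i ∈ Finset.univ) => h i
  rw [Finset.sum_const, Finset.card_univ, Fintype.card_fin, nsmul_eq_mul] at this
  rw [one_div_mul_eq_div, div_le_iff₀ hK']
  linarith

/-- Comparison principle for the monotone scheme. -/
theorem SolvesScheme.le {ε h k : ℝ} {N : ℕ} {G : Fin K → ℝ → ℝ → ℝ}
    {g g' U W : Fin K → ℕ → ℕ → ℝ} (hU : SolvesScheme ε h k N G g U)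
    (hW : SolvesScheme ε h k N G g' W) (hk : 0 < k) (hmon : IsMonotoneScheme ε h k G) {e η : ℝ}
    (h0 : ∀ i m, U i m 0 ≤ W i m 0 + e) (hg : ∀ i m, ∀ s < N, g i m s ≤ g' i m s + η) :
    ∀ s ≤ N, ∀ i m, U i m s ≤ W i m s + (e + s * k * η) := by
  intro s
  induction s with
  | zero => intro _ i m; simpa using h0 i m
  | succ s ih =>
    intro hs i m
    have ih := ih (by omega)
    have hedge : ∀ i, ∀ m : ℕ, 1 ≤ m →
        U i m (s + 1) ≤ W i m (s + 1) + (e + (s + 1 : ℕ) * k * η) := by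
      intro i m hm
      rw [hU.edge i m hm s (by omega), hW.edge i m hm s (by omega)]
      have h1 := hmon i _ _ _ _ _ _ (ih i (m - 1)) (ih i m) (ih i (m + 1))
      have e1 : ∀ x y c : ℝ, (x + c - (y + c)) / h = (x - y) / h := by
        intro x y c; congr 1; ring
      rw [e1, e1] at h1
      have h2 := mul_le_mul_of_nonneg_left (hg i m s (by omega)) hk.le
      unfold Dplus Dminus
      push_cast
      linarith
    rcases Nat.eq_zero_or_pos m with rfl | hm
    · rw [hU.junction i (s + 1) (by omega) hs, hW.junction i (s + 1) (by omega) hs]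
      have h1 := average_le i.pos (fun j => sub_le_iff_le_add'.2 (hedge j 1 le_rfl))
      rw [Finset.sum_sub_distrib, mul_sub] at h1
      linarith
    · exact hedge i m hm

theorem SolvesScheme.abs_sub_le {ε h k : ℝ} {N : ℕ} {G : Fin K → ℝ → ℝ → ℝ}
    {g g' U W : Fin K → ℕ → ℕ → ℝ} (hU : SolvesScheme ε h k N G g U)
    (hW : SolvesScheme ε h k N G g' W) (hk : 0 < k) (hmon : IsMonotoneScheme ε h k G) {e η : ℝ}
    (h0 : ∀ i m, |U i m 0 - W i m 0| ≤ e) (hg : ∀ i m, ∀ s < N, |g i m s - g' i m s| ≤ η) :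
    ∀ s ≤ N, ∀ i m, |U i m s - W i m s| ≤ e + s * k * η := by
  intro s hs i m
  have h1 := hU.le hW hk hmon (e := e) (η := η) (fun i m => by linarith [(abs_le.1 (h0 i m)).2])
    (fun i m s hs => by linarith [(abs_le.1 (hg i m s hs)).2]) s hs i m
  have h2 := hW.le hU hk hmon (e := e) (η := η) (fun i m => by linarith [(abs_le.1 (h0 i m)).1])
    (fun i m s hs => by linarith [(abs_le.1 (hg i m s hs)).1]) s hs i m
  rw [abs_le]; constructor <;> linarith

/-- Solutions of the scheme are Lipschitz in time, with the constant given by the first step. -/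
theorem SolvesScheme.abs_succ_sub_le {ε h k : ℝ} {N : ℕ} {G : Fin K → ℝ → ℝ → ℝ}
    {g U : Fin K → ℕ → ℕ → ℝ} (hU : SolvesScheme ε h k (N + 1) G g U) (hk : 0 < k)
    (hmon : IsMonotoneScheme ε h k G) {e η : ℝ} (h0 : ∀ i m, |U i m 1 - U i m 0| ≤ e)
    (hg : ∀ i m, ∀ s < N, |g i m (s + 1) - g i m s| ≤ η) :
    ∀ s ≤ N, ∀ i m, |U i m (s + 1) - U i m s| ≤ e + s * k * η := by
  have hW : SolvesScheme ε h k N G (fun i m s => g i m (s + 1)) (fun i m s => U i m (s + 1)) :=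
    ⟨fun i m hm s hs => hU.edge i m hm (s + 1) (by omega),
      fun j s _ hs' => hU.junction j (s + 1) (by omega) (by omega)⟩
  have hU' : SolvesScheme ε h k N G g U :=
    ⟨fun i m hm s hs => hU.edge i m hm s (by omega),
      fun j s hs hs' => hU.junction j s hs (by omega)⟩
  exact hW.abs_sub_le hU' hk hmon h0 hg

/-- The slope bound for one time level: when the numerical flux is below its values at the large
slopes, slopes beyond `R` would have to decrease to `-∞` along the edge, or to increase towards the
junction.  The latter is limited by the Kirchhoff condition. -/
theorem abs_slope_le_of_flux_le {ε h k L₁ R : ℝ} {G : Fin K → ℝ → ℝ → ℝ} (hh : 0 < h)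
    (hk : 0 < k) (hε : 0 < ε) (hL₁ : 0 ≤ L₁) (hG : NumHamLipschitz L₁ G)
    (hmon : IsMonotoneScheme ε h k G) (hR : 0 ≤ R) {b : Fin K → ℝ}
    (hb : ∀ i p, R ≤ |p| → b i ≤ G i p p) {W : Fin K → ℕ → ℝ}
    (hF : ∀ i, ∀ m : ℕ, 1 ≤ m → numF ε h (G i) (Dplus h (W i) m) (Dminus h (W i) m) ≤ b i - 1 / 2)
    (hsum : ∑ i, (W i 0 - W i 1) = 0) {C : ℝ} (hC : ∀ i m, |W i m - W i (m + 1)| ≤ C)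
    (i : Fin K) (m : ℕ) : |W i m - W i (m + 1)| ≤ K * R * h := by
  set p : Fin K → ℕ → ℝ := fun i m => Dminus h (W i) m with hp
  have hF' : ∀ i m, numF ε h (G i) (p i m) (p i (m + 1)) ≤ b i - 1 / 2 := fun i m =>
    hF i (m + 1) (by omega)
  have hdiag : ∀ i P, numF ε h (G i) P P = G i P P := by intro i P; simp [numF]
  have hpW : ∀ i m, W i m - W i (m + 1) = p i m * h := by
    intro i m; simp only [hp, Dminus]; field_simp
  set γ := ε / h + L₁ with hγ
  have hγ0 : 0 < γ := add_pos_of_pos_of_nonneg (div_pos hε hh) hL₁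
  have hlow : ∀ i m, -R ≤ p i m := by
    intro i m
    by_contra hcon
    push Not at hcon
    have hstep : ∀ j : ℕ, p i (m + j) ≤ p i m - j * (1 / (2 * γ)) := by
      intro j
      induction j with
      | zero => simp
      | succ j ih =>
        set P := p i (m + j) with hP
        set P' := p i (m + j + 1) with hP'
        have hPR : P < -R := by
          have : 0 ≤ (j : ℝ) * (1 / (2 * γ)) := by positivity
          linarith
        have h1 := hb i P (by rw [abs_of_neg (by linarith)]; linarith)
        have h2 := hF' i (m + j)
        have h3 : P' < P := by
          by_contra hPP
          push Not at hPP
          have := hmon.numF_le hh hk i (le_refl P) hPP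
          rw [hdiag] at this
          linarith
        have h4 := (abs_le.1 (hG i P P P P')).2
        rw [sub_self, abs_zero, zero_add, abs_of_pos (by linarith)] at h4
        have h5 : numF ε h (G i) P P' = -(ε / h) * (P - P') + G i P P' := rfl
        have h6 : 1 / 2 ≤ γ * (P - P') := by
          rw [hγ]; linarith
        have h7 : 1 / (2 * γ) ≤ P - P' := by
          rw [div_le_iff₀ (by positivity)]; linarith
        rw [← add_assoc]
        push_cast
        linarith
    obtain ⟨j, hj⟩ := exists_nat_gt ((p i m + C / h) * (2 * γ))
    have h1 := hstep j
    have h2 := (abs_le.1 (hC i (m + j))).1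
    rw [hpW] at h2
    have h3 : -(C / h) ≤ p i (m + j) := by
      rw [← neg_div, div_le_iff₀ hh]; exact h2
    have h4 : p i m + C / h < j * (1 / (2 * γ)) := by
      rw [mul_one_div, lt_div_iff₀ (by positivity)]; exact hj
    linarith
  have hK1 : (1 : ℝ) ≤ K := by exact_mod_cast i.pos
  have hRK : R ≤ K * R := by nlinarith
  have h0 : p i 0 ≤ K * R := by
    have h1 : ∑ j, p j 0 = 0 := by
      have : (∑ j, p j 0) * h = 0 := by
        rw [Finset.sum_mul, ← hsum]
        exact Finset.sum_congr rfl fun j _ => (hpW j 0).symm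
      exact (mul_eq_zero.1 this).resolve_right hh.ne'
    have h2 : ∑ j ∈ Finset.univ.erase i, (-R) ≤ ∑ j ∈ Finset.univ.erase i, p j 0 :=
      Finset.sum_le_sum fun j _ => hlow j 0
    rw [Finset.sum_const, Finset.card_erase_of_mem (Finset.mem_univ i), Finset.card_univ,
      Fintype.card_fin, nsmul_eq_mul, Nat.cast_sub i.pos] at h2
    have h3 := Finset.add_sum_erase Finset.univ (fun j => p j 0) (Finset.mem_univ i)
    push_cast at h2
    linarith
  have hup : p i m ≤ K * R := by
    induction m with
    | zero => exact h0
    | succ m ih =>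
      by_contra hcon
      push Not at hcon
      have h1 := hb i (p i (m + 1)) (by rw [abs_of_nonneg (by linarith)]; linarith)
      have h2 := hmon.numF_le hh hk i (show p i m ≤ p i (m + 1) by linarith) (le_refl (p i (m + 1)))
      rw [hdiag] at h2
      linarith [hF' i m]
  rw [hpW, abs_mul, abs_of_pos hh]
  refine mul_le_mul_of_nonneg_right (abs_le.2 ⟨by linarith [hlow i m], hup⟩) hh.le

/-! ### Existence and regularized initial values -/

/-- One step of the scheme. -/
noncomputable def schemeStep (ε h k : ℝ) (G : Fin K → ℝ → ℝ → ℝ) (g W : Fin K → ℕ → ℝ)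
    (i : Fin K) (m : ℕ) : ℝ :=
  let W' : Fin K → ℕ → ℝ := fun i m =>
    W i m - k * numF ε h (G i) (Dplus h (W i) m) (Dminus h (W i) m) + k * g i m
  if m = 0 then (1 / (K : ℝ)) * ∑ j, W' j 1 else W' i m

/-- The solution of the scheme with initial values `W`. -/
noncomputable def schemeIterate (ε h k : ℝ) (G : Fin K → ℝ → ℝ → ℝ) (g : Fin K → ℕ → ℕ → ℝ)
    (W : Fin K → ℕ → ℝ) : ℕ → Fin K → ℕ → ℝ
  | 0 => W
  | s + 1 => schemeStep ε h k G (fun i m => g i m s) (schemeIterate ε h k G g W s)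

theorem solvesScheme_schemeIterate (ε h k : ℝ) (N : ℕ) (G : Fin K → ℝ → ℝ → ℝ)
    (g : Fin K → ℕ → ℕ → ℝ) (W : Fin K → ℕ → ℝ) :
    SolvesScheme ε h k N G g (fun i m s => schemeIterate ε h k G g W s i m) where
  edge i m hm s _ := by
    have hm0 : m ≠ 0 := by omega
    simp [schemeIterate, schemeStep, hm0]
  junction j s hs _ := by
    obtain ⟨s, rfl⟩ : ∃ r, s = r + 1 := ⟨s - 1, by omega⟩
    simp [schemeIterate, schemeStep]

/-- Initial values on the grid, constant near the junction and averaged over `n` nodes.  The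
subtraction of natural numbers is truncated on purpose: the function `v` is shifted by `2 n` nodes
away from the junction and extended by the constant `v 0`. -/
noncomputable def smoothInitial (h : ℝ) (n : ℕ) (v : ℝ → ℝ) (m : ℕ) : ℝ :=
  (1 / (n : ℝ)) * ∑ j ∈ Finset.range n, v (-((m + j - 2 * n : ℕ) * h))

section smoothInitial
variable {h ℓ : ℝ} {n : ℕ} {v : ℝ → ℝ}

theorem smoothInitial_of_le (hn : 1 ≤ n) {m : ℕ} (hm : m ≤ 1) : smoothInitial h n v m = v 0 := by
  have hn' : (0 : ℝ) < n := by exact_mod_cast hn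
  have : ∀ j ∈ Finset.range n, v (-((m + j - 2 * n : ℕ) * h)) = v 0 := by
    intro j hj
    rw [Finset.mem_range] at hj
    rw [show m + j - 2 * n = 0 by omega]
    simp
  unfold smoothInitial
  rw [Finset.sum_congr rfl this, Finset.sum_const, Finset.card_range, nsmul_eq_mul]
  field_simp

theorem abs_node_sub_le (hh : 0 < h) (hℓ : 0 ≤ ℓ)
    (hv : ∀ x ≤ 0, ∀ y ≤ 0, |v x - v y| ≤ ℓ * |x - y|) {a b d : ℕ} (h1 : a ≤ b + d)
    (h2 : b ≤ a + d) : |v (-(a * h)) - v (-(b * h))| ≤ ℓ * (d * h) := by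
  refine (hv _ (neg_nonpos.2 (by positivity)) _ (neg_nonpos.2 (by positivity))).trans ?_
  refine mul_le_mul_of_nonneg_left ?_ hℓ
  have e1 : (a : ℝ) ≤ b + d := by exact_mod_cast h1
  have e2 : (b : ℝ) ≤ a + d := by exact_mod_cast h2
  have e3 := mul_le_mul_of_nonneg_right e1 hh.le
  have e4 := mul_le_mul_of_nonneg_right e2 hh.le
  rw [abs_le]; constructor <;> linarith

theorem abs_smoothInitial_sub_le_of_forall (hn : 1 ≤ n) {m : ℕ} {a c : ℝ}
    (hac : ∀ j < n, |v (-((m + j - 2 * n : ℕ) * h)) - a| ≤ c) : |smoothInitial h n v m - a| ≤ c := by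
  have hn' : (0 : ℝ) < n := by exact_mod_cast hn
  have e : smoothInitial h n v m - a
      = (1 / (n : ℝ)) * ∑ j ∈ Finset.range n, (v (-((m + j - 2 * n : ℕ) * h)) - a) := by
    unfold smoothInitial
    rw [Finset.sum_sub_distrib, Finset.sum_const, Finset.card_range, nsmul_eq_mul, mul_sub]
    congr 1
    field_simp
  rw [e, abs_mul, abs_of_pos (by positivity : 0 < 1 / (n : ℝ)), one_div_mul_eq_div,
    div_le_iff₀ hn']
  refine (Finset.abs_sum_le_sum_abs _ _).trans ?_
  refine (Finset.sum_le_sum fun j hj => hac j (Finset.mem_range.1 hj)).trans ?_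
  rw [Finset.sum_const, Finset.card_range, nsmul_eq_mul, mul_comm]

theorem abs_smoothInitial_sub_le (hh : 0 < h) (hℓ : 0 ≤ ℓ) (hn : 1 ≤ n)
    (hv : ∀ x ≤ 0, ∀ y ≤ 0, |v x - v y| ≤ ℓ * |x - y|) (m : ℕ) :
    |smoothInitial h n v m - v (-(m * h))| ≤ ℓ * (2 * n * h) := by
  refine abs_smoothInitial_sub_le_of_forall hn fun j hj => ?_
  have := abs_node_sub_le hh hℓ hv (a := m + j - 2 * n) (b := m) (d := 2 * n) (by omega) (by omega)
  simpa using this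

/-- The difference of neighbouring values telescopes. -/
theorem smoothInitial_sub_succ (m : ℕ) :
    smoothInitial h n v m - smoothInitial h n v (m + 1)
      = (1 / (n : ℝ)) * (v (-((m - 2 * n : ℕ) * h)) - v (-((m + n - 2 * n : ℕ) * h))) := by
  unfold smoothInitial
  rw [← mul_sub, ← Finset.sum_sub_distrib]
  congr 1
  have := Finset.sum_range_sub' (fun j => v (-((m + j - 2 * n : ℕ) * h))) n
  simp only [add_zero] at this
  rw [← this]
  refine Finset.sum_congr rfl fun j _ => ?_
  rw [show m + 1 + j = m + (j + 1) by ring]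

theorem abs_smoothInitial_sub_succ_le (hh : 0 < h) (hℓ : 0 ≤ ℓ) (hn : 1 ≤ n)
    (hv : ∀ x ≤ 0, ∀ y ≤ 0, |v x - v y| ≤ ℓ * |x - y|) (m : ℕ) :
    |smoothInitial h n v m - smoothInitial h n v (m + 1)| ≤ ℓ * h := by
  have hn' : (0 : ℝ) < n := by exact_mod_cast hn
  have := abs_node_sub_le hh hℓ hv (a := m - 2 * n) (b := m + n - 2 * n) (d := n) (by omega)
    (by omega)
  rw [smoothInitial_sub_succ, abs_mul, abs_of_pos (by positivity : 0 < 1 / (n : ℝ)),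
    one_div_mul_eq_div, div_le_iff₀ hn']
  linarith

theorem abs_smoothInitial_second_difference_le (hh : 0 < h) (hℓ : 0 ≤ ℓ) (hn : 1 ≤ n)
    (hv : ∀ x ≤ 0, ∀ y ≤ 0, |v x - v y| ≤ ℓ * |x - y|) (m : ℕ) :
    |(smoothInitial h n v m - smoothInitial h n v (m + 1))
      - (smoothInitial h n v (m + 1) - smoothInitial h n v (m + 1 + 1))| ≤ 2 * ℓ / n * h := by
  have hn' : (0 : ℝ) < n := by exact_mod_cast hn
  have h1 := abs_le.1 (abs_node_sub_le hh hℓ hv (a := m - 2 * n) (b := m + 1 - 2 * n) (d := 1)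
    (by omega) (by omega))
  have h2 := abs_le.1 (abs_node_sub_le hh hℓ hv (a := m + n - 2 * n) (b := m + 1 + n - 2 * n)
    (d := 1) (by omega) (by omega))
  rw [smoothInitial_sub_succ, smoothInitial_sub_succ, ← mul_sub, abs_mul,
    abs_of_pos (by positivity : 0 < 1 / (n : ℝ)), one_div_mul_eq_div, div_le_iff₀ hn',
    show 2 * ℓ / n * h * n = 2 * ℓ * h by field_simp]
  push_cast at h1 h2
  rw [abs_le]; constructor <;> linarith

end smoothInitial

theorem abs_sub_le_of_step {a : ℕ → ℝ} {c : ℝ} {N : ℕ} (h : ∀ s < N, |a (s + 1) - a s| ≤ c) :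
    ∀ s ≤ N, |a s - a 0| ≤ s * c := by
  intro s
  induction s with
  | zero => intro _; simp
  | succ s ih =>
    intro hs
    have h1 := h s (by omega)
    have h2 := ih (by omega)
    have h3 := abs_sub_le (a (s + 1)) (a s) (a 0)
    push_cast; linarith

/-- From Lipschitz initial data one obtains, after regularization on `3 n` nodes, a solution of the
scheme with Lipschitz bounds in time and space that do not depend on the mesh. -/
theorem exists_lipschitz_solution {T M lam ℓ ε h k L₁ R : ℝ} {G : Fin K → ℝ → ℝ → ℝ}
    {f : Fin K → ℝ → ℝ → ℝ} {u₀ : Fin K → ℝ → ℝ} (hT : 0 ≤ T) (hh : 0 < h) (hk : 0 < k)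
    (hε : 0 < ε) (hL₁ : 0 ≤ L₁) (hG : NumHamLipschitz L₁ G) (hmon : IsMonotoneScheme ε h k G)
    (hR : 0 ≤ R) (hℓ : 0 ≤ ℓ) (hlam0 : 0 ≤ lam) {b : Fin K → ℝ}
    (hb : ∀ i p, R ≤ |p| → b i ≤ G i p p)
    (hbf : ∀ i, ∀ t ∈ Icc 0 T, ∀ x ≤ 0, f i t x + M + 1 ≤ b i)
    (hM : ∀ i, ∀ t ∈ Icc 0 T, ∀ x ≤ 0, ∀ p, |p| ≤ ℓ → |G i p p - f i t x| + T * lam ≤ M)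
    (hlam : ∀ i, ∀ t ∈ Icc 0 T, ∀ s ∈ Icc 0 T, ∀ x ≤ 0, |f i t x - f i s x| ≤ lam * |t - s|)
    (hu₀ : IsNetworkLipschitz ℓ u₀) {N n : ℕ} (hN : N * k ≤ T) (hn : 1 ≤ n)
    (hnε : 2 * (ε / h + L₁) * (2 * ℓ / n) ≤ 1 / 4) :
    ∃ V : Fin K → ℕ → ℕ → ℝ,
      SolvesScheme ε h k (N + 1) G (fun i m s => f i (min (s * k) T) (-(m * h))) V ∧
      (∀ i j, ∀ s ≤ N, V i 0 s = V j 0 s) ∧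
      (∀ i m, |V i m 0 - u₀ i (-(m * h))| ≤ ℓ * (2 * n * h)) ∧
      (∀ i m, ∀ s ≤ N, |V i m (s + 1) - V i m s| ≤ (M + 1 / 4) * k) ∧
      (∀ i m, ∀ s ≤ N, |V i m s - V i (m + 1) s| ≤ K * R * h) := by
  set g : Fin K → ℕ → ℕ → ℝ := fun i m s => f i (min (s * k) T) (-(m * h)) with hg
  set V : Fin K → ℕ → ℕ → ℝ := fun i m s =>
    schemeIterate ε h k G g (fun i => smoothInitial h n (u₀ i)) s i m with hV
  have hS : SolvesScheme ε h k (N + 1) G g V := solvesScheme_schemeIterate _ _ _ _ _ _ _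
  have hV0 : ∀ i m, V i m 0 = smoothInitial h n (u₀ i) m := fun i m => rfl
  have htime : ∀ s : ℕ, min ((s : ℝ) * k) T ∈ Icc 0 T := fun s =>
    ⟨le_min (by positivity) hT, min_le_right _ _⟩
  have hnode : ∀ m : ℕ, -((m : ℝ) * h) ≤ 0 := fun m => neg_nonpos.2 (by positivity)
  have hεh : 0 ≤ ε / h := (div_pos hε hh).le
  have hsl : ∀ i m, |Dminus h (fun j => V i j 0) m| ≤ ℓ := by
    intro i m
    unfold Dminus
    rw [abs_div, abs_of_pos hh, div_le_iff₀ hh]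
    exact abs_smoothInitial_sub_succ_le hh hℓ hn (hu₀.2 i) m
  -- the first time step: at the nodes `0` and `1` the initial value is the same on all edges, so that
  -- the bound at the junction follows from the one at the nodes `1`
  have hedge : ∀ i, ∀ m : ℕ, 1 ≤ m → |V i m 1 - V i m 0| ≤ (M - T * lam + 1 / 4) * k := by
    intro i m hm
    have e := hS.edge i m hm 0 (by omega)
    rw [zero_add] at e
    obtain ⟨m, rfl⟩ : ∃ r, m = r + 1 := ⟨m - 1, by omega⟩
    set p := Dminus h (fun j => V i j 0) (m + 1) with hp
    have h1 : |Dplus h (fun j => V i j 0) (m + 1) - p| ≤ 2 * ℓ / n := by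
      have := abs_smoothInitial_second_difference_le hh hℓ hn (hu₀.2 i) m
      have e1 : Dplus h (fun j => V i j 0) (m + 1) - p
          = ((V i m 0 - V i (m + 1) 0) - (V i (m + 1) 0 - V i (m + 1 + 1) 0)) / h := by
        rw [hp]; unfold Dplus Dminus; rw [Nat.add_sub_cancel]; ring
      rw [e1, abs_div, abs_of_pos hh, div_le_iff₀ hh]
      exact this
    have h2 := numF_sub_le (ε := ε) (h := h) hG hL₁ hεh i h1
      (show |p - p| ≤ 2 * ℓ / n by rw [sub_self, abs_zero]; positivity)
    have h3 := hM i _ (htime 0) _ (hnode (m + 1)) p (hsl i (m + 1))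
    have h4 : |numF ε h (G i) (Dplus h (fun j => V i j 0) (m + 1)) p - g i (m + 1) 0|
        ≤ M - T * lam + 1 / 4 := by
      have := abs_sub_le (numF ε h (G i) (Dplus h (fun j => V i j 0) (m + 1)) p) (G i p p)
        (g i (m + 1) 0)
      have h5 : |G i p p - g i (m + 1) 0| + T * lam ≤ M := h3
      linarith
    have e2 : V i (m + 1) 1 - V i (m + 1) 0
        = -(k * (numF ε h (G i) (Dplus h (fun j => V i j 0) (m + 1)) p - g i (m + 1) 0)) := by
      rw [e]; ring
    rw [e2, abs_neg, abs_mul, abs_of_pos hk, mul_comm]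
    exact mul_le_mul_of_nonneg_right h4 hk.le
  have h01 : ∀ i j, ∀ m ≤ 1, V i m 0 = u₀ j 0 := by
    intro i j m hm
    rw [hV0, smoothInitial_of_le hn hm]
    exact hu₀.1 i j
  have hfirst : ∀ i m, |V i m 1 - V i m 0| ≤ (M - T * lam + 1 / 4) * k := by
    intro i m
    rcases Nat.eq_zero_or_pos m with rfl | hm
    · rw [hS.junction i 1 le_rfl (by omega), h01 i i 0 (by omega)]
      have hK' : (K : ℝ) ≠ 0 := by
        have := i.pos
        positivity
      have e1 : (1 / (K : ℝ)) * ∑ j, (V j 1 1 - V j 1 0) = (1 / (K : ℝ)) * ∑ j, V j 1 1 - u₀ i 0 := by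
        rw [Finset.sum_sub_distrib, Finset.sum_congr rfl (fun j _ => h01 j i 1 le_rfl),
          Finset.sum_const, Finset.card_univ, Fintype.card_fin, nsmul_eq_mul]
        field_simp
      rw [← e1, abs_le]
      constructor
      · have := average_le (a := fun j => -(V j 1 1 - V j 1 0))
          (c := (M - T * lam + 1 / 4) * k) i.pos
          (fun j => by linarith [(abs_le.1 (hedge j 1 le_rfl)).1])
        rw [Finset.sum_neg_distrib, mul_neg] at this
        linarith
      · exact average_le i.pos fun j => (abs_le.1 (hedge j 1 le_rfl)).2
    · exact hedge i m hm
  have hVt : ∀ i m, ∀ s ≤ N, |V i m (s + 1) - V i m s| ≤ (M + 1 / 4) * k := by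
    intro i m s hs
    have h1 := hS.abs_succ_sub_le hk hmon (e := (M - T * lam + 1 / 4) * k) (η := lam * k) hfirst
      (fun i m s _ => by
        refine (hlam i _ (htime (s + 1)) _ (htime s) _ (hnode m)).trans ?_
        refine mul_le_mul_of_nonneg_left ?_ hlam0
        refine (abs_min_sub_min_le_max _ _ _ _).trans ?_
        rw [sub_self, abs_zero, show ((s + 1 : ℕ) : ℝ) * k - s * k = k by push_cast; ring,
          abs_of_pos hk, max_eq_left hk.le]) s hs i m
    have h2 : (s : ℝ) * k ≤ T :=
      (mul_le_mul_of_nonneg_right (by exact_mod_cast hs) hk.le).trans hN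
    have h3 := mul_le_mul_of_nonneg_right h2 (show 0 ≤ lam * k by positivity)
    linarith
  have hglue : ∀ i j, ∀ s ≤ N, V i 0 s = V j 0 s := by
    intro i j s hs
    rcases Nat.eq_zero_or_pos s with rfl | hs1
    · rw [h01 i j 0 (by omega), h01 j j 0 (by omega)]
    · rw [hS.junction i s hs1 (by omega), hS.junction j s hs1 (by omega)]
  refine ⟨V, hS, hglue, fun i m => abs_smoothInitial_sub_le hh hℓ hn (hu₀.2 i) m, hVt, ?_⟩
  -- with the time derivative bounded by `M + 1/4`, the scheme keeps the flux below `b i - 1/2`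
  intro i m s hs
  have hflux : ∀ i, ∀ m : ℕ, 1 ≤ m → numF ε h (G i) (Dplus h (fun j => V i j s) m)
      (Dminus h (fun j => V i j s) m) ≤ b i - 1 / 2 := by
    intro i m hm
    have e := hS.edge i m hm s (by omega)
    have h1 := (abs_le.1 (hVt i m s hs)).1
    have h2 := hbf i _ (htime s) _ (hnode m)
    have h3 : k * numF ε h (G i) (Dplus h (fun j => V i j s) m) (Dminus h (fun j => V i j s) m)
        ≤ k * (g i m s + (M + 1 / 4)) := by linarith
    have h4 := le_of_mul_le_mul_left h3 hk
    have h5 : g i m s + M + 1 ≤ b i := h2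
    linarith
  have hsum : ∑ j, (V j 0 s - V j 1 s) = 0 := by
    rcases Nat.eq_zero_or_pos s with rfl | hs1
    · exact Finset.sum_eq_zero fun j _ => by rw [h01 j j 0 (by omega), h01 j j 1 le_rfl, sub_self]
    · have hK' : (K : ℝ) ≠ 0 := by
        have := i.pos
        positivity
      rw [Finset.sum_sub_distrib,
        Finset.sum_congr rfl (fun j _ => hS.junction j s hs1 (by omega)), Finset.sum_const,
        Finset.card_univ, Fintype.card_fin, nsmul_eq_mul]
      field_simp
      ring
  refine abs_slope_le_of_flux_le (W := fun i m => V i m s) hh hk hε hL₁ hG hmon hR hb hflux hsum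
    (C := ℓ * h + 2 * (s * ((M + 1 / 4) * k))) ?_ i m
  intro i m
  have h1 := fun m => abs_le.1 (abs_sub_le_of_step (a := fun s => V i m s) (N := N)
    (fun s hs => hVt i m s hs.le) s hs)
  have h2 := abs_le.1 (abs_smoothInitial_sub_succ_le hh hℓ hn (hu₀.2 i) m)
  rw [← hV0, ← hV0] at h2
  have h3 := h1 m
  have h4 := h1 (m + 1)
  rw [abs_le]; constructor <;> linarith

/-- A uniformly continuous function differs from its initial values by a bounded amount, although
it need not be bounded itself. -/
theorem exists_abs_sub_initial_le {T : ℝ} (hT : 0 < T) {u : ℝ → ℝ → ℝ}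
    (hu : UniformContinuousOn (fun z : ℝ × ℝ => u z.1 z.2) (edgeDomain T)) :
    ∃ C, ∀ x ≤ 0, ∀ t ∈ Icc 0 T, |u x t - u x 0| ≤ C := by
  obtain ⟨δ, hδ, hδu⟩ := Metric.uniformContinuousOn_iff.1 hu 1 one_pos
  obtain ⟨n, hn⟩ := exists_nat_gt (T / δ)
  have hn0 : (0 : ℝ) < n := lt_trans (by positivity) hn
  refine ⟨n, fun x hx t ht => ?_⟩
  have hmem : ∀ s : ℕ, s ≤ n → t * (s / n) ∈ Icc 0 T := by
    intro s hs
    have h1 : (s : ℝ) / n ≤ 1 := by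
      rw [div_le_one hn0]; exact_mod_cast hs
    have ht0 := ht.1
    refine ⟨by positivity, ?_⟩
    calc _ ≤ t * 1 := by gcongr
      _ ≤ T := by linarith [ht.2]
  have := abs_sub_le_of_step (a := fun s : ℕ => u x (t * (s / n))) (c := 1) (N := n) (by
    intro s hs
    have h1 := hδu (x, t * ((s + 1 : ℕ) / n)) ⟨hx, hmem (s + 1) (by omega)⟩ (x, t * (s / n))
      ⟨hx, hmem s (by omega)⟩ (by
        rw [Prod.dist_eq, dist_self, max_eq_right dist_nonneg, Real.dist_eq]
        have e : t * ((s + 1 : ℕ) / n) - t * (s / n) = t / n := by push_cast; ring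
        have ht0 := ht.1
        rw [e, abs_of_nonneg (by positivity), div_lt_iff₀ hn0]
        rw [div_lt_iff₀ hδ] at hn
        linarith [ht.2])
    rw [Real.dist_eq] at h1
    exact h1.le) n le_rfl
  simpa [hn0.ne'] using this

/-- The reflected pair `(-u, -V)`. -/
theorem ComparisonPair.reflect {T A L c₀ L₁ CF ℓ E₀ z ε h k : ℝ} {G : Fin K → ℝ → ℝ → ℝ}
    {f u : Fin K → ℝ → ℝ → ℝ} {N : ℕ} {V : Fin K → ℕ → ℕ → ℝ}
    (P : ComparisonPair T A L c₀ L₁ CF ℓ E₀ G f u z ε h k N V)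
    (hsub : IsSubsolutionBelow T (A + 1 / 4) (fun i p => -G i (-p) (-p)) (fun i t x => -f i t x)
      (fun i x t => -u i x t))
    (hbdd : ∃ C, ∀ i, ∀ x ≤ 0, ∀ t ∈ Icc 0 T, u i x 0 ≤ u i x t + C)
    (hV : IsDiscreteSuper ε h k N (fun i p q => -G i (-p) (-q)) (fun i t x => -f i t x)
      (fun i m s => -V i m s))
    (hinit : ∀ i, ∀ x ≤ 0, ∀ m : ℕ, V i m 0 - u i x 0 ≤ ℓ * |x + m * h| + E₀ * z) :
    ComparisonPair T A L c₀ L₁ CF ℓ E₀ (fun i p q => -G i (-p) (-q)) (fun i t x => -f i t x)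
      (fun i x t => -u i x t) z ε h k N (fun i m s => -V i m s) where
  T_pos := P.T_pos
  A_nonneg := P.A_nonneg
  L_nonneg := P.L_nonneg
  c₀_nonneg := P.c₀_nonneg
  L₁_nonneg := P.L₁_nonneg
  ℓ_nonneg := P.ℓ_nonneg
  E₀_nonneg := P.E₀_nonneg
  f_lip i t ht s hs x hx y hy := by
    have := P.f_lip i t ht s hs x hx y hy
    rwa [show -f i t x - -f i s y = -(f i t x - f i s y) by ring, abs_neg]
  G_lip := P.G_lip.reflect
  u_glue i j t ht := by simp only [P.u_glue i j t ht]
  u_cont i := (P.u_cont i).neg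
  u_sub := hsub
  u_bdd := by
    obtain ⟨C, hC⟩ := hbdd
    exact ⟨C, fun i x hx t ht => by linarith [hC i x hx t ht]⟩
  z_pos := P.z_pos
  z_le := P.z_le
  z_le_T := P.z_le_T
  h_pos := P.h_pos
  h_le := P.h_le
  k_pos := P.k_pos
  k_le := P.k_le
  ε_pos := P.ε_pos
  CF_le := P.CF_le
  mono := P.mono.reflect
  N_pos := P.N_pos
  N_le := P.N_le
  T_lt := P.T_lt
  V_super := hV
  V_space i m s hs := by
    have := P.V_space i m s hs
    rwa [show -V i m s - -V i (m + 1) s = -(V i m s - V i (m + 1) s) by ring, abs_neg]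
  V_time i m s hs := by
    have := P.V_time i m s hs
    rwa [show -V i m (s + 1) - -V i m s = -(V i m (s + 1) - V i m s) by ring, abs_neg]
  initial i x hx m := by
    have := hinit i x hx m
    linarith

/-! ### The two-sided error estimate -/

theorem IsSchemeSolution.solvesScheme {T ε h k : ℝ} {G : Fin K → ℝ → ℝ → ℝ}
    {f : Fin K → ℝ → ℝ → ℝ} {u₀ : Fin K → ℝ → ℝ} {U : Fin K → ℕ → ℕ → ℝ}
    (hU : IsSchemeSolution T ε h k G f u₀ U) (hk : 0 < k) {N : ℕ} (hN : N ≤ numSteps T k) :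
    SolvesScheme ε h k N G (fun i m s => f i (s * k) (-(m * h))) U where
  edge i m hm s hs := by
    have := hU.edge i m hm s (by omega)
    rw [sub_eq_zero, ← eq_sub_iff_add_eq, div_eq_iff hk.ne'] at this
    linarith
  junction j s hs hs' := hU.junction j s hs (by omega)

theorem NumHamLipschitz.continuous_diag {L₁ : ℝ} {G : Fin K → ℝ → ℝ → ℝ}
    (hG : NumHamLipschitz L₁ G) (i : Fin K) : Continuous fun p => G i p p := by
  refine (LipschitzWith.of_dist_le' (K := 2 * L₁) fun p q => ?_).continuous
  rw [Real.dist_eq, Real.dist_eq]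
  have := hG i p p q q
  linarith

/-- The error estimate on a given mesh with `Δx = z ^ 6`, with explicit constants. -/
theorem mesh_estimate {T M lam ℓ c₀ L₁ CF R ε z k A L E₀ D E Λ B Q C : ℝ} {H : Fin K → ℝ → ℝ}
    {f : Fin K → ℝ → ℝ → ℝ} {u₀ : Fin K → ℝ → ℝ} {G : Fin K → ℝ → ℝ → ℝ}
    {u : Fin K → ℝ → ℝ → ℝ} {b : Fin K → ℝ} (hT : 0 < T) (hL₁ : 0 < L₁)
    (hG : NumHamLipschitz L₁ G) (hR : 0 ≤ R) (hℓ : 0 ≤ ℓ) (hlam0 : 0 ≤ lam) (hM0 : 0 ≤ M)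
    (hc₀ : 0 ≤ c₀) (hmin : ∀ i p, G i p p = min (H i p) (b i))
    (hb : ∀ i p, R ≤ |p| → b i ≤ H i p)
    (hbf : ∀ i, ∀ t ∈ Icc 0 T, ∀ x ≤ 0, f i t x + M + 1 ≤ b i)
    (hM : ∀ i, ∀ t ∈ Icc 0 T, ∀ x ≤ 0, ∀ p, |p| ≤ ℓ → |H i p - f i t x| + T * lam ≤ M)
    (hlam : ∀ i, ∀ t ∈ Icc 0 T, ∀ s ∈ Icc 0 T, ∀ x ≤ 0, |f i t x - f i s x| ≤ lam * |t - s|)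
    (hf : ∀ i, ∀ t ∈ Icc 0 T, ∀ s ∈ Icc 0 T, ∀ x ≤ 0, ∀ y ≤ 0,
      |f i t x - f i s y| ≤ c₀ * (|t - s| + |x - y|))
    (hu₀ : IsNetworkLipschitz ℓ u₀) (hu : IsCauchySolution T (separated H f) u₀ u)
    (hA : A = M + 1 / 4) (hL : L = K * R) (hE₀ : E₀ = 4 * ℓ) (hQ : Q = K * R + 1 + R)
    (hB : B = K * Q) (hD : D = 2 * L + 2 * B + 5) (hE : E = L * (2 * L + 2) + (L + 2) ^ 2 + 1)
    (hΛ : 4 * D + 2 * L₁ + 1 + 32 * CF * (B + 1) ^ 2 + c₀ * (D + 2 * A + 5) < Λ / 2)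
    (hΛ' : 2 * L₁ + c₀ * (2 * A + 2 * L + 5) + 1 + CF < Λ)
    (hC : C = (ℓ * (2 * L + 2) + E₀ + 2 * A * (A + 1))
        + (ℓ + E₀ + 2 * L + A * (D + 2 * (A + 1)) + 2 * (B + 2) + (A + 1) * D)
        + L * (2 * L + 2) + (L + 1) ^ 2 + (A + 1) ^ 2 + Λ * T + 1)
    (hz : 0 < z) (hz1 : z ≤ 1) (hzT : z ≤ T) (hzL : z ≤ L₁ / 25)
    (small₁ : (4 * D + Λ) * z ≤ 1 / 16) (small₂ : 4 * E * z ≤ 1)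
    (small₃ : 16 * (B + 1) ^ 2 * z < 1) (small₄ : 16 * CF * ℓ * z ≤ 1)
    (hk : 0 < k) (hε : 0 < ε) (hεL : 4 * L₁ ≤ 2 * ε / z ^ 6) (hεk : 2 * ε / z ^ 6 ≤ z ^ 6 / k)
    (hCF : ε / z ^ 6 + L₁ ≤ CF) (hmon : IsMonotoneScheme ε (z ^ 6) k G)
    {U : Fin K → ℕ → ℕ → ℝ} (hU : IsSchemeSolution T ε (z ^ 6) k G f u₀ U)
    (i : Fin K) (m s : ℕ) (hs : s * k ≤ T) :
    |U i m s - u i (-(m * z ^ 6)) (s * k)| ≤ (C + 4 * ℓ) * z := by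
  obtain ⟨h, hh⟩ : ∃ h, h = z ^ 6 := ⟨_, rfl⟩
  rw [← hh] at hεL hεk hCF hmon hU ⊢
  have hh0 : 0 < h := by rw [hh]; positivity
  have hK1 : (1 : ℝ) ≤ K := by exact_mod_cast i.pos
  have hKR : 0 ≤ K * R := by positivity
  have hCF0 : 0 ≤ CF := (add_nonneg (div_pos hε hh0).le hL₁.le).trans hCF
  -- the mesh condition gives `4 L₁ k ≤ h`, where `h = z⁶` and `z ≤ L₁ / 25`
  have hk5 : k ≤ z ^ 5 / 100 := by
    have h1 := hεL.trans hεk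
    rw [le_div_iff₀ hk] at h1
    have h2 : z ^ 6 ≤ L₁ / 25 * z ^ 5 := by
      rw [show z ^ 6 = z * z ^ 5 by ring]; gcongr
    have h3 : L₁ * k ≤ L₁ * (z ^ 5 / 100) := by linarith
    exact le_of_mul_le_mul_left h3 hL₁
  -- `N` is the last time level before `T`, at most the number `⌈T / k⌉` of time steps
  set N := ⌊T / k⌋₊ with hNdef
  have hTk : 0 ≤ T / k := by positivity
  have hN1 : (N : ℝ) * k ≤ T := by
    have := Nat.floor_le hTk
    rwa [le_div_iff₀ hk] at this
  have hN2 : T < N * k + k := by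
    have := Nat.lt_floor_add_one (T / k)
    rw [div_lt_iff₀ hk] at this
    linarith
  have hNpos : 1 ≤ N := by
    rw [hNdef, Nat.one_le_floor_iff, le_div_iff₀ hk, one_mul]
    have : z ^ 5 ≤ z := by simpa using pow_le_pow_of_le_one hz.le hz1 (show 1 ≤ 5 by norm_num)
    linarith
  have hNs : N ≤ numSteps T k := Nat.floor_le_ceil _
  have hsN : s ≤ N := by
    rw [hNdef, Nat.le_floor_iff hTk, le_div_iff₀ hk]; exact hs
  -- averaging over `n ≈ z⁻³` nodes moves the initial values by `2 ℓ n h = O(z³)` and leaves second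
  -- differences of size `ℓ h / n`, small enough for the numerical viscosity
  set n := ⌈1 / z ^ 3⌉₊ with hndef
  have hz3 : 0 < z ^ 3 := by positivity
  have hn1 : 1 ≤ n := Nat.one_le_iff_ne_zero.2 (Nat.ceil_pos.2 (by positivity)).ne'
  have hn0 : (0 : ℝ) < n := by exact_mod_cast hn1
  have hnz : 1 ≤ n * z ^ 3 := by
    have := Nat.le_ceil (1 / z ^ 3)
    rwa [div_le_iff₀ hz3] at this
  have hz31 : z ^ 3 ≤ z := by simpa using pow_le_pow_of_le_one hz.le hz1 (show 1 ≤ 3 by norm_num)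
  have hnh : n * h ≤ 2 * z := by
    have := Nat.ceil_lt_add_one (show 0 ≤ 1 / z ^ 3 by positivity)
    have h1 : (n : ℝ) * h ≤ (1 / z ^ 3 + 1) * h := by gcongr
    have h2 : (1 / z ^ 3 + 1) * h = z ^ 3 + z ^ 6 := by rw [hh]; field_simp
    have h3 : z ^ 6 ≤ z := by simpa using pow_le_pow_of_le_one hz.le hz1 (show 1 ≤ 6 by norm_num)
    linarith
  have hnε : 2 * (ε / h + L₁) * (2 * ℓ / n) ≤ 1 / 4 := by
    have h1 : 2 * ℓ / n ≤ 2 * ℓ * z := by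
      rw [div_le_iff₀ hn0]
      have h2 : 1 ≤ n * z := hnz.trans (by gcongr)
      have h3 := mul_le_mul_of_nonneg_left h2 (show 0 ≤ 2 * ℓ by positivity)
      linarith
    calc _ ≤ 2 * CF * (2 * ℓ * z) := by gcongr
      _ ≤ 1 / 4 := by linarith
  have hGb : ∀ i p, R ≤ |p| → b i ≤ G i p p := fun i p hp => by
    rw [hmin]; exact le_min (hb i p hp) le_rfl
  have hMG : ∀ i, ∀ t ∈ Icc 0 T, ∀ x ≤ 0, ∀ p, |p| ≤ ℓ → |G i p p - f i t x| + T * lam ≤ M := by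
    intro i t ht x hx p hp
    have h1 := hM i t ht x hx p hp
    have h2 := hbf i t ht x hx
    have h3 := (abs_le.1 (show |H i p - f i t x| ≤ M by
      have : 0 ≤ T * lam := by positivity
      linarith)).2
    rw [hmin, min_eq_left (by linarith)]
    exact h1
  obtain ⟨V, hVS, hVglue, hV0, hVt, hVx⟩ := exists_lipschitz_solution hT.le hh0 hk hε hL₁.le hG hmon
    hR hℓ hlam0 hGb hbf hMG hlam hu₀ hN1 hn1 hnε
  have hV0' : ∀ i m, |V i m 0 - u₀ i (-(m * h))| ≤ E₀ * z := by
    intro i m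
    refine (hV0 i m).trans ?_
    rw [hE₀]
    have := mul_le_mul_of_nonneg_left hnh (show 0 ≤ 2 * ℓ by positivity)
    linarith
  have hmink : ∀ s < N, min ((s : ℝ) * k) T = s * k := by
    intro s hs
    refine min_eq_left (le_trans ?_ hN1)
    exact mul_le_mul_of_nonneg_right (by exact_mod_cast hs.le) hk.le
  -- by the comparison principle `U` stays as close to `V` as it is initially
  have hUV : |U i m s - V i m s| ≤ E₀ * z := by
    have hVN : SolvesScheme ε h k N G (fun i m s => f i (min (s * k) T) (-(m * h))) V :=
      ⟨fun i m hm s hs => hVS.edge i m hm s (by omega),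
        fun j s hs hs' => hVS.junction j s hs (by omega)⟩
    have := (hU.solvesScheme hk hNs).abs_sub_le hVN hk hmon (e := E₀ * z) (η := 0)
      (fun i m => by rw [hU.initial, abs_sub_comm]; exact hV0' i m)
      (fun i m s hs => by simp only [hmink s hs, sub_self, abs_zero, le_refl]) s hsN i m
    simpa using this
  -- `V` is both a super- and a subsolution of the scheme, so that `(u, V)` and `(-u, -V)` are
  -- comparison pairs
  have hedge : ∀ i, ∀ m : ℕ, 1 ≤ m → ∀ s < N, f i (s * k) (-(m * h)) = (V i m (s + 1) - V i m s) / k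
      + numF ε h (G i) (Dplus h (fun j => V i j s) m) (Dminus h (fun j => V i j s) m) := by
    intro i m hm s hs
    rw [hVS.edge i m hm s (by omega), hmink s hs]
    field_simp
    ring
  have hjun : ∀ s : ℕ, 1 ≤ s → s ≤ N → ∑ i, (V i 1 s - V i 0 s) = 0 := by
    intro s hs hs'
    rw [Finset.sum_sub_distrib,
      Finset.sum_congr rfl (fun j _ => hVS.junction j s hs (by omega)), Finset.sum_const,
      Finset.card_univ, Fintype.card_fin, nsmul_eq_mul]
    field_simp
    ring
  have hbdd : ∃ C, ∀ i, ∀ x ≤ 0, ∀ t ∈ Icc 0 T, |u i x t - u i x 0| ≤ C := by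
    choose c hc using fun i => exists_abs_sub_initial_le hT (hu.uniformContinuousOn i)
    refine ⟨∑ i, |c i|, fun i x hx t ht => (hc i x hx t ht).trans ((le_abs_self _).trans ?_)⟩
    exact Finset.single_le_sum (f := fun i => |c i|) (fun j _ => abs_nonneg _) (Finset.mem_univ i)
  obtain ⟨Cu, hCu⟩ := hbdd
  have hinit : ∀ i, ∀ x ≤ 0, ∀ m : ℕ, |u i x 0 - V i m 0| ≤ ℓ * |x + m * h| + E₀ * z := by
    intro i x hx m
    have h1 := hV0' i m
    have h2 := hu₀.2 i x hx (-(m * h)) (neg_nonpos.2 (by positivity))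
    rw [sub_neg_eq_add] at h2
    rw [hu.initial i x hx]
    have h3 := abs_sub_le (u₀ i x) (u₀ i (-(m * h))) (V i m 0)
    rw [abs_sub_comm (u₀ i (-(m * h)))] at h3
    linarith
  have hA14 : A + 1 / 4 = M + 1 / 2 := by rw [hA]; ring
  have P : ComparisonPair T A L c₀ L₁ CF ℓ E₀ G f u z ε h k N V :=
    { T_pos := hT
      A_nonneg := by rw [hA]; positivity
      L_nonneg := by rw [hL]; exact hKR
      c₀_nonneg := hc₀
      L₁_nonneg := hL₁.le
      ℓ_nonneg := hℓ
      E₀_nonneg := by rw [hE₀]; positivity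
      f_lip := hf
      G_lip := hG
      u_glue := hu.glue
      u_cont := fun i => (hu.uniformContinuousOn i).continuousOn
      u_sub := hu.subsolution.below fun i p => by rw [hmin]; exact min_le_left _ _
      u_bdd := ⟨Cu, fun i x hx t ht => by linarith [(abs_le.1 (hCu i x hx t ht)).2]⟩
      z_pos := hz
      z_le := hz1
      z_le_T := hzT
      h_pos := hh0
      h_le := hh.le
      k_pos := hk
      k_le := hk5
      ε_pos := hε
      CF_le := hCF
      mono := hmon
      N_pos := hNpos
      N_le := hN1
      T_lt := hN2
      V_super := ⟨hVglue, fun i m hm s hs => (hedge i m hm s hs).le,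
        fun s hs hs' => (hjun s hs hs').le⟩
      V_space := fun i m s hs => by rw [hL]; exact hVx i m s hs
      V_time := fun i m s hs => by rw [hA]; exact hVt i m s hs.le
      initial := fun i x hx m => (abs_le.1 (hinit i x hx m)).2 }
  have P' := P.reflect
    (hu.supersolution.reflect_below b hmin fun i t ht x hx => by
      have := hbf i t ht x hx
      rw [hA14]; linarith)
    ⟨Cu, fun i x hx t ht => by linarith [(abs_le.1 (hCu i x hx t ht)).1]⟩
    ⟨fun i j s hs => by simp only [hVglue i j s hs], fun i m hm s hs => by
        have e1 : Dplus h (fun j => -V i j s) m = -Dplus h (fun j => V i j s) m := by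
          unfold Dplus; ring
        have e2 : Dminus h (fun j => -V i j s) m = -Dminus h (fun j => V i j s) m := by
          unfold Dminus; ring
        rw [e1, e2, numF_reflect, neg_neg, neg_neg, hedge i m hm s hs]
        apply le_of_eq; ring,
      fun s hs hs' => by
        have := hjun s hs hs'
        rw [← neg_eq_zero, ← Finset.sum_neg_distrib] at this
        refine le_of_eq (Eq.trans (Finset.sum_congr rfl fun j _ => ?_) this)
        ring⟩
    (fun i x hx m => by linarith [(abs_le.1 (hinit i x hx m)).1])
  have hQ0 : 0 ≤ Q := by rw [hQ]; positivity
  have hB0 : 0 ≤ B := by rw [hB]; positivity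
  have hSA : SlopeAlternative T (A + 1 / 4) L B (fun i p => G i p p) f := by
    rw [hB]
    refine slopeAlternative_of_coercive i.pos hG.continuous_diag (by rw [hL, hQ]; linarith) hQ0 ?_
    intro i t ht τ hτ p hp
    have h1 := hGb i p (by rw [hQ] at hp; linarith)
    have h2 := hbf i t ht 0 le_rfl
    have h3 := (abs_le.1 hτ).1
    rw [hA14] at h3
    linarith
  have r1 := P.sub_le hSA hB0 hD hE hΛ small₁ small₂ small₃ hΛ' i m s hsN
  have r2 := P'.sub_le hSA.reflect hB0 hD hE hΛ small₁ small₂ small₃ hΛ' i m s hsN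
  rw [← hC] at r1 r2
  have r3 := abs_le.1 hUV
  rw [hE₀] at r3
  rw [abs_le]; constructor <;> linarith

end KirchhoffHJ

theorem theorem4 {K : ℕ} (T : ℝ) (hT : 0 < T)
    (H : Fin K → ℝ → ℝ) (f : Fin K → ℝ → ℝ → ℝ) (u₀ : Fin K → ℝ → ℝ)
    -- the assumptions on the Hamiltonians `H i p - f i t x`
    (hLip : KirchhoffHJ.HamLocallyLipschitz T (KirchhoffHJ.separated H f))
    (hCoercive : KirchhoffHJ.HamCoercive T (KirchhoffHJ.separated H f))
    (hLipST : KirchhoffHJ.HamLipschitzSpaceTime T (KirchhoffHJ.separated H f))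
    -- the initial datum is Lipschitz
    (ℓ : ℝ) (hu₀ : KirchhoffHJ.IsNetworkLipschitz ℓ u₀)
    -- `lam` is a Lipschitz constant in time of the source terms, and `M` dominates the
    -- a priori bound for the time derivative of the solution
    (lam : ℝ) (hlam : ∀ i : Fin K, ∀ t ∈ Set.Icc 0 T, ∀ s ∈ Set.Icc 0 T, ∀ x ≤ 0,
      |f i t x - f i s x| ≤ lam * |t - s|)
    (M : ℝ) (hM : ∀ i : Fin K, ∀ t ∈ Set.Icc 0 T, ∀ x ≤ 0, ∀ p : ℝ, |p| ≤ ℓ →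
      |KirchhoffHJ.separated H f i t x p| + T * lam ≤ M)
    -- the numerical Hamiltonians
    (G : Fin K → ℝ → ℝ → ℝ) (L₁ : ℝ) (hGLip : KirchhoffHJ.NumHamLipschitz L₁ G)
    (hGcons : KirchhoffHJ.NumHamConsistent T M H f G)
    (L₂ : ℝ)
    -- the viscosity solution of the Cauchy problem
    (u : Fin K → ℝ → ℝ → ℝ)
    (hu : KirchhoffHJ.IsCauchySolution T (KirchhoffHJ.separated H f) u₀ u) :
    ∃ C : ℝ, 0 < C ∧ ∃ δ : ℝ, 0 < δ ∧
      ∀ ε Δx Δt : ℝ, 0 < ε → 0 < Δx → 0 < Δt → Δx < δ →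
        4 * L₁ ≤ 2 * ε / Δx → 2 * ε / Δx ≤ Δx / Δt → Δx / Δt ≤ L₂ →
        KirchhoffHJ.IsMonotoneScheme ε Δx Δt G →
        ∀ U : Fin K → ℕ → ℕ → ℝ, KirchhoffHJ.IsSchemeSolution T ε Δx Δt G f u₀ U →
          ∀ i : Fin K, ∀ m s : ℕ, s ≤ KirchhoffHJ.numSteps T Δt → s * Δt ≤ T →
            |U i m s - u i (-(m * Δx)) (s * Δt)| ≤ C * Δx ^ (1 / 6 : ℝ) := by
  rcases isEmpty_or_nonempty (Fin K) with hK | ⟨⟨i₀⟩⟩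
  · exact ⟨1, one_pos, 1, one_pos, fun _ _ _ _ _ _ _ _ _ _ _ _ _ i => hK.elim i⟩
  have h0T : (0 : ℝ) ∈ Icc 0 T := ⟨le_rfl, hT.le⟩
  have hTT : T ∈ Icc 0 T := ⟨hT.le, le_rfl⟩
  have hℓ : 0 ≤ ℓ := by
    have := (abs_nonneg _).trans (hu₀.2 i₀ 0 le_rfl (-1) (by norm_num))
    simpa using this
  have hlam0 : 0 ≤ lam := by
    have := (abs_nonneg _).trans (hlam i₀ T hTT 0 h0T 0 le_rfl)
    rw [sub_zero, abs_of_pos hT] at this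
    exact nonneg_of_mul_nonneg_left this hT
  have hM' : ∀ i, ∀ t ∈ Icc 0 T, ∀ x ≤ 0, ∀ p, |p| ≤ ℓ → |H i p - f i t x| + T * lam ≤ M := hM
  have hTlam : 0 ≤ T * lam := by positivity
  have hM0 : 0 ≤ M := by
    have := hM' i₀ 0 h0T 0 le_rfl 0 (by simpa using hℓ)
    linarith [abs_nonneg (H i₀ 0 - f i₀ 0 0)]
  obtain ⟨c₀, hc₀, hcf⟩ := hLipST 1 one_pos
  have hf : ∀ i, ∀ t ∈ Icc 0 T, ∀ s ∈ Icc 0 T, ∀ x ≤ 0, ∀ y ≤ 0,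
      |f i t x - f i s y| ≤ c₀ * (|t - s| + |x - y|) := by
    intro i t ht s hs x hx y hy
    have := hcf i t ht s hs x hx y hy 0 (by simp)
    simp only [KirchhoffHJ.separated, abs_zero, add_zero, mul_one] at this
    rw [abs_sub_comm, show f i s y - f i t x = H i 0 - f i t x - (H i 0 - f i s y) by ring,
      add_comm |t - s|]
    exact this
  -- `b i` is the truncation level of the Hamiltonians; it exceeds `f + M` by `1`
  obtain ⟨b, hbdef⟩ : ∃ b : Fin K → ℝ, ∀ i, b i = M + KirchhoffHJ.supAbs T (f i) + 1 :=
    ⟨_, fun _ => rfl⟩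
  have hmin : ∀ i p, G i p p = min (H i p) (b i) := fun i p => by rw [hbdef]; exact hGcons i p
  have hbf : ∀ i, ∀ t ∈ Icc 0 T, ∀ x ≤ 0, f i t x + M + 1 ≤ b i := by
    intro i t ht x hx
    have hbdd : BddAbove {y : ℝ | ∃ t ∈ Icc 0 T, ∃ x ≤ (0 : ℝ), y = |f i t x|} := by
      refine ⟨|H i 0| + M, ?_⟩
      rintro _ ⟨t, ht, x, hx, rfl⟩
      have h1 := hM' i t ht x hx 0 (by simpa using hℓ)
      have h2 := abs_sub_abs_le_abs_sub (f i t x) (H i 0)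
      rw [abs_sub_comm] at h2
      linarith
    have : |f i t x| ≤ KirchhoffHJ.supAbs T (f i) := le_csSup hbdd ⟨t, ht, x, hx, rfl⟩
    rw [hbdef]
    linarith [le_abs_self (f i t x)]
  choose R' hR' using fun i => hCoercive i (b i - f i 0 0)
  obtain ⟨R, hRdef⟩ : ∃ R, R = ∑ i, |R' i| := ⟨_, rfl⟩
  have hR : 0 ≤ R := hRdef ▸ Finset.sum_nonneg fun i _ => abs_nonneg _
  have hb : ∀ i p, R ≤ |p| → b i ≤ H i p := by
    intro i p hp
    have h1 : |R' i| ≤ R := hRdef ▸ Finset.single_le_sum (f := fun i => |R' i|)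
      (fun j _ => abs_nonneg _) (Finset.mem_univ i)
    have h2 := hR' i 0 h0T 0 le_rfl p (by linarith [le_abs_self (R' i)])
    simp only [KirchhoffHJ.separated] at h2
    linarith
  -- a constant `G i₀` would contradict coercivity
  have hL₁ : 0 < L₁ := by
    by_contra hcon
    have h1 := hGLip i₀ R R 0 0
    have h2 : L₁ * (|R - 0| + |R - 0|) ≤ 0 :=
      mul_nonpos_of_nonpos_of_nonneg (not_lt.1 hcon) (by positivity)
    have h3 := (abs_le.1 (h1.trans h2)).2
    have h4 := hM' i₀ 0 h0T 0 le_rfl 0 (by simpa using hℓ)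
    have h5 := hbf i₀ 0 h0T 0 le_rfl
    have h6 := (abs_le.1 (show |H i₀ 0 - f i₀ 0 0| ≤ M by linarith)).2
    rw [hmin, hmin, min_eq_right (hb i₀ R (le_abs_self R)), min_eq_left (by linarith)] at h3
    linarith
  have hK1 : (1 : ℝ) ≤ K := by exact_mod_cast i₀.pos
  obtain ⟨CF, hCFdef⟩ : ∃ c, c = |L₂| / 2 + L₁ := ⟨_, rfl⟩
  obtain ⟨A, hA⟩ : ∃ c, c = M + 1 / 4 := ⟨_, rfl⟩
  obtain ⟨L, hL⟩ : ∃ c, c = K * R := ⟨_, rfl⟩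
  obtain ⟨E₀, hE₀⟩ : ∃ c, c = 4 * ℓ := ⟨_, rfl⟩
  obtain ⟨Q, hQ⟩ : ∃ c, c = K * R + 1 + R := ⟨_, rfl⟩
  obtain ⟨B, hB⟩ : ∃ c, c = K * Q := ⟨_, rfl⟩
  obtain ⟨D, hD⟩ : ∃ c, c = 2 * L + 2 * B + 5 := ⟨_, rfl⟩
  obtain ⟨E, hE⟩ : ∃ c, c = L * (2 * L + 2) + (L + 2) ^ 2 + 1 := ⟨_, rfl⟩
  have hCF0 : 0 ≤ CF := by rw [hCFdef]; positivity
  have hA0 : 0 ≤ A := by rw [hA]; positivity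
  have hL0 : 0 ≤ L := by rw [hL]; positivity
  have hE₀0 : 0 ≤ E₀ := by rw [hE₀]; positivity
  have hQ0 : 0 ≤ Q := by rw [hQ]; positivity
  have hB0 : 0 ≤ B := by rw [hB]; positivity
  have hD0 : 0 ≤ D := by rw [hD]; positivity
  have hE0 : 0 ≤ E := by rw [hE]; positivity
  obtain ⟨a₁, ha₁⟩ : ∃ c,
    c = 4 * D + 2 * L₁ + 1 + 32 * CF * (B + 1) ^ 2 + c₀ * (D + 2 * A + 5) := ⟨_, rfl⟩
  obtain ⟨a₂, ha₂⟩ : ∃ c, c = 2 * L₁ + c₀ * (2 * A + 2 * L + 5) + 1 + CF := ⟨_, rfl⟩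
  have ha₁0 : 0 ≤ a₁ := by rw [ha₁]; positivity
  have ha₂0 : 0 ≤ a₂ := by rw [ha₂]; positivity
  obtain ⟨Λ, hΛdef⟩ : ∃ c, c = 2 * a₁ + a₂ + 1 := ⟨_, rfl⟩
  have hΛ0 : 0 ≤ Λ := by rw [hΛdef]; positivity
  obtain ⟨C, hC⟩ : ∃ c, c = (ℓ * (2 * L + 2) + E₀ + 2 * A * (A + 1))
        + (ℓ + E₀ + 2 * L + A * (D + 2 * (A + 1)) + 2 * (B + 2) + (A + 1) * D)
        + L * (2 * L + 2) + (L + 1) ^ 2 + (A + 1) ^ 2 + Λ * T + 1 := ⟨_, rfl⟩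
  have hC0 : 0 < C := by rw [hC]; positivity
  -- the mesh has to be finer than `Ω⁻¹ ^ 6`
  obtain ⟨Ω, hΩ⟩ : ∃ c, c = 1 + 1 / T + 25 / L₁ + 16 * (4 * D + Λ) + 4 * E + 16 * (B + 1) ^ 2
    + 16 * CF * ℓ := ⟨_, rfl⟩
  have p1 : 0 ≤ 1 / T := by positivity
  have p2 : 0 ≤ 25 / L₁ := by positivity
  have p3 : 0 ≤ 16 * (4 * D + Λ) := by positivity
  have p4 : 0 ≤ 4 * E := by positivity
  have p5 : 0 ≤ 16 * (B + 1) ^ 2 := by positivity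
  have p6 : 0 ≤ 16 * CF * ℓ := by positivity
  have hΩ0 : 0 < Ω := by rw [hΩ]; positivity
  refine ⟨C + 4 * ℓ, by positivity, Ω⁻¹ ^ 6, by positivity, ?_⟩
  intro ε h k hε hh hk hδ hεL hεk hkL hmon U hU i m s _ hsT
  obtain ⟨z, hzdef⟩ : ∃ z, z = h ^ (1 / 6 : ℝ) := ⟨_, rfl⟩
  have hz : 0 < z := by rw [hzdef]; positivity
  have hz6 : h = z ^ 6 := by
    rw [hzdef, ← Real.rpow_natCast, ← Real.rpow_mul hh.le]
    norm_num
  rw [← hzdef]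
  clear hzdef
  subst hz6
  have hzΩ : z < Ω⁻¹ := lt_of_pow_lt_pow_left₀ 6 (by positivity) hδ
  have hzΩ' : Ω * z < 1 := by
    rw [lt_inv_comm₀ hz hΩ0] at hzΩ
    calc Ω * z < z⁻¹ * z := by gcongr
      _ = 1 := inv_mul_cancel₀ hz.ne'
  have hsmall : ∀ c, c ≤ Ω → c * z < 1 := fun c hc =>
    (mul_le_mul_of_nonneg_right hc hz.le).trans_lt hzΩ'
  have s0 := hsmall 1 (by linarith)
  have s1 := hsmall (1 / T) (by linarith)
  have s2 := hsmall (25 / L₁) (by linarith)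
  have s3 := hsmall (16 * (4 * D + Λ)) (by linarith)
  have s4 := hsmall (4 * E) (by linarith)
  have s5 := hsmall (16 * (B + 1) ^ 2) (by linarith)
  have s6 := hsmall (16 * CF * ℓ) (by linarith)
  rw [div_mul_eq_mul_div, div_lt_one hT] at s1
  rw [div_mul_eq_mul_div, div_lt_one hL₁] at s2
  refine KirchhoffHJ.mesh_estimate (b := b) hT hL₁ hGLip hR hℓ hlam0 hM0 hc₀.le hmin hb hbf hM' hlam
    hf hu₀ hu hA hL hE₀ hQ hB hD hE (Λ := Λ) (by linarith) (by linarith) hC hz (by linarith)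
    (by linarith) (by linarith) (by linarith) s4.le s5 s6.le hk hε hεL hεk ?_ hmon hU i m s hsT
  have e1 : 2 * ε / z ^ 6 = 2 * (ε / z ^ 6) := by ring
  rw [e1] at hεk
  linarith [le_abs_self L₂]
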